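/- Let $n\ge 2$ and $s\in\mathbb R$. Let $\mathbb H^n=\{x\in\mathbb R^{1,n}:\ -x_0^2+x_1^2+\dots+x_n^2=-1,\ x_0>0\}$ with the induced hyperbolic metric $b$, let $r=\sqrt{x_1^2+\dots+x_n^2}$, $\mathbb H^n_s=\{x\in\mathbb H^n: x_1\le s\}$, $\Sigma_s=\partial\mathbb H^n_s=\{x_1=s\}$, with $b$-outward unit normal $\eta_s$, and $\lambda_s=s/\sqrt{1+s^2}$ (so that the second fundamental form of $\Sigma_s$ is $\lambda_s b|_{\Sigma_s}$). Let $\mathcal N_{b,s}$ be the space of static potentials of $(\mathbb H^n_s,b,\Sigma_s)$, i.e. of the functions $V$ on $\mathbb H^n_s$, smooth up to the boundary, with $$\nabla_b^2V-nVb-V\,\mathrm{Ric}_b=0,\qquad \Delta_bV-nV=0\quad\text{on }\mathbb H^n_s,\qquad \frac{\partial V}{\partial\eta_s}=\lambda_sV\quad\text{on }\Sigma_s .$$ Let $(M^n,g)$ be a smooth Riemannian manifold with boundary $\Sigma=\partial M$ which is $s$-asymptotically hyperbolic, i.e. for some $r_0>0$ there is a diffeomorphism $F$ (a chart at infinity)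 from $\{x\in\mathbb H^n_s: r(x)>r_0\}$ onto an open region $M_{\rm ext}\subset M$, taking $\Sigma_s\cap\{r>r_0\}$ to $\Sigma\cap M_{\rm ext}$, such that $e:=F^*g-b$ satisfies $$|e|_b+|\nabla_be|_b+|\nabla_b^2e|_b=O(r^{-\sigma})\quad (r\to\infty)\qquad\text{for some }\sigma>n/2,$$ and such that, with $r$ transplanted to $M_{\rm ext}$ by $F$, $r(R_g+n(n-1))\in L^1(M_{\rm ext})$ and $r(H_g-(n-1)\lambda_s)\in L^1(\Sigma\cap M_{\rm ext})$ for the Riemannian measures of $g$ and $g|_\Sigma$. Here $R_g$ is the scalar curvature and $H_g$ the mean curvature of $\Sigma$ with respect to the outward unit normal (positive for the boundary of a round ball). For $V\in\mathcal N_{b,s}$ define the $1$-form $$\mathbb U(V,e)=V(\mathrm{div}_be-d\,\mathrm{tr}_be)-\nabla_bV\lrcorner\, e+\mathrm{tr}_be\,dV .$$ Let $S^{n-1}_{r,+}=\{x\in\mathbb H^n_s: r(x)=r\}$, with outward $b$-unit normal $\mu$ (pointing to larger $r$), and $S^{n-2}_r=\partial S^{n-1}_{r,+}\subset\Sigma_s$,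 with outward $b$-unit conormal $\vartheta$ in $\Sigma_s$; area elements are taken with respect to $b$. Then for every $V\in\mathcal N_{b,s}$ both integrands below are integrable for all sufficiently large $r$, and the limit $$\mathfrak m_{s,F}(V)=\lim_{r\to+\infty}\left[\int_{S^{n-1}_{r,+}}\langle\mathbb U(V,e),\mu\rangle\,dS^{n-1}_{r,+}-\int_{S^{n-2}_r}V\,e(\eta_s,\vartheta)\,dS^{n-2}_r\right]$$ exists and is finite. -/

import Mathlib

open Set Filter Topology MeasureTheory
open scoped Manifold ContDiff

namespace AHMass

noncomputable section

/-! ### Riemannian geometry in a coordinate domain of `ℝⁿ`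

All tensors are given by their components in the standard coordinates. Derivatives are taken within
a set `S` (below a closed half-space, so that they make sense up to the boundary). -/

/-- The coordinate space `ℝⁿ`. -/
abbrev E (n : ℕ) : Type := EuclideanSpace ℝ (Fin n)

/-- A field of bilinear forms, `G y i j = G_y(∂ᵢ, ∂ⱼ)`. -/
abbrev MetricField (n : ℕ) : Type := E n → Matrix (Fin n) (Fin n) ℝ

/-- A covariant tensor field of rank `k`, `T y I = T_y(∂_{I 0}, …, ∂_{I (k-1)})`. -/
abbrev TensorField (n k : ℕ) : Type := E n → (Fin k → Fin n) → ℝ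

/-- Partial derivative `∂ᵢ f` within `S`. -/
def pd {n : ℕ} (S : Set (E n)) (f : E n → ℝ) (i : Fin n) (y : E n) : ℝ :=
  fderivWithin ℝ f S y (EuclideanSpace.single i 1)

/-- Christoffel symbol `Γᵏᵢⱼ = ½ Gᵏˡ (∂ᵢ Gⱼₗ + ∂ⱼ Gᵢₗ - ∂ₗ Gᵢⱼ)` of the Levi-Civita connection. -/
def christoffel {n : ℕ} (S : Set (E n)) (G : MetricField n) (k i j : Fin n) (y : E n) : ℝ :=
  (1 / 2) * ∑ l, (G y)⁻¹ k l *
    (pd S (fun z => G z j l) i y + pd S (fun z => G z i l) j y - pd S (fun z => G z i j) l y)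

/-- Ricci tensor `Ricⱼₖ = ∂ᵢ Γⁱⱼₖ - ∂ⱼ Γⁱᵢₖ + Γⁱᵢₗ Γˡⱼₖ - Γⁱⱼₗ Γˡᵢₖ`
(positive on round spheres). -/
def ricci {n : ℕ} (S : Set (E n)) (G : MetricField n) (j k : Fin n) (y : E n) : ℝ :=
  ∑ i, (pd S (christoffel S G i j k) i y - pd S (christoffel S G i i k) j y +
    ∑ l, (christoffel S G i i l y * christoffel S G l j k y -
      christoffel S G i j l y * christoffel S G l i k y))

/-- Scalar curvature `R_G = Gʲᵏ Ricⱼₖ`. -/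
def scalarCurvature {n : ℕ} (S : Set (E n)) (G : MetricField n) (y : E n) : ℝ :=
  ∑ j, ∑ k, (G y)⁻¹ j k * ricci S G j k y

/-- Covariant derivative of a covariant tensor field with respect to the Levi-Civita connection of
`B`; the differentiation index comes first:
`(∇T)_{i I} = ∂ᵢ T_I - ∑ₐ Γᵖ_{i Iₐ} T_{I with Iₐ replaced by p}`. -/
def covDeriv {n : ℕ} (S : Set (E n)) (B : MetricField n) {k : ℕ} (T : TensorField n k) :
    TensorField n (k + 1) := fun y J =>
  pd S (fun z => T z (Fin.tail J)) (J 0) y -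
    ∑ a : Fin k, ∑ p, christoffel S B p (J 0) (Fin.tail J a) y *
      T y (Function.update (Fin.tail J) a p)

/-- The pointwise norm `|T|_B = (B^{I₁J₁} ⋯ B^{IₖJₖ} T_I T_J)^{1/2}`. -/
def tensorNorm {n : ℕ} (B : MetricField n) {k : ℕ} (T : TensorField n k) (y : E n) : ℝ :=
  Real.sqrt (∑ I : Fin k → Fin n, ∑ J : Fin k → Fin n,
    (∏ a, (B y)⁻¹ (I a) (J a)) * T y I * T y J)

/-- Gradient of a function, `(∇_B V)ⁱ = Bⁱʲ ∂ⱼ V`. -/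
def gradient {n : ℕ} (S : Set (E n)) (B : MetricField n) (V : E n → ℝ) (i : Fin n) (y : E n) : ℝ :=
  ∑ j, (B y)⁻¹ i j * pd S V j y

/-- Hessian of a function, `(∇²_B V)ᵢⱼ = ∂ᵢ∂ⱼ V - Γᵏᵢⱼ ∂ₖ V`. -/
def hessian {n : ℕ} (S : Set (E n)) (B : MetricField n) (V : E n → ℝ) (i j : Fin n) (y : E n) : ℝ :=
  pd S (pd S V j) i y - ∑ k, christoffel S B k i j y * pd S V k y

/-- Laplacian of a function, `Δ_B V = tr_B ∇²_B V`. -/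
def laplacian {n : ℕ} (S : Set (E n)) (B : MetricField n) (V : E n → ℝ) (y : E n) : ℝ :=
  ∑ i, ∑ j, (B y)⁻¹ i j * hessian S B V i j y

/-- Trace of a field of bilinear forms, `tr_B e = Bⁱʲ eᵢⱼ`. -/
def traceTwo {n : ℕ} (B : MetricField n) (e : TensorField n 2) (y : E n) : ℝ :=
  ∑ i, ∑ j, (B y)⁻¹ i j * e y ![i, j]

/-- Divergence of a field of bilinear forms, `(div_B e)ⱼ = Bⁱᵏ (∇e)ᵢₖⱼ`. -/
def divTwo {n : ℕ} (S : Set (E n)) (B : MetricField n) (e : TensorField n 2) (j : Fin n)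
    (y : E n) : ℝ :=
  ∑ i, ∑ k, (B y)⁻¹ i k * covDeriv S B e y ![i, k, j]

/-- The charge 1-form `𝕌(V, e) = V (div_B e - d tr_B e) - ∇_B V ⌟ e + tr_B e dV`. -/
def charge {n : ℕ} (S : Set (E n)) (B : MetricField n) (V : E n → ℝ) (e : TensorField n 2)
    (i : Fin n) (y : E n) : ℝ :=
  V y * (divTwo S B e i y - pd S (traceTwo B e) i y)
    - ∑ j, gradient S B V j y * e y ![j, i]
    + traceTwo B e y * pd S V i y

/-! ### Hypersurfaces `{y₀ = const}`

The region lies on the side of smaller `y₀`. -/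

/-- The outward unit normal `∇_G y₀ / |∇_G y₀|_G` to the level sets of the coordinate `y₀`. -/
def outwardNormal {m : ℕ} (G : MetricField (m + 1)) (y : E (m + 1)) (i : Fin (m + 1)) : ℝ :=
  (G y)⁻¹ i 0 / Real.sqrt ((G y)⁻¹ 0 0)

/-- The metric induced on the level sets of `y₀`, in the coordinates `y₁, …, y_m`. -/
def inducedMetric {m : ℕ} (G : MetricField (m + 1)) (y : E (m + 1)) : Matrix (Fin m) (Fin m) ℝ :=
  (G y).submatrix Fin.succ Fin.succ

/-- Second fundamental form `Π(∂_α, ∂_β) = -G(∇_{∂_α} ∂_β, N)` with respect to the outward unit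
normal `N`. -/
def secondFundamentalForm {m : ℕ} (S : Set (E (m + 1))) (G : MetricField (m + 1)) (α β : Fin m)
    (y : E (m + 1)) : ℝ :=
  -∑ k, ∑ l, christoffel S G k α.succ β.succ y * G y k l * outwardNormal G y l

/-- Mean curvature `H_G = tr Π`. -/
def meanCurvature {m : ℕ} (S : Set (E (m + 1))) (G : MetricField (m + 1)) (y : E (m + 1)) : ℝ :=
  ∑ α, ∑ β, (inducedMetric G y)⁻¹ α β * secondFundamentalForm S G α β y

/-! ### The model `(ℍⁿ_s, b, Σ_s)`, `n = m + 1`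

A point `(x₀, x₁, …, xₙ)` of the hyperboloid `-x₀² + x₁² + ⋯ + xₙ² = -1`, `x₀ > 0`, is represented by
`y = (x₁, …, xₙ) ∈ ℝⁿ`, so that `x₁, …, xₙ` are the coordinates `y 0, …, y m`,
`x₀ = √(1 + |y|²)` and `r = |y|`. -/

/-- The hyperbolic metric `bᵢⱼ = δᵢⱼ - yᵢ yⱼ / (1 + |y|²)`, which is the metric induced by Minkowski
space on the hyperboloid (see `hypMetric_eq_minkowski`). -/
def hypMetric (n : ℕ) : MetricField n := fun y =>
  Matrix.of fun i j => (if i = j then 1 else 0) - y i * y j / (1 + ‖y‖ ^ 2)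

/-- `b` is the pullback of `-dx₀² + dx₁² + ⋯ + dxₙ²` under `y ↦ (√(1 + |y|²), y)`. -/
theorem hypMetric_eq_minkowski (n : ℕ) (y : E n) (i j : Fin n) :
    hypMetric n y i j =
      -(fderiv ℝ (fun z : E n => Real.sqrt (1 + ‖z‖ ^ 2)) y (EuclideanSpace.single i 1) *
        fderiv ℝ (fun z : E n => Real.sqrt (1 + ‖z‖ ^ 2)) y (EuclideanSpace.single j 1))
      + inner ℝ (EuclideanSpace.single i (1 : ℝ)) (EuclideanSpace.single j (1 : ℝ)) := by
  have hpos : 0 < 1 + ‖y‖ ^ 2 := by positivity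
  have h1 : HasFDerivAt (fun z : E n => 1 + ‖z‖ ^ 2) (2 • innerSL ℝ y) y :=
    ((hasStrictFDerivAt_norm_sq y).hasFDerivAt).const_add 1
  have h2 := (h1.sqrt hpos.ne').fderiv
  rw [h2]
  have hs : Real.sqrt (1 + ‖y‖ ^ 2) * Real.sqrt (1 + ‖y‖ ^ 2) = 1 + ‖y‖ ^ 2 :=
    Real.mul_self_sqrt hpos.le
  have hs0 : Real.sqrt (1 + ‖y‖ ^ 2) ≠ 0 := (Real.sqrt_pos.2 hpos).ne'
  have hc : ∀ i : Fin n, inner ℝ y (EuclideanSpace.single i (1 : ℝ)) = y i := by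
    intro i
    simp [EuclideanSpace.inner_single_right]
  have hd : inner ℝ (EuclideanSpace.single i (1 : ℝ)) (EuclideanSpace.single j (1 : ℝ))
      = if i = j then (1 : ℝ) else 0 := by
    simp [EuclideanSpace.inner_single_left]
  rw [hd]
  simp only [hypMetric, Matrix.of_apply, _root_.smul_apply, innerSL_apply_apply, hc,
    smul_eq_mul, nsmul_eq_mul]
  generalize Real.sqrt (1 + ‖y‖ ^ 2) = q at hs hs0
  rw [← hs]
  field_simp
  push_cast
  ring

/-- `ℍⁿ_s = {x₁ ≤ s}`. -/
def halfSpace {m : ℕ} (s : ℝ) : Set (E (m + 1)) := {y | y 0 ≤ s}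

/-- The part `{x₁ ≤ s, r > r₀}` of `ℍⁿ_s` near infinity. -/
def modelEnd {m : ℕ} (s r₀ : ℝ) : Set (E (m + 1)) := {y | y 0 ≤ s ∧ r₀ < ‖y‖}

/-- The point of `Σ_s = {x₁ = s}` with remaining coordinates `z = (x₂, …, xₙ)`. -/
def sigmaPoint {m : ℕ} (s : ℝ) (z : E m) : E (m + 1) :=
  WithLp.toLp 2 (Fin.cons s fun i => z i)

/-- `λ_s = s / √(1 + s²)`. -/
def lam (s : ℝ) : ℝ := s / Real.sqrt (1 + s ^ 2)

/-- The space `𝒩_{b,s}` of static potentials of `(ℍⁿ_s, b, Σ_s)`: smooth functions on `ℍⁿ_s`, up to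
the boundary, with
`∇²V + Λ V b - V Ric_b = 0` and `ΔV + Λ V = 0` on `ℍⁿ_s`, where `Λ = -n`, and
`∂V/∂η_s = λ_s V` along `Σ_s`. -/
structure IsStaticPotential {m : ℕ} (s : ℝ) (V : E (m + 1) → ℝ) : Prop where
  smooth : ContDiffOn ℝ ∞ V (halfSpace s)
  hessian_eq : ∀ y ∈ halfSpace s, ∀ i j,
    hessian (halfSpace s) (hypMetric (m + 1)) V i j y
      + (-((m : ℝ) + 1)) * V y * hypMetric (m + 1) y i j
      - V y * ricci (halfSpace s) (hypMetric (m + 1)) i j y = 0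
  laplacian_eq : ∀ y ∈ halfSpace s,
    laplacian (halfSpace s) (hypMetric (m + 1)) V y + (-((m : ℝ) + 1)) * V y = 0
  boundary_eq : ∀ y : E (m + 1), y 0 = s →
    ∑ i, outwardNormal (hypMetric (m + 1)) y i * pd (halfSpace s) V i y = lam s * V y

/-! ### `s`-asymptotically hyperbolic manifolds -/

section Manifold

variable {m : ℕ} {M : Type*} [TopologicalSpace M] [ChartedSpace (EuclideanHalfSpace (m + 1)) M]
  [IsManifold (𝓡∂ (m + 1)) ∞ M]

/-- `F` restricts to a diffeomorphism from `{x₁ ≤ s, r > r₀}` onto an open region of the manifold with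
boundary `M`, under which `Σ_s` corresponds to `∂M`. -/
structure IsChartAtInfinity (s r₀ : ℝ) (F : E (m + 1) → M) : Prop where
  pos : 0 < r₀
  smooth : ContMDiffOn 𝓘(ℝ, E (m + 1)) (𝓡∂ (m + 1)) ∞ F (modelEnd s r₀)
  isOpen_image : IsOpen (F '' modelEnd s r₀)
  exists_inverse : ∃ Φ : M → E (m + 1),
    ContMDiffOn (𝓡∂ (m + 1)) 𝓘(ℝ, E (m + 1)) ∞ Φ (F '' modelEnd s r₀) ∧
      ∀ y ∈ modelEnd s r₀, Φ (F y) = y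
  boundary : ∀ y ∈ modelEnd s r₀, F y ∈ (𝓡∂ (m + 1)).boundary M ↔ y 0 = s

/-- The components of `F^* g` on `{x₁ ≤ s, r > r₀}`. -/
def pullbackMetric
    (g : Bundle.ContMDiffRiemannianMetric (𝓡∂ (m + 1)) ∞ (E (m + 1))
      (fun x : M => TangentSpace (𝓡∂ (m + 1)) x))
    (s r₀ : ℝ) (F : E (m + 1) → M) : MetricField (m + 1) := fun y =>
  Matrix.of fun i j =>
    g.inner (F y)
      (mfderivWithin 𝓘(ℝ, E (m + 1)) (𝓡∂ (m + 1)) F (modelEnd s r₀) y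
        (EuclideanSpace.single i (1 : ℝ) : E (m + 1)))
      (mfderivWithin 𝓘(ℝ, E (m + 1)) (𝓡∂ (m + 1)) F (modelEnd s r₀) y
        (EuclideanSpace.single j (1 : ℝ) : E (m + 1)))

/-- `e = G - b`. -/
def deviation (G : MetricField (m + 1)) : TensorField (m + 1) 2 := fun y I =>
  G y (I 0) (I 1) - hypMetric (m + 1) y (I 0) (I 1)

/-- `(M, g, ∂M)` is `s`-asymptotically hyperbolic with chart at infinity `F` defined for `r > r₀`.
The curvatures `R_g`, `H_g` and the Riemannian measures of `g` and of its restriction to `∂M` are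
expressed in the coordinates that `F` provides on `M_ext = F({x₁ ≤ s, r > r₀})`; integrability is
required on `M_ext` and on `∂M ∩ M_ext` only. -/
structure IsAsymptoticallyHyperbolic
    (g : Bundle.ContMDiffRiemannianMetric (𝓡∂ (m + 1)) ∞ (E (m + 1))
      (fun x : M => TangentSpace (𝓡∂ (m + 1)) x))
    (s r₀ : ℝ) (F : E (m + 1) → M) : Prop where
  chart : IsChartAtInfinity s r₀ F
  /-- `|e|_b + |∇_b e|_b + |∇_b² e|_b = O(r^{-σ})` for some `σ > n/2`, where `e = F^*g - b`. -/
  decay : ∃ σ : ℝ, ((m : ℝ) + 1) / 2 < σ ∧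
    (fun y : E (m + 1) =>
      tensorNorm (hypMetric (m + 1)) (deviation (pullbackMetric g s r₀ F)) y
      + tensorNorm (hypMetric (m + 1))
          (covDeriv (halfSpace s) (hypMetric (m + 1)) (deviation (pullbackMetric g s r₀ F))) y
      + tensorNorm (hypMetric (m + 1))
          (covDeriv (halfSpace s) (hypMetric (m + 1))
            (covDeriv (halfSpace s) (hypMetric (m + 1)) (deviation (pullbackMetric g s r₀ F)))) y)
      =O[comap norm atTop ⊓ 𝓟 (halfSpace s)] fun y => ‖y‖ ^ (-σ)
  /-- `r (R_g + n(n-1)) ∈ L¹(M_ext)` -/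
  scalar_integrable : IntegrableOn
    (fun y : E (m + 1) =>
      ‖y‖ * (scalarCurvature (halfSpace s) (pullbackMetric g s r₀ F) y + ((m : ℝ) + 1) * m) *
        Real.sqrt (pullbackMetric g s r₀ F y).det)
    (modelEnd s r₀)
  /-- `r (H_g - (n-1)λ_s) ∈ L¹(∂M ∩ M_ext)` -/
  mean_integrable : IntegrableOn
    (fun z : E m =>
      ‖sigmaPoint s z‖ *
        (meanCurvature (halfSpace s) (pullbackMetric g s r₀ F) (sigmaPoint s z) - m * lam s) *
        Real.sqrt (inducedMetric (pullbackMetric g s r₀ F) (sigmaPoint s z)).det)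
    {z : E m | r₀ < ‖sigmaPoint s z‖}

end Manifold

/-! ### The mass functional -/

/-- `b(v, v)` at `y`. -/
def hypSq {n : ℕ} (y : E n) (v : E n) : ℝ := ∑ i, ∑ j, hypMetric n y i j * v i * v j

/-- `⟨𝕌(V, e), μ⟩` at `y`; the outward `b`-unit normal to the sphere `{r = |y|}` at `y` is
`μ = y / |y|_b`. -/
def fluxDensity {m : ℕ} (s : ℝ) (V : E (m + 1) → ℝ) (e : TensorField (m + 1) 2) (y : E (m + 1)) :
    ℝ :=
  ∑ i, charge (halfSpace s) (hypMetric (m + 1)) V e i y * (y i / Real.sqrt (hypSq y y))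

/-- `V e(η_s, ϑ)` at the point `(s, z)` of `Σ_s`; the outward `b`-unit conormal to
`S^{n-2}_r ⊂ Σ_s` at `(s, z)` is `ϑ = (0, z) / |(0, z)|_b`. -/
def cornerDensity {m : ℕ} (s : ℝ) (V : E (m + 1) → ℝ) (e : TensorField (m + 1) 2) (z : E m) : ℝ :=
  V (sigmaPoint s z) * ∑ i, ∑ j, e (sigmaPoint s z) ![i, j] *
    outwardNormal (hypMetric (m + 1)) (sigmaPoint s z) i *
    (sigmaPoint 0 z j / Real.sqrt (hypSq (sigmaPoint s z) (sigmaPoint 0 z)))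

/-- The set of directions `ξ` with `rξ ∈ S^{n-1}_{r,+} = {|y| = r, x₁ ≤ s}`. -/
def hemisphere (m : ℕ) (s r : ℝ) : Set (Metric.sphere (0 : E (m + 1)) 1) :=
  {ξ | r * (ξ : E (m + 1)) 0 ≤ s}

/-- Radius of the sphere `S^{n-2}_r = {(s, z) : |z|² = r² - s²}`. -/
def cornerRadius (s r : ℝ) : ℝ := Real.sqrt (r ^ 2 - s ^ 2)

/-- `∫_{S^{n-1}_{r,+}} ⟨𝕌(V, e), μ⟩ dS^{n-1}_{r,+} - ∫_{S^{n-2}_r} V e(η_s, ϑ) dS^{n-2}_r`.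
On tangent vectors to these round spheres `b` is the Euclidean metric, so the two area measures
are `r^{n-1} dξ` and `ρ^{n-2} dξ` with `ρ = √(r² - s²)`. -/
def massIntegral {m : ℕ} (s : ℝ) (V : E (m + 1) → ℝ) (e : TensorField (m + 1) 2) (r : ℝ) : ℝ :=
  r ^ m * (∫ ξ in hemisphere m s r, fluxDensity s V e (r • (ξ : E (m + 1)))
      ∂(volume : Measure (E (m + 1))).toSphere)
  - cornerRadius s r ^ (m - 1) *
    ∫ ξ : Metric.sphere (0 : E m) 1, cornerDensity s V e (cornerRadius s r • (ξ : E m))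
      ∂(volume : Measure (E m)).toSphere

end

end AHMass

open AHMass

/-!
The limit exists because the bracket `m(r)` is a boundary term whose increments are controlled by
integrals over a neighbourhood of infinity.

In the coordinates `y = (x₁, …, xₙ)` the charge `𝕌(V, e)` becomes a vector density `J` with
`⟨𝕌, μ⟩ dS = J · (y / |y|) dS`, and the form `V e(η, ·)` on `Σ_s` becomes a vector density `Y`. So
`m(r)` is the flux of `J` through the spherical cap minus the flux of `Y` through its edge
(`massIntegral_eq_fluxDifference`), and by the divergence theorem on `{x₁ ≤ s}` and on `Σ_s`,
`m(r') - m(r)` is the integral of `div J` over `{r < |y| < r'}` minus the integral of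
`J₀ + div_Σ Y` over the part of `Σ_s` between the two radii (`J₀` being the conormal component). If
both integrands are integrable near infinity, then `m` is Cauchy (`exists_tendsto_fluxDifference`).
To avoid domains with corners the divergence theorem is applied to `φ(|y|) J` for a smooth cutoff `φ`
that passes from `0` to `1` near `r` and back to `0` near `r'`; letting the transition layers shrink
recovers `m(r)` and `m(r')`, because `m` is continuous.

*Interior.* The static equation gives `∇²V = V b`, hence `V` is a combination of `x₀, …, xₙ` and a
constant, so `V = O(r)`, and the terms with derivatives of `V` in `div 𝕌(V, e)` cancel, which leaves
`V` times the linearization of the scalar curvature at `b` (`divWithin_vectorDensity_charge`).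

*Boundary.* The Robin condition `∂V/∂η = λ_s V` gives in the same way that
`⟨𝕌(V, e), η⟩ + div_Σ (V e(η, ·))` is `-2 V` times the linearized mean curvature
(`vectorDensity_charge_add_divWithin`).

The linearizations differ from `R_g + n(n-1)` and `H_g - (n-1)λ_s` by terms that are quadratic in
`e, ∇e, ∇²e`, hence `O(r^{-2σ})` (`isBigO_scalarCurvature`, `isBigO_meanCurvature`). The Riemannian
measures of `b` are comparable to `dy / √(1 + |y|²)`, so multiplication by `V = O(r)` leaves `r^{-2σ}`
integrable for `dy` because `2σ > n`, while the remaining parts are integrable by the hypotheses on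
`r (R_g + n(n-1))` and `r (H_g - (n-1)λ_s)`.

All tensor estimates are made in the `b`-orthonormal frame formed by the columns of the positive
square root of `b⁻¹ = 1 + y yᵀ`, in which the components of a tensor are bounded by its `b`-norm. The
Christoffel symbols of `b` are `Γᵏᵢⱼ = -yᵏ bᵢⱼ`, which makes all covariant derivatives explicit.
-/

namespace AHMass

/-! ### The half-space and its end -/

theorem convex_halfSpace {m : ℕ} (s : ℝ) : Convex ℝ (halfSpace s : Set (E (m + 1))) := by
  have : (halfSpace s : Set (E (m+1))) = (EuclideanSpace.proj (0 : Fin (m+1)) : E (m+1) →L[ℝ] ℝ) ⁻¹' Iic s := rfl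
  rw [this]
  exact (convex_Iic s).is_linear_preimage (EuclideanSpace.proj (0 : Fin (m+1)) : E (m+1) →L[ℝ] ℝ).isBoundedLinearMap.toIsLinearMap

theorem isClosed_halfSpace {m : ℕ} (s : ℝ) : IsClosed (halfSpace s : Set (E (m + 1))) := by
  have h : Continuous fun y : E (m+1) => y 0 := by fun_prop
  exact isClosed_Iic.preimage h

theorem uniqueDiffOn_halfSpace {m : ℕ} (s : ℝ) :
    UniqueDiffOn ℝ (halfSpace s : Set (E (m + 1))) := by
  apply uniqueDiffOn_convex (convex_halfSpace s)
  have h : Continuous fun y : E (m+1) => y 0 := by fun_prop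
  have ho : IsOpen {y : E (m+1) | y 0 < s} := isOpen_Iio.preimage h
  refine ⟨EuclideanSpace.single 0 (s-1), mem_interior.2 ⟨_, ?_, ho, ?_⟩⟩
  · intro y hy
    exact le_of_lt (α := ℝ) hy
  · simp

theorem modelEnd_eq {m : ℕ} (s r₀ : ℝ) :
    (modelEnd s r₀ : Set (E (m + 1))) = halfSpace s ∩ {y | r₀ < ‖y‖} := rfl

theorem isOpen_norm_gt {n : ℕ} (r₀ : ℝ) : IsOpen {y : E n | r₀ < ‖y‖} :=
  isOpen_lt continuous_const continuous_norm

theorem uniqueDiffOn_modelEnd {m : ℕ} (s r₀ : ℝ) :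
    UniqueDiffOn ℝ (modelEnd s r₀ : Set (E (m + 1))) :=
  (uniqueDiffOn_halfSpace s).inter (isOpen_norm_gt r₀)

theorem measurableSet_modelEnd {m : ℕ} (s r₀ : ℝ) :
    MeasurableSet (modelEnd s r₀ : Set (E (m + 1))) :=
  (isClosed_halfSpace s).measurableSet.inter (isOpen_norm_gt r₀).measurableSet

theorem fderivWithin_halfSpace_eq {m : ℕ} {s r₀ : ℝ} {f : E (m + 1) → ℝ} {y : E (m + 1)}
    (hy : y ∈ modelEnd s r₀) :
    fderivWithin ℝ f (halfSpace s) y = fderivWithin ℝ f (modelEnd s r₀) y := by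
  rw [modelEnd_eq, fderivWithin_inter ((isOpen_norm_gt r₀).mem_nhds hy.2)]

theorem contDiffOn_pd {m : ℕ} {s r₀ : ℝ} {f : E (m + 1) → ℝ}
    (hf : ContDiffOn ℝ ∞ f (modelEnd s r₀)) (i : Fin (m + 1)) :
    ContDiffOn ℝ ∞ (pd (halfSpace s) f i) (modelEnd s r₀) := by
  have h := hf.fderivWithin (m := ∞) (uniqueDiffOn_modelEnd s r₀) (by simp)
  have h2 : ContDiffOn ℝ ∞
      (fun y => fderivWithin ℝ f (modelEnd s r₀) y (EuclideanSpace.single i 1)) (modelEnd s r₀) :=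
    h.clm_apply contDiffOn_const
  exact h2.congr fun y hy => by rw [pd, fderivWithin_halfSpace_eq hy]

theorem differentiableWithinAt_halfSpace {m : ℕ} {s r₀ : ℝ} {f : E (m + 1) → ℝ}
    (hf : ContDiffOn ℝ ∞ f (modelEnd s r₀)) {y : E (m + 1)} (hy : y ∈ modelEnd s r₀) :
    DifferentiableWithinAt ℝ f (halfSpace s) y := by
  have h := (hf.differentiableOn (by simp)) y hy
  rw [modelEnd_eq] at h
  exact (differentiableWithinAt_inter ((isOpen_norm_gt r₀).mem_nhds hy.2)).1 h

/-- The components of `F^* g` are smooth up to the boundary: they are `g` evaluated on the images of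
the coordinate fields under the tangent map of `F`. -/
theorem contDiffOn_pullbackMetric {m : ℕ} {M : Type*} [TopologicalSpace M]
    [ChartedSpace (EuclideanHalfSpace (m + 1)) M] [IsManifold (𝓡∂ (m + 1)) ∞ M]
    (g : Bundle.ContMDiffRiemannianMetric (𝓡∂ (m + 1)) ∞ (E (m + 1))
      (fun x : M => TangentSpace (𝓡∂ (m + 1)) x)) {s r₀ : ℝ} {F : E (m + 1) → M}
    (hF : ContMDiffOn 𝓘(ℝ, E (m + 1)) (𝓡∂ (m + 1)) ∞ F (modelEnd s r₀)) (i j : Fin (m + 1)) :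
    ContDiffOn ℝ ∞ (fun y => pullbackMetric g s r₀ F y i j) (modelEnd s r₀) := by
  have hT := hF.contMDiffOn_tangentMapWithin (m := ∞) (by simp)
    (uniqueDiffOn_modelEnd s r₀).uniqueMDiffOn
  have hv : ∀ k : Fin (m + 1), ContMDiffOn 𝓘(ℝ, E (m + 1)) ((𝓡∂ (m + 1)).prod 𝓘(ℝ, E (m + 1))) ∞
      (fun y => (⟨F y, mfderivWithin 𝓘(ℝ, E (m + 1)) (𝓡∂ (m + 1)) F (modelEnd s r₀) y
        (EuclideanSpace.single k (1 : ℝ) : E (m + 1))⟩ :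
          Bundle.TotalSpace (E (m+1)) (TangentSpace (𝓡∂ (m + 1)) : M → Type _)))
      (modelEnd s r₀) := by
    intro k
    have hs : ContMDiff 𝓘(ℝ, E (m + 1)) (𝓘(ℝ, E (m + 1)).tangent) ∞
        (fun y : E (m+1) => (⟨y, (EuclideanSpace.single k (1 : ℝ) : E (m + 1))⟩ :
          TangentBundle 𝓘(ℝ, E (m + 1)) (E (m+1)))) := by
      exact contMDiff_vectorSpace_iff_contDiff.2 contDiff_const
    have := hT.comp hs.contMDiffOn (s := modelEnd s r₀) (by intro y hy; exact hy)
    exact this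
  rw [← contMDiffOn_iff_contDiffOn]
  intro y hy
  have hb : ContMDiffWithinAt 𝓘(ℝ, E (m + 1)) (𝓡∂ (m + 1)) ∞ F (modelEnd s r₀) y := hF y hy
  have : ContMDiffWithinAt 𝓘(ℝ, E (m + 1)) ((𝓡∂ (m + 1)).prod 𝓘(ℝ)) ∞
      (fun y => Bundle.TotalSpace.mk' ℝ (E := Bundle.Trivial M ℝ) (F y)
        (pullbackMetric g s r₀ F y i j)) (modelEnd s r₀) y := by
    apply ContMDiffWithinAt.clm_bundle_apply₂ (F₁ := E (m+1)) (F₂ := E (m+1))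
      (E₁ := fun x : M => TangentSpace (𝓡∂ (m + 1)) x) (E₂ := fun x : M => TangentSpace (𝓡∂ (m + 1)) x)
    · exact ContMDiffAt.comp_contMDiffWithinAt y g.contMDiff.contMDiffAt hb
    · exact hv i y hy
    · exact hv j y hy
  rw [Bundle.contMDiffWithinAt_totalSpace] at this
  exact this.2

theorem pullbackMetric_symm {m : ℕ} {M : Type*} [TopologicalSpace M]
    [ChartedSpace (EuclideanHalfSpace (m + 1)) M] [IsManifold (𝓡∂ (m + 1)) ∞ M]
    (g : Bundle.ContMDiffRiemannianMetric (𝓡∂ (m + 1)) ∞ (E (m + 1))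
      (fun x : M => TangentSpace (𝓡∂ (m + 1)) x)) (s r₀ : ℝ) (F : E (m + 1) → M)
    (y : E (m + 1)) (i j : Fin (m + 1)) :
    pullbackMetric g s r₀ F y i j = pullbackMetric g s r₀ F y j i :=
  g.symm _ _ _

/-! ### The divergence theorem on the half-space -/

theorem pd_eq_zero_of_norm_gt {m : ℕ} {s R : ℝ} {f : E (m + 1) → ℝ}
    (hf : ∀ y, R ≤ ‖y‖ → f y = 0) (i : Fin (m + 1)) {y : E (m + 1)} (hy : R < ‖y‖) :
    pd (halfSpace s) f i y = 0 := by
  have h : f =ᶠ[𝓝 y] fun _ => 0 := by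
    filter_upwards [(isOpen_norm_gt R).mem_nhds hy] with z hz using hf z (le_of_lt hz)
  rw [pd, (h.filter_mono nhdsWithin_le_nhds).fderivWithin_eq (by simpa using h.self_of_nhds)]
  simp

theorem abs_coord_le_norm {n : ℕ} (y : E n) (i : Fin n) : |y i| ≤ ‖y‖ := by
  simpa using PiLp.norm_apply_le y i

theorem continuousOn_pd_of_contDiffOn_one {m : ℕ} {s : ℝ} {f : E (m + 1) → ℝ}
    (hf : ContDiffOn ℝ 1 f (halfSpace s)) (i : Fin (m + 1)) :
    ContinuousOn (pd (halfSpace s) f i) (halfSpace s) :=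
  (hf.continuousOn_fderivWithin (uniqueDiffOn_halfSpace s) le_rfl).clm_apply continuousOn_const

/-- Divergence theorem on `{y₀ ≤ s}` for a field of class `C¹` up to the boundary that vanishes far
out. It is the divergence theorem on a box whose face `{y₀ = s}` is the only one the field reaches. -/
theorem integral_div_halfSpace {m : ℕ} {s R : ℝ} (K : Fin (m + 1) → E (m + 1) → ℝ)
    (hK : ∀ i, ContDiffOn ℝ 1 (K i) (halfSpace s)) (h0 : ∀ i y, R ≤ ‖y‖ → K i y = 0) :
    ∫ y in (halfSpace s : Set (E (m + 1))), ∑ i, pd (halfSpace s) (K i) i y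
      = ∫ z : E m, K 0 (sigmaPoint s z) := by
  obtain ⟨R', hR', hs'⟩ : ∃ R', R ≤ R' ∧ |s| ≤ R' := ⟨max R |s|, le_max_left _ _, le_max_right _ _⟩
  have hR0 : 0 ≤ R' := (abs_nonneg s).trans hs'
  set eL := (PiLp.continuousLinearEquiv 2 ℝ (fun _ : Fin (m + 1) => ℝ)).symm with heL
  have heLa : ∀ x, eL x = WithLp.toLp 2 x := fun x => rfl
  set a : Fin (m + 1) → ℝ := fun _ => -R' with ha
  set b : Fin (m + 1) → ℝ := Fin.cons s fun _ => R' with hb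
  have hle : a ≤ b := by
    intro i
    refine Fin.cases ?_ (fun j => ?_) i
    · simpa [ha, hb] using (abs_le.1 hs').1
    · simp [ha, hb]; linarith
  have hbR : ∀ i, b i ≤ R' := by
    intro i
    refine Fin.cases ?_ (fun j => ?_) i
    · simpa [hb] using (abs_le.1 hs').2
    · simp [hb]
  have hKl : ∀ i x (j : Fin (m + 1)), R' ≤ |x j| → K i (WithLp.toLp 2 x) = 0 := by
    intro i x j hj
    exact h0 i _ (hR'.trans (hj.trans (abs_coord_le_norm (WithLp.toLp 2 x) j)))
  have hmaps : MapsTo (fun x : Fin (m + 1) → ℝ => (WithLp.toLp 2 x : E (m + 1))) (Icc a b)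
      (halfSpace s) := fun x hx => show x 0 ≤ s by simpa [hb] using hx.2 0
  have hcont : Continuous fun x : Fin (m + 1) → ℝ => (WithLp.toLp 2 x : E (m + 1)) :=
    eL.continuous
  have key := integral_divergence_of_hasFDerivAt_off_countable' a b hle
    (fun i x => K i (WithLp.toLp 2 x))
    (fun i x => (fderivWithin ℝ (K i) (halfSpace s) (WithLp.toLp 2 x)).comp
      (eL : (Fin (m + 1) → ℝ) →L[ℝ] E (m + 1))) ∅ countable_empty ?_ ?_ ?_
  · have e1 : ∀ i x, ((fderivWithin ℝ (K i) (halfSpace s) (WithLp.toLp 2 x)).comp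
        (eL : (Fin (m + 1) → ℝ) →L[ℝ] E (m + 1))) (Pi.single i 1)
        = pd (halfSpace s) (K i) i (WithLp.toLp 2 x) := fun i x => rfl
    simp only [e1] at key
    have e2 : ∫ y in (halfSpace s : Set (E (m + 1))), ∑ i, pd (halfSpace s) (K i) i y
        = ∫ x in Icc a b, ∑ i, pd (halfSpace s) (K i) i (WithLp.toLp 2 x) := by
      rw [← (PiLp.volume_preserving_toLp (Fin (m + 1))).setIntegral_preimage_emb
        (MeasurableEquiv.toLp 2 _).measurableEmbedding]
      apply setIntegral_eq_of_subset_of_forall_sdiff_eq_zero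
      · exact hcont.measurable (isClosed_halfSpace s).measurableSet
      · exact hmaps
      · rintro x ⟨hx, hxn⟩
        refine Finset.sum_eq_zero fun i _ => pd_eq_zero_of_norm_gt (R := R')
          (fun y hy => h0 i y (hR'.trans hy)) i ?_
        by_contra hcon
        rw [not_lt] at hcon
        apply hxn
        have hc : ∀ j, |x j| ≤ R' := fun j => (abs_coord_le_norm (WithLp.toLp 2 x) j).trans hcon
        refine ⟨fun j => (abs_le.1 (hc j)).1, fun j => ?_⟩
        refine Fin.cases ?_ (fun k => ?_) j
        · simpa [hb] using (show x 0 ≤ s from hx)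
        · simpa [hb] using (abs_le.1 (hc k.succ)).2
    rw [e2, key, Fin.sum_univ_succ]
    have hz : ∀ i (c : ℝ), R' ≤ |c| → ∀ x : Fin m → ℝ,
        K i (WithLp.toLp 2 (Fin.insertNth (α := fun _ => ℝ) i c x)) = 0 := by
      intro i c hc x
      refine hKl i _ i ?_
      simpa using hc
    have hRa : R' ≤ |(-R')| := by rw [abs_neg]; exact le_abs_self _
    simp only [ha, hb, Fin.cons_succ, Fin.cons_zero, hz _ _ hRa, hz _ R' (le_abs_self _)]
    simp only [integral_zero, sub_zero, Finset.sum_const_zero, add_zero]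
    rw [← (PiLp.volume_preserving_toLp (Fin m)).integral_comp
        (MeasurableEquiv.toLp 2 _).measurableEmbedding]
    have e3 : ∀ x : Fin m → ℝ, K 0 (WithLp.toLp 2 (Fin.insertNth (α := fun _ => ℝ) 0 s x))
        = K 0 (sigmaPoint s (WithLp.toLp 2 x)) := by
      intro x
      rw [sigmaPoint, Fin.insertNth_zero']
    simp only [e3]
    rw [setIntegral_eq_integral_of_forall_compl_eq_zero]
    intro x hx
    rw [← e3]
    by_contra hcon
    apply hx
    have hc : ∀ j : Fin m, |x j| ≤ R' := by
      intro j
      by_contra hj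
      refine hcon (hKl 0 _ j.succ ?_)
      simpa [Fin.insertNth_zero'] using (not_le.1 hj).le
    refine ⟨fun j => (abs_le.1 (hc j)).1, fun j => ?_⟩
    simpa using (abs_le.1 (hc j)).2
  · exact fun i => ((hK i).continuousOn).comp hcont.continuousOn hmaps
  · rintro x ⟨hx, -⟩ i
    have hlt : x 0 < s := by simpa [hb] using (hx 0 trivial).2
    have hnh : (halfSpace s : Set (E (m + 1))) ∈ 𝓝 (WithLp.toLp 2 x : E (m + 1)) := by
      have h : Continuous fun y : E (m + 1) => y 0 := by fun_prop
      filter_upwards [(isOpen_Iio.preimage h).mem_nhds (show (WithLp.toLp 2 x : E (m + 1)) ∈ _ from hlt)]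
        with z hz using le_of_lt (α := ℝ) hz
    have hd := ((hK i).differentiableOn one_ne_zero (WithLp.toLp 2 x) (mem_of_mem_nhds hnh)).hasFDerivWithinAt.hasFDerivAt hnh
    exact hd.comp x eL.hasFDerivAt
  · refine ContinuousOn.integrableOn_compact isCompact_Icc ?_
    refine continuousOn_finsetSum _ fun i _ => ?_
    exact (continuousOn_pd_of_contDiffOn_one (hK i) i).comp hcont.continuousOn hmaps

/-! ### Polar coordinates and integrals over spherical caps -/

/-- Integration in polar coordinates. -/
theorem integral_polar {m : ℕ} {F : E (m + 1) → ℝ} (hF : Integrable F) :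
    ∫ y, F y = ∫ t in Ioi (0 : ℝ), t ^ m *
      ∫ ξ : Metric.sphere (0 : E (m + 1)) 1, F (t • (ξ : E (m + 1)))
        ∂(volume : Measure (E (m + 1))).toSphere := by
  have hdim : Module.finrank ℝ (E (m + 1)) - 1 = m := by simp
  have hmp := (volume : Measure (E (m + 1))).measurePreserving_homeomorphUnitSphereProd
  rw [hdim] at hmp
  have hemb := (homeomorphUnitSphereProd (E (m + 1))).measurableEmbedding
  set G : Metric.sphere (0 : E (m + 1)) 1 × Ioi (0 : ℝ) → ℝ :=
    fun p => F ((p.2 : ℝ) • (p.1 : E (m + 1))) with hG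
  have hGF : ∀ x : ({(0)}ᶜ : Set (E (m + 1))), G (homeomorphUnitSphereProd (E (m + 1)) x) = F x := by
    intro x
    have hx : ‖(x : E (m + 1))‖ ≠ 0 := norm_ne_zero_iff.2 x.2
    simp [hG, homeomorphUnitSphereProd_apply_fst_coe, homeomorphUnitSphereProd_apply_snd_coe,
      smul_smul, hx]
  have h1 : ∫ y, F y = ∫ p, G p ∂((volume : Measure (E (m + 1))).toSphere.prod
      (Measure.volumeIoiPow m)) := by
    rw [← hmp.integral_comp hemb G]
    simp only [hGF]
    rw [integral_subtype_comap (measurableSet_singleton _).compl fun x ↦ F x,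
        restrict_compl_singleton]
  have hi : Integrable G ((volume : Measure (E (m + 1))).toSphere.prod (Measure.volumeIoiPow m)) := by
    rw [← hmp.integrable_comp_emb hemb]
    have : G ∘ (homeomorphUnitSphereProd (E (m + 1))) = F ∘ Subtype.val := funext hGF
    rw [this, ← integrableOn_iff_comap_subtypeVal (by measurability)]
    exact hF.integrableOn
  rw [h1, integral_prod_symm G hi]
  simp only [Measure.volumeIoiPow, ENNReal.ofReal]
  rw [integral_withDensity_eq_integral_smul,
    integral_subtype_comap measurableSet_Ioi fun a : ℝ ↦ Real.toNNReal (a ^ m) •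
      ∫ ξ : Metric.sphere (0 : E (m + 1)) 1, F (a • (ξ : E (m + 1)))
        ∂(volume : Measure (E (m + 1))).toSphere]
  · refine setIntegral_congr_fun measurableSet_Ioi fun x hx ↦ ?_
    rw [NNReal.smul_def, Real.coe_toNNReal _ (pow_nonneg (le_of_lt hx) _), smul_eq_mul]
  · exact (measurable_subtype_coe.pow_const _).real_toNNReal

open scoped Pointwise in
/-- A circle of latitude other than the poles has measure zero on the unit sphere. The hypothesis
`|c| ≠ 1` matters for the sphere `{±1}` in dimension one, where the poles have positive measure. -/
theorem toSphere_level_eq_zero {m : ℕ} {c : ℝ} (hc' : |c| ≠ 1) :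
    (volume : Measure (E (m + 1))).toSphere {ξ | (ξ : E (m + 1)) 0 = c} = 0 := by
  rcases lt_or_gt_of_ne hc' with hc | hc
  swap
  · convert measure_empty (μ := (volume : Measure (E (m + 1))).toSphere)
    refine eq_empty_of_forall_notMem fun ξ hξ => ?_
    have h1 := abs_coord_le_norm (ξ : E (m + 1)) 0
    have h2 : ‖(ξ : E (m + 1))‖ = 1 := by simp
    rw [h2, show (ξ : E (m + 1)) 0 = c from hξ] at h1
    linarith
  have hcont : Continuous fun ξ : Metric.sphere (0 : E (m + 1)) 1 => (ξ : E (m + 1)) 0 := by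
    fun_prop
  have hmeas : MeasurableSet {ξ : Metric.sphere (0 : E (m + 1)) 1 | (ξ : E (m + 1)) 0 = c} :=
    (isClosed_singleton.preimage hcont).measurableSet
  -- the cone over the circle of latitude is a null set
  rw [Measure.toSphere_apply' _ hmeas]
  have hnull : volume {y : E (m + 1) | y 0 = c * ‖y‖} = 0 := by
    have hm : MeasurableSet {y : E (m + 1) | ¬ y 0 = c * ‖y‖} := by
      have : IsClosed {y : E (m + 1) | y 0 = c * ‖y‖} :=
        isClosed_eq (by fun_prop) (by fun_prop)
      exact this.measurableSet.compl
    -- by Fubini, since each line in the direction of `e₀` meets the cone in at most two points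
    have := ae_mem_of_ae_add_linearMap_mem
      (LinearMap.toSpanSingleton ℝ (E (m + 1)) (EuclideanSpace.single 0 1)) volume volume hm ?_
    · have h2 := this
      rw [ae_iff] at h2
      simpa using h2
    · intro y
      set A := ‖y‖ ^ 2 - (y 0) ^ 2 with hA
      rw [ae_iff]
      set B := Real.sqrt (c ^ 2 * A / (1 - c ^ 2)) with hB
      have hc2 : 0 < 1 - c ^ 2 := by have := sq_lt_one_iff_abs_lt_one c |>.2 hc; linarith
      refine measure_mono_null (t := ({B - y 0, -B - y 0} : Set ℝ)) ?_
        ((Set.toFinite _).measure_zero _)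
      intro t ht
      simp only [mem_ofPred_eq, not_not, LinearMap.toSpanSingleton_apply] at ht
      have h0 : (y + t • EuclideanSpace.single (0 : Fin (m + 1)) (1 : ℝ)) 0 = y 0 + t := by simp
      have hn : ‖y + t • EuclideanSpace.single (0 : Fin (m + 1)) (1 : ℝ)‖ ^ 2 = A + (y 0 + t) ^ 2 := by
        rw [norm_add_sq_real, inner_smul_right, norm_smul]
        simp [EuclideanSpace.inner_single_right, hA]
        ring
      rw [h0] at ht
      have h3 : (y 0 + t) ^ 2 = c ^ 2 * (A + (y 0 + t) ^ 2) := by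
        rw [← hn, ← mul_pow, ← ht]
      have h4 : (y 0 + t) ^ 2 = c ^ 2 * A / (1 - c ^ 2) := by
        field_simp
        linarith
      have h5 : (y 0 + t) ^ 2 = B ^ 2 := by
        rw [hB, Real.sq_sqrt (h4 ▸ sq_nonneg _), h4]
      rcases sq_eq_sq_iff_eq_or_eq_neg.1 h5 with h | h
      · left; linarith
      · right; simp only [mem_singleton_iff]; linarith
  have : volume (Ioo (0 : ℝ) 1 • ((↑) '' {ξ : Metric.sphere (0 : E (m + 1)) 1 |
      (ξ : E (m + 1)) 0 = c} : Set (E (m + 1)))) = 0 := by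
    refine measure_mono_null ?_ hnull
    rintro _ ⟨t, ht, _, ⟨ξ, hξ, rfl⟩, rfl⟩
    have hξ1 : ‖(ξ : E (m + 1))‖ = 1 := by simp
    have : (ξ : E (m + 1)) 0 = c := hξ
    simp [norm_smul, abs_of_pos ht.1, this, mul_comm]
  rw [this, mul_zero]

theorem isClosed_hemisphere (m : ℕ) (s r : ℝ) : IsClosed (hemisphere m s r) := by
  have hcont : Continuous fun ξ : Metric.sphere (0 : E (m + 1)) 1 => r * (ξ : E (m + 1)) 0 := by
    fun_prop
  exact isClosed_Iic.preimage hcont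

theorem smul_mem_modelEnd {m : ℕ} {s r₀ r : ℝ} (h0 : 0 ≤ r₀) (hr : r₀ < r)
    {ξ : Metric.sphere (0 : E (m + 1)) 1} (hξ : ξ ∈ hemisphere m s r) :
    r • (ξ : E (m + 1)) ∈ modelEnd s r₀ := by
  refine ⟨by simpa using (show r * (ξ : E (m + 1)) 0 ≤ s from hξ), ?_⟩
  have : ‖r • (ξ : E (m + 1))‖ = r := by
    rw [norm_smul]; simp [abs_of_pos (h0.trans_lt hr)]
  rw [this]; exact hr

theorem continuousOn_hemisphere_smul {m : ℕ} {s r₀ r : ℝ} (h0 : 0 ≤ r₀) (hr : r₀ < r)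
    {f : E (m + 1) → ℝ} (hf : ContinuousOn f (modelEnd s r₀)) :
    ContinuousOn (fun ξ : Metric.sphere (0 : E (m + 1)) 1 => f (r • (ξ : E (m + 1))))
      (hemisphere m s r) :=
  hf.comp (by fun_prop) fun _ hξ => smul_mem_modelEnd h0 hr hξ

theorem integrableOn_hemisphere {m : ℕ} {s r₀ r : ℝ} (h0 : 0 ≤ r₀) (hr : r₀ < r)
    {f : E (m + 1) → ℝ} (hf : ContinuousOn f (modelEnd s r₀)) :
    IntegrableOn (fun ξ : Metric.sphere (0 : E (m + 1)) 1 => f (r • (ξ : E (m + 1))))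
      (hemisphere m s r) (volume : Measure (E (m + 1))).toSphere :=
  (continuousOn_hemisphere_smul h0 hr hf).integrableOn_compact (isClosed_hemisphere m s r).isCompact

/-- The integral over the spherical cap depends continuously on the radius; the cap itself moves, but
its edge has measure zero. -/
theorem continuousAt_hemisphere_integral {m : ℕ} {s r₀ t₀ : ℝ} (h0 : 0 ≤ r₀) (ht : r₀ < t₀)
    (hs : |s| ≠ t₀) {f : E (m + 1) → ℝ} (hf : ContinuousOn f (modelEnd s r₀)) :
    ContinuousAt (fun t : ℝ => ∫ ξ in hemisphere m s t, f (t • (ξ : E (m + 1)))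
      ∂(volume : Measure (E (m + 1))).toSphere) t₀ := by
  have ht0 : 0 < t₀ := h0.trans_lt ht
  obtain ⟨a, ha1, ha2⟩ := exists_between ht
  have hK : IsCompact ((halfSpace s : Set (E (m + 1))) ∩ (Metric.closedBall 0 (t₀ + 1) \ Metric.ball 0 a)) :=
    ((isCompact_closedBall (0 : E (m + 1)) (t₀ + 1)).diff Metric.isOpen_ball).inter_left
      (isClosed_halfSpace s)
  have hsub : ((halfSpace s : Set (E (m + 1))) ∩ (Metric.closedBall 0 (t₀ + 1) \ Metric.ball 0 a))
      ⊆ modelEnd s r₀ := by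
    rintro y ⟨hy, -, hy2⟩
    exact ⟨hy, ha1.trans_le (by simpa using hy2)⟩
  obtain ⟨C, hC⟩ := hK.exists_bound_of_continuousOn (hf.mono hsub)
  have hIoo : Ioo a (t₀ + 1) ∈ 𝓝 t₀ := Ioo_mem_nhds ha2 (by linarith)
  simp only [← integral_indicator (isClosed_hemisphere m s _).measurableSet]
  apply continuousAt_of_dominated (bound := fun _ => |C|)
  · filter_upwards [hIoo] with t ht'
    rw [aestronglyMeasurable_indicator_iff (isClosed_hemisphere m s _).measurableSet]
    exact (continuousOn_hemisphere_smul h0 (ha1.trans ht'.1) hf).aestronglyMeasurable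
      (isClosed_hemisphere m s _).measurableSet
  · filter_upwards [hIoo] with t ht'
    refine Eventually.of_forall fun ξ => ?_
    by_cases hξ : ξ ∈ hemisphere m s t
    · rw [indicator_of_mem hξ]
      refine (hC _ ⟨(smul_mem_modelEnd h0 (ha1.trans ht'.1) hξ).1, ?_⟩).trans (le_abs_self C)
      have : ‖t • (ξ : E (m + 1))‖ = t := by
        rw [norm_smul]; simp [abs_of_pos ((h0.trans_lt ha1).trans ht'.1)]
      simp only [Set.mem_sdiff, Metric.mem_closedBall, dist_zero_right, this, Metric.mem_ball, not_lt]
      exact ⟨ht'.2.le, ht'.1.le⟩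
    · rw [indicator_of_notMem hξ]; simp
  · exact integrable_const _
  · have hnull := toSphere_level_eq_zero (m := m) (c := s / t₀)
      (by rw [abs_div, abs_of_pos ht0, Ne, div_eq_one_iff_eq ht0.ne']; exact hs)
    have hae : ∀ᵐ ξ : Metric.sphere (0 : E (m + 1)) 1 ∂(volume : Measure (E (m + 1))).toSphere,
        (ξ : E (m + 1)) 0 ≠ s / t₀ := by
      rw [ae_iff]; simpa using hnull
    filter_upwards [hae] with ξ hξ
    have hne : t₀ * (ξ : E (m + 1)) 0 ≠ s := by
      intro h; apply hξ; rw [eq_div_iff ht0.ne', mul_comm]; exact h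
    have hct : Continuous fun t : ℝ => t * (ξ : E (m + 1)) 0 := by fun_prop
    rcases lt_or_gt_of_ne hne with h | h
    · have hev : ∀ᶠ t in 𝓝 t₀, ξ ∈ hemisphere m s t := by
        filter_upwards [hct.continuousAt.eventually_lt_const h] with t ht' using ht'.le
      have hcs : ContinuousAt (fun t : ℝ => f (t • (ξ : E (m + 1)))) t₀ := by
        have hc1 := hf (t₀ • (ξ : E (m + 1))) (smul_mem_modelEnd h0 ht hev.self_of_nhds)
        refine ContinuousWithinAt.tendsto hc1 |>.comp ?_
        rw [tendsto_nhdsWithin_iff]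
        refine ⟨by apply Continuous.tendsto' (by fun_prop); rfl, ?_⟩
        filter_upwards [hev, Ioi_mem_nhds ht] with t h1 h2 using smul_mem_modelEnd h0 h2 h1
      refine hcs.congr ?_
      filter_upwards [hev] with t ht' using (indicator_of_mem ht' (fun ξ : Metric.sphere (0 : E (m + 1)) 1 => f (t • (ξ : E (m + 1))))).symm
    · have hev : ∀ᶠ t in 𝓝 t₀, ξ ∉ hemisphere m s t := by
        filter_upwards [hct.continuousAt.eventually_const_lt h] with t ht' using not_le.2 ht'
      refine (continuousAt_const (y := (0 : ℝ))).congr ?_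
      filter_upwards [hev] with t ht' using (indicator_of_notMem ht' _).symm

theorem integrableOn_cutoff_mul {m : ℕ} {s r₀ r₁ r₂ : ℝ} (h1 : r₀ < r₁) {χ : ℝ → ℝ}
    (hχ : Continuous χ) (hχ1 : ∀ t < r₁, χ t = 0) (hχ2 : ∀ t, r₂ < t → χ t = 0)
    {h : E (m + 1) → ℝ} (hh : ContinuousOn h (modelEnd s r₀)) :
    IntegrableOn (fun y => χ ‖y‖ * h y) (halfSpace s) := by
  have hK : IsCompact ((halfSpace s : Set (E (m + 1))) ∩
      (Metric.closedBall 0 r₂ \ Metric.ball 0 r₁)) :=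
    ((isCompact_closedBall (0 : E (m + 1)) r₂).diff Metric.isOpen_ball).inter_left
      (isClosed_halfSpace s)
  have hsub : ((halfSpace s : Set (E (m + 1))) ∩ (Metric.closedBall 0 r₂ \ Metric.ball 0 r₁))
      ⊆ modelEnd s r₀ := by
    rintro y ⟨hy, -, hy2⟩
    exact ⟨hy, h1.trans_le (by simpa using hy2)⟩
  have hc : ContinuousOn (fun y => χ ‖y‖ * h y) ((halfSpace s : Set (E (m + 1))) ∩
      (Metric.closedBall 0 r₂ \ Metric.ball 0 r₁)) :=
    (hχ.comp continuous_norm).continuousOn.mul (hh.mono hsub)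
  refine (hc.integrableOn_compact hK).of_forall_sdiff_eq_zero
    (isClosed_halfSpace s).measurableSet ?_
  rintro y ⟨hy, hn⟩
  by_cases hy1 : ‖y‖ < r₁
  · simp [hχ1 _ hy1]
  by_cases hy2 : r₂ < ‖y‖
  · simp [hχ2 _ hy2]
  · exact absurd ⟨hy, by simpa using hy2, by simpa using hy1⟩ hn

/-- Polar coordinates on `{y₀ ≤ s}` for a function that is only controlled near infinity, multiplied
by a radial cutoff. -/
theorem integral_cutoff_polar {m : ℕ} {s r₀ r₁ r₂ : ℝ} (h0 : 0 ≤ r₀) (h1 : r₀ < r₁) {χ : ℝ → ℝ}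
    (hχ : Continuous χ) (hχ1 : ∀ t < r₁, χ t = 0) (hχ2 : ∀ t, r₂ < t → χ t = 0)
    {h : E (m + 1) → ℝ} (hh : ContinuousOn h (modelEnd s r₀)) :
    ∫ y in (halfSpace s : Set (E (m + 1))), χ ‖y‖ * h y = ∫ t in Ioi r₁, χ t * (t ^ m *
      ∫ ξ in hemisphere m s t, h (t • (ξ : E (m + 1)))
        ∂(volume : Measure (E (m + 1))).toSphere) := by
  have hm := (isClosed_halfSpace (m := m) s).measurableSet
  have hi := integrableOn_cutoff_mul h1 hχ hχ1 hχ2 hh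
  rw [← integral_indicator hm, integral_polar (hi.integrable_indicator hm)]
  have e : ∀ t ∈ Ioi (0 : ℝ), (t ^ m * ∫ ξ : Metric.sphere (0 : E (m + 1)) 1,
      (halfSpace s).indicator (fun y => χ ‖y‖ * h y) (t • (ξ : E (m + 1)))
        ∂(volume : Measure (E (m + 1))).toSphere) = χ t * (t ^ m *
      ∫ ξ in hemisphere m s t, h (t • (ξ : E (m + 1)))
        ∂(volume : Measure (E (m + 1))).toSphere) := by
    intro t ht
    rw [← integral_indicator (isClosed_hemisphere m s t).measurableSet, mul_left_comm,
      ← integral_const_mul (χ t)]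
    congr 2
    funext ξ
    have hmem : (t • (ξ : E (m + 1)) ∈ (halfSpace s : Set (E (m + 1)))) ↔ ξ ∈ hemisphere m s t := by
      simp [halfSpace, hemisphere]
    have hn : ‖t • (ξ : E (m + 1))‖ = t := by
      rw [norm_smul]; simp [abs_of_pos (show 0 < t from ht)]
    by_cases hξ : ξ ∈ hemisphere m s t
    · rw [indicator_of_mem (hmem.2 hξ), indicator_of_mem hξ, hn]
    · rw [indicator_of_notMem (fun h => hξ (hmem.1 h)), indicator_of_notMem hξ, mul_zero]
  rw [setIntegral_congr_fun measurableSet_Ioi e]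
  refine setIntegral_eq_of_subset_of_forall_sdiff_eq_zero measurableSet_Ioi
    (Ioi_subset_Ioi (h0.trans h1.le)) ?_ |>.trans ?_
  · rintro t ⟨-, ht⟩
    rcases lt_or_eq_of_le (not_lt.1 (show ¬ r₁ < t from ht)) with h | h
    · simp [hχ1 t h]
    · have : χ r₁ = 0 := by
        have hcl : r₁ ∈ closure (Iio r₁) := by rw [closure_Iio]; exact self_mem_Iic
        exact closure_minimal (fun t ht => hχ1 t ht) (isClosed_eq hχ continuous_const) hcl
      simp [h, this]
  · rfl

/-! ### Fluxes weighted by a cutoff -/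

theorem deriv_eq_zero_of_lt {φ : ℝ → ℝ} {r₁ : ℝ} (h : ∀ t ≤ r₁, φ t = 0) {t : ℝ} (ht : t < r₁) :
    deriv φ t = 0 := by
  have : φ =ᶠ[𝓝 t] fun _ => 0 := by
    filter_upwards [Iio_mem_nhds ht] with u hu using h u (le_of_lt hu)
  rw [this.deriv_eq]; simp

theorem deriv_eq_zero_of_gt {φ : ℝ → ℝ} {r₂ : ℝ} (h : ∀ t, r₂ ≤ t → φ t = 0) {t : ℝ} (ht : r₂ < t) :
    deriv φ t = 0 := by
  have : φ =ᶠ[𝓝 t] fun _ => 0 := by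
    filter_upwards [Ioi_mem_nhds ht] with u hu using h u (le_of_lt hu)
  rw [this.deriv_eq]; simp

/-- The radial component `J · y / |y|` of a vector field. -/
noncomputable def radialPart {n : ℕ} (J : Fin n → E n → ℝ) (y : E n) : ℝ := ∑ i, J i y * (y i / ‖y‖)

/-- The Euclidean divergence `∂ᵢ Jⁱ`, with derivatives taken within `S`. -/
noncomputable def divWithin {n : ℕ} (S : Set (E n)) (J : Fin n → E n → ℝ) (y : E n) : ℝ :=
  ∑ i, pd S (J i) i y

theorem hasFDerivAt_norm {n : ℕ} {y : E n} (hy : y ≠ 0) :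
    HasFDerivAt (fun z : E n => ‖z‖) (‖y‖⁻¹ • innerSL ℝ y) y := by
  have h1 : HasFDerivAt (fun z : E n => ‖z‖ ^ 2) (2 • innerSL ℝ y) y :=
    (hasStrictFDerivAt_norm_sq y).hasFDerivAt
  have hn : ‖y‖ ≠ 0 := norm_ne_zero_iff.2 hy
  have h2 := h1.sqrt (pow_ne_zero 2 hn)
  simp only [Real.sqrt_sq (norm_nonneg _)] at h2
  refine h2.congr_fderiv ?_
  ext v
  simp
  field_simp

theorem continuousOn_radialPart {m : ℕ} {s r₀ : ℝ} (h0 : 0 ≤ r₀) {J : Fin (m + 1) → E (m + 1) → ℝ}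
    (hJ : ∀ i, ContDiffOn ℝ ∞ (J i) (modelEnd s r₀)) :
    ContinuousOn (radialPart J) (modelEnd s r₀) := by
  refine continuousOn_finsetSum _ fun i _ => (hJ i).continuousOn.mul ?_
  refine ContinuousOn.div (by fun_prop) (by fun_prop) fun y hy => ?_
  exact (h0.trans_lt hy.2).ne'

theorem continuousOn_divWithin {m : ℕ} {s r₀ : ℝ} {J : Fin (m + 1) → E (m + 1) → ℝ}
    (hJ : ∀ i, ContDiffOn ℝ ∞ (J i) (modelEnd s r₀)) :
    ContinuousOn (divWithin (halfSpace s) J) (modelEnd s r₀) :=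
  continuousOn_finsetSum _ fun i _ => (contDiffOn_pd (hJ i) i).continuousOn

/-- The divergence theorem for `φ(|y|) J`: the flux of `J` through spherical caps, averaged with weight
`φ'`, in terms of the flux through `{y₀ = s}` and of the divergence. -/
theorem integral_deriv_mul_flux {m : ℕ} {s r₀ r₁ r₂ : ℝ} (h0 : 0 ≤ r₀) (h1 : r₀ < r₁) {φ : ℝ → ℝ}
    (hφ : ContDiff ℝ ∞ φ) (hφ1 : ∀ t ≤ r₁, φ t = 0) (hφ2 : ∀ t, r₂ ≤ t → φ t = 0)
    {J : Fin (m + 1) → E (m + 1) → ℝ} (hJ : ∀ i, ContDiffOn ℝ ∞ (J i) (modelEnd s r₀)) :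
    ∫ t in Ioi r₁, deriv φ t * (t ^ m * ∫ ξ in hemisphere m s t, radialPart J (t • (ξ : E (m + 1)))
        ∂(volume : Measure (E (m + 1))).toSphere)
      = (∫ z : E m, φ ‖(sigmaPoint s z : E (m + 1))‖ * J 0 (sigmaPoint s z))
        - ∫ y in (halfSpace s : Set (E (m + 1))), φ ‖y‖ * divWithin (halfSpace s) J y := by
  have hφ'c : Continuous (deriv φ) := hφ.continuous_deriv (by simp)
  have hpos : 0 < r₁ := h0.trans_lt h1
  have hfar : ∀ {y : E (m + 1)}, y ∈ halfSpace s → ¬ r₀ < ‖y‖ → ∀ i,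
      (fun z => φ ‖z‖ * J i z) =ᶠ[𝓝 y] fun _ => 0 := by
    intro y _ hy i
    have : ‖y‖ < r₁ := (not_lt.1 hy).trans_lt h1
    filter_upwards [(isOpen_lt continuous_norm continuous_const).mem_nhds this] with z hz
    simp [hφ1 _ (le_of_lt (show ‖z‖ < r₁ from hz))]
  have hφn : ∀ {y : E (m + 1)}, r₀ < ‖y‖ → ContDiffAt ℝ 1 (fun z : E (m + 1) => φ ‖z‖) y := by
    intro y hy
    have hy0 : y ≠ 0 := norm_pos_iff.1 (h0.trans_lt hy)
    exact ((hφ.of_le (by simp)).contDiffAt).comp y (contDiffAt_norm ℝ hy0)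
  have hK : ∀ i, ContDiffOn ℝ 1 (fun y => φ ‖y‖ * J i y) (halfSpace s) := by
    intro i y hy
    by_cases hy' : r₀ < ‖y‖
    · have h2 := (hJ i y ⟨hy, hy'⟩).of_le (m := 1) (by simp)
      rw [modelEnd_eq, contDiffWithinAt_inter ((isOpen_norm_gt r₀).mem_nhds hy')] at h2
      exact (hφn hy').contDiffWithinAt.mul h2
    · exact (contDiffAt_const.congr_of_eventuallyEq (hfar hy hy' i)).contDiffWithinAt
  have hpd : ∀ y ∈ (halfSpace s : Set (E (m + 1))), ∀ i,
      pd (halfSpace s) (fun y => φ ‖y‖ * J i y) i y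
        = deriv φ ‖y‖ * (J i y * (y i / ‖y‖)) + φ ‖y‖ * pd (halfSpace s) (J i) i y := by
    intro y hy i
    by_cases hy' : r₀ < ‖y‖
    · have hy0 : y ≠ 0 := norm_pos_iff.1 (h0.trans_lt hy')
      have hd1 : HasFDerivAt (fun z : E (m + 1) => φ ‖z‖)
          (deriv φ ‖y‖ • (‖y‖⁻¹ • innerSL ℝ y)) y :=
        (hφ.differentiable (by simp) _).hasDerivAt.comp_hasFDerivAt y (hasFDerivAt_norm hy0)
      have hd2 := (differentiableWithinAt_halfSpace (hJ i) ⟨hy, hy'⟩).hasFDerivWithinAt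
      rw [pd, (hd1.hasFDerivWithinAt.fun_mul hd2).fderivWithin (uniqueDiffOn_halfSpace s y hy)]
      simp [pd, EuclideanSpace.inner_single_right]
      ring
    · have h3 := hfar hy hy' i
      have : ‖y‖ < r₁ := (not_lt.1 hy').trans_lt h1
      rw [pd, (h3.filter_mono nhdsWithin_le_nhds).fderivWithin_eq h3.self_of_nhds,
        deriv_eq_zero_of_lt hφ1 this, hφ1 _ this.le]
      simp
  have key := integral_div_halfSpace (R := r₂) (fun i y => φ ‖y‖ * J i y) hK
    (fun i y hy => by simp [hφ2 _ hy])
  rw [← key]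
  have e1 : ∫ y in (halfSpace s : Set (E (m + 1))), ∑ i, pd (halfSpace s) (fun y => φ ‖y‖ * J i y) i y
      = ∫ y in (halfSpace s : Set (E (m + 1))),
        (deriv φ ‖y‖ * radialPart J y + φ ‖y‖ * divWithin (halfSpace s) J y) := by
    refine setIntegral_congr_fun (isClosed_halfSpace s).measurableSet fun y hy => ?_
    simp only [hpd y hy, Finset.sum_add_distrib, radialPart, divWithin, Finset.mul_sum]
  have hd1 : ∀ t < r₁, deriv φ t = 0 := fun t ht => deriv_eq_zero_of_lt hφ1 ht
  have hd2 : ∀ t, r₂ < t → deriv φ t = 0 := fun t ht => deriv_eq_zero_of_gt hφ2 ht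
  rw [e1, integral_add (integrableOn_cutoff_mul h1 hφ'c hd1 hd2 (continuousOn_radialPart h0 hJ))
    (integrableOn_cutoff_mul h1 hφ.continuous (fun t ht => hφ1 t ht.le) (fun t ht => hφ2 t ht.le)
      (continuousOn_divWithin hJ)), add_sub_cancel_right,
    integral_cutoff_polar h0 h1 hφ'c hd1 hd2 (continuousOn_radialPart h0 hJ)]

theorem norm_sigmaPoint_sq {m : ℕ} (s : ℝ) (z : E m) : ‖sigmaPoint s z‖ ^ 2 = s ^ 2 + ‖z‖ ^ 2 := by
  simp [EuclideanSpace.norm_sq_eq, sigmaPoint, Fin.sum_univ_succ]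

theorem norm_sigmaPoint {m : ℕ} (s : ℝ) (z : E m) :
    ‖sigmaPoint s z‖ = Real.sqrt (s ^ 2 + ‖z‖ ^ 2) := by
  rw [← norm_sigmaPoint_sq, Real.sqrt_sq (norm_nonneg _)]

theorem pd_univ_eq {m : ℕ} {S : ℝ} (f : E (m + 1) → ℝ) (i : Fin (m + 1)) {z : E (m + 1)}
    (hz : ‖z‖ < S) : pd (halfSpace S) f i z = pd univ f i z := by
  have hnh : (halfSpace S : Set (E (m + 1))) ∈ 𝓝 z := by
    filter_upwards [(isOpen_lt continuous_norm continuous_const).mem_nhds hz] with w hw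
    exact (le_abs_self _).trans ((abs_coord_le_norm w 0).trans (le_of_lt hw))
  rw [pd, pd, fderivWithin_of_mem_nhds hnh, fderivWithin_univ]

theorem sqrt_sq_add_cornerRadius_sq {s t : ℝ} (ht : |s| ≤ t) :
    Real.sqrt (s ^ 2 + cornerRadius s t ^ 2) = t := by
  have h : s ^ 2 ≤ t ^ 2 := by
    rw [← sq_abs]; exact pow_le_pow_left₀ (abs_nonneg s) ht 2
  rw [cornerRadius, Real.sq_sqrt (by linarith), add_sub_cancel,
    Real.sqrt_sq ((abs_nonneg s).trans ht)]

theorem cornerRadius_sqrt {s ρ : ℝ} (hρ : 0 ≤ ρ) :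
    cornerRadius s (Real.sqrt (s ^ 2 + ρ ^ 2)) = ρ := by
  rw [cornerRadius, Real.sq_sqrt (by positivity), add_sub_cancel_left, Real.sqrt_sq hρ]

theorem cornerRadius_nonneg (s t : ℝ) : 0 ≤ cornerRadius s t := Real.sqrt_nonneg _

theorem cornerRadius_lt {s t u : ℝ} (ht : |s| ≤ t) (hu : t < u) :
    cornerRadius s t < cornerRadius s u := by
  have h : s ^ 2 ≤ t ^ 2 := by
    rw [← sq_abs]; exact pow_le_pow_left₀ (abs_nonneg s) ht 2
  have h0 := (abs_nonneg s).trans ht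
  exact Real.sqrt_lt_sqrt (by linarith) (by nlinarith)

theorem image_sqrt_Ioi {s r : ℝ} (hr : |s| ≤ r) :
    (fun ρ => Real.sqrt (s ^ 2 + ρ ^ 2)) '' Ioi (cornerRadius s r) = Ioi r := by
  ext t
  constructor
  · rintro ⟨ρ, hρ, rfl⟩
    rw [mem_Ioi, ← sqrt_sq_add_cornerRadius_sq hr]
    have := pow_lt_pow_left₀ (show cornerRadius s r < ρ from hρ) (cornerRadius_nonneg s r)
      two_ne_zero
    exact Real.sqrt_lt_sqrt (by positivity) (by linarith)
  · intro ht
    exact ⟨cornerRadius s t, cornerRadius_lt hr ht,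
      sqrt_sq_add_cornerRadius_sq (hr.trans (le_of_lt (show r < t from ht)))⟩

theorem hemisphere_eq_univ {m : ℕ} {S ρ : ℝ} (hρ : 0 ≤ ρ) (h : ρ ≤ S) :
    hemisphere m S ρ = univ := by
  refine eq_univ_of_forall fun ξ => ?_
  have h4 := abs_coord_le_norm (ξ : E (m + 1)) 0
  have h5 : ‖(ξ : E (m + 1))‖ = 1 := by simp
  rw [h5] at h4
  exact (mul_le_of_le_one_right hρ ((le_abs_self _).trans h4)).trans h

/-- The analogue of `integral_deriv_mul_flux` in the boundary hyperplane, parametrized by the distance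
`t = √(s² + |z|²)` from the origin of the ambient space. It follows from that lemma for a half-space
so large that its boundary avoids the support of the cutoff. -/
theorem integral_deriv_mul_corner {m : ℕ} {s r₀ r₁ r₂ : ℝ} (hs : |s| ≤ r₀) (h1 : r₀ < r₁)
    (h2 : r₁ < r₂) {φ : ℝ → ℝ}
    (hφ : ContDiff ℝ ∞ φ) (hφ1 : ∀ t ≤ r₁, φ t = 0) (hφ2 : ∀ t, r₂ ≤ t → φ t = 0)
    {Y : Fin (m + 1) → E (m + 1) → ℝ}
    (hY : ∀ i, ContDiffOn ℝ ∞ (Y i) {z | cornerRadius s r₀ < ‖z‖}) :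
    ∫ t in Ioi r₁, deriv φ t * (cornerRadius s t ^ m *
        ∫ ξ : Metric.sphere (0 : E (m + 1)) 1, radialPart Y (cornerRadius s t • (ξ : E (m + 1)))
        ∂(volume : Measure (E (m + 1))).toSphere)
      = - ∫ z : E (m + 1), φ ‖sigmaPoint s z‖ * divWithin univ Y z := by
  have hs1 : |s| ≤ r₁ := hs.trans h1.le
  have hs2 : |s| ≤ r₂ := hs1.trans h2.le
  set f : ℝ → ℝ := fun ρ => Real.sqrt (s ^ 2 + ρ ^ 2) with hf
  set ρ₁ := cornerRadius s r₁ with hρ₁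
  set ρ₂ := cornerRadius s r₂ with hρ₂
  have hρ₁pos : 0 < ρ₁ := (cornerRadius_nonneg s r₀).trans_lt (cornerRadius_lt hs h1)
  have hfmono : ∀ {ρ ρ'}, 0 ≤ ρ → ρ ≤ ρ' → f ρ ≤ f ρ' := fun {ρ ρ'} h h' =>
    Real.sqrt_le_sqrt (by gcongr)
  have hf1 : f ρ₁ = r₁ := sqrt_sq_add_cornerRadius_sq hs1
  have hf2 : f ρ₂ = r₂ := sqrt_sq_add_cornerRadius_sq hs2
  -- the cutoff as a function of the radius in `Σ_s`, extended by `0` to negative radii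
  set ψ : ℝ → ℝ := fun ρ => if 0 < ρ then φ (f ρ) else 0 with hψ
  have hψ1 : ∀ ρ ≤ ρ₁, ψ ρ = 0 := by
    intro ρ hρ
    by_cases h : 0 < ρ
    · simp only [hψ, if_pos h]
      exact hφ1 _ ((hfmono h.le hρ).trans hf1.le)
    · simp only [hψ, if_neg h]
  have hψ2 : ∀ ρ, ρ₂ ≤ ρ → ψ ρ = 0 := by
    intro ρ hρ
    have h : 0 < ρ := hρ₁pos.trans_le ((cornerRadius_lt hs1 h2).le.trans hρ)
    simp only [hψ, if_pos h]
    exact hφ2 _ (hf2.symm.le.trans (hfmono (cornerRadius_nonneg _ _) hρ))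
  have hψloc : ∀ {ρ}, 0 < ρ → ψ =ᶠ[𝓝 ρ] fun ρ => φ (f ρ) := by
    intro ρ hρ
    filter_upwards [Ioi_mem_nhds hρ] with u hu
    simp only [hψ, if_pos (show 0 < u from hu)]
  have hfd : ∀ {ρ}, 0 < ρ → HasDerivAt f (ρ / f ρ) ρ := by
    intro ρ hρ
    have h := ((hasDerivAt_pow 2 ρ).const_add (s ^ 2)).sqrt
      (show s ^ 2 + ρ ^ 2 ≠ 0 by positivity)
    convert h using 1
    simp only [hf]
    norm_num
    field_simp
  have hψd : ∀ {ρ}, 0 < ρ → deriv ψ ρ = deriv φ (f ρ) * (ρ / f ρ) := by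
    intro ρ hρ
    rw [(hψloc hρ).deriv_eq]
    exact ((hφ.differentiable (by simp) _).hasDerivAt.comp ρ (hfd hρ)).deriv
  have hψc : ContDiff ℝ ∞ ψ := by
    rw [contDiff_iff_contDiffAt]
    intro ρ
    by_cases h : ρ < ρ₁
    · refine (contDiffAt_const (c := (0 : ℝ))).congr_of_eventuallyEq ?_
      filter_upwards [Iio_mem_nhds h] with u hu using hψ1 u (le_of_lt hu)
    · have hρ : 0 < ρ := hρ₁pos.trans_le (not_lt.1 h)
      refine ContDiffAt.congr_of_eventuallyEq ?_ (hψloc hρ)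
      refine hφ.contDiffAt.comp ρ (ContDiffAt.sqrt (by fun_prop) ?_)
      positivity
  -- `{y₀ = S}` avoids the support of the cutoff
  set S := ρ₂ + 1 with hS
  have hρ₂0 : 0 ≤ ρ₂ := cornerRadius_nonneg _ _
  have key := integral_deriv_mul_flux (s := S) (cornerRadius_nonneg s r₀) (cornerRadius_lt hs h1)
    hψc hψ1 hψ2 (J := Y) (fun i => (hY i).mono fun z hz => hz.2)
  have hz1 : ∀ z : E m, ψ ‖(sigmaPoint S z : E (m + 1))‖ = 0 := by
    intro z
    refine hψ2 _ ?_
    have := abs_coord_le_norm (sigmaPoint S z) 0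
    have h3 : (sigmaPoint S z : E (m + 1)) 0 = S := rfl
    rw [h3] at this
    linarith [le_abs_self S]
  simp only [hz1, zero_mul, integral_zero, zero_sub] at key
  have hR : ∫ z in (halfSpace S : Set (E (m + 1))), ψ ‖z‖ * divWithin (halfSpace S) Y z
      = ∫ z : E (m + 1), φ ‖sigmaPoint s z‖ * divWithin univ Y z := by
    have hφψ : ∀ z : E (m + 1), φ ‖sigmaPoint s z‖ = ψ ‖z‖ := by
      intro z
      rw [norm_sigmaPoint]
      by_cases h : 0 < ‖z‖
      · simp only [hψ, if_pos h, hf]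
      · have h0 : ‖z‖ = 0 := le_antisymm (not_lt.1 h) (norm_nonneg _)
        simp only [hψ, h0, lt_irrefl, if_false]
        refine hφ1 _ ?_
        rw [zero_pow two_ne_zero, add_zero, Real.sqrt_sq_eq_abs]; exact hs1
    rw [← integral_indicator (isClosed_halfSpace S).measurableSet]
    congr 1
    funext z
    rw [hφψ]
    by_cases hz : ‖z‖ < S
    · have hmem : z ∈ (halfSpace S : Set (E (m + 1))) :=
        (le_abs_self _).trans ((abs_coord_le_norm z 0).trans hz.le)
      rw [indicator_of_mem hmem]
      simp only [divWithin, pd_univ_eq _ _ hz]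
    · have : ψ ‖z‖ = 0 := hψ2 _ (by linarith [not_lt.1 hz])
      rw [this, zero_mul]
      by_cases hmem : z ∈ (halfSpace S : Set (E (m + 1)))
      · rw [indicator_of_mem hmem, this, zero_mul]
      · rw [indicator_of_notMem hmem]
  -- substitute `t = √(s² + ρ²)`
  rw [← hR, ← key, ← image_sqrt_Ioi hs1, integral_image_eq_integral_abs_deriv_smul measurableSet_Ioi
    (fun ρ hρ => (hfd (hρ₁pos.trans hρ)).hasDerivWithinAt) ?_]
  · refine setIntegral_congr_fun measurableSet_Ioi fun ρ hρ => ?_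
    have hρ0 : 0 < ρ := hρ₁pos.trans hρ
    have hfp : 0 < f ρ := Real.sqrt_pos.2 (by positivity)
    simp only [smul_eq_mul]
    rw [cornerRadius_sqrt hρ0.le, hψd hρ0, abs_of_nonneg (by positivity)]
    by_cases h : ρ ≤ S
    · rw [hemisphere_eq_univ hρ0.le h, setIntegral_univ]
      ring
    · have h6 : deriv φ (f ρ) = 0 := by
        refine deriv_eq_zero_of_gt hφ2 ?_
        rw [← hf2]
        refine Real.sqrt_lt_sqrt (by positivity) ?_
        have h7 : ρ₂ < ρ := by linarith [not_le.1 h]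
        gcongr
      rw [h6]; ring
  · intro ρ hρ ρ' hρ' h
    have h0 : 0 ≤ ρ := (hρ₁pos.trans hρ).le
    have h0' : 0 ≤ ρ' := (hρ₁pos.trans hρ').le
    rw [← cornerRadius_sqrt (s := s) h0, ← cornerRadius_sqrt (s := s) h0']
    exact congrArg _ h

/-! ### Convergence of the difference of fluxes -/

/-- A smooth monotone step from `0` (for `t ≤ r`) to `1` (for `t ≥ r + h`). -/
noncomputable def smoothStep (r h t : ℝ) : ℝ := Real.smoothTransition ((t - r) / h)

theorem smoothStep_contDiff (r h : ℝ) : ContDiff ℝ ∞ (smoothStep r h) :=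
  (Real.smoothTransition.contDiff (n := ⊤)).comp ((contDiff_id.sub contDiff_const).div_const h)

theorem smoothStep_monotone {r h : ℝ} (hh : 0 < h) : Monotone (smoothStep r h) := fun t u htu =>
  Real.smoothTransition.monotone (by gcongr)

theorem smoothStep_of_le {r h t : ℝ} (hh : 0 < h) (ht : t ≤ r) : smoothStep r h t = 0 :=
  Real.smoothTransition.zero_of_nonpos (div_nonpos_of_nonpos_of_nonneg (by linarith) hh.le)

theorem smoothStep_of_ge {r h t : ℝ} (hh : 0 < h) (ht : r + h ≤ t) : smoothStep r h t = 1 :=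
  Real.smoothTransition.one_of_one_le ((one_le_div hh).2 (by linarith))

theorem deriv_smoothStep_nonneg {r h : ℝ} (hh : 0 < h) (t : ℝ) : 0 ≤ deriv (smoothStep r h) t :=
  (smoothStep_monotone hh).deriv_nonneg

theorem deriv_smoothStep_of_lt {r h t : ℝ} (hh : 0 < h) (ht : t < r) :
    deriv (smoothStep r h) t = 0 :=
  deriv_eq_zero_of_lt (fun _ hu => smoothStep_of_le hh hu) ht

theorem deriv_smoothStep_of_gt {r h t : ℝ} (hh : 0 < h) (ht : r + h < t) :
    deriv (smoothStep r h) t = 0 := by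
  have : smoothStep r h =ᶠ[𝓝 t] fun _ => 1 := by
    filter_upwards [Ioi_mem_nhds ht] with u hu using smoothStep_of_ge hh (le_of_lt hu)
  rw [this.deriv_eq]; simp

/-- The derivatives of steps at `r` of width `h → 0` are an approximate identity at `r`. -/
theorem integral_deriv_smoothStep_mul {M : ℝ → ℝ} {R a r ε : ℝ} (hM : ContinuousOn M (Ioi R))
    (hR : R < r) (ha : a ≤ r) (hε : 0 < ε) :
    ∃ δ > 0, ∀ h ∈ Ioo 0 δ, IntegrableOn (fun t => deriv (smoothStep r h) t * M t) (Ioi a) ∧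
      |(∫ t in Ioi a, deriv (smoothStep r h) t * M t) - M r| ≤ ε := by
  obtain ⟨δ, hδ, hd⟩ := Metric.continuousAt_iff.1 (hM.continuousAt (Ioi_mem_nhds hR)) ε hε
  refine ⟨δ, hδ, fun h hh => ?_⟩
  have hdc : Continuous (deriv (smoothStep r h)) := (smoothStep_contDiff r h).continuous_deriv (by simp)
  have hle : r ≤ r + h := by linarith [hh.1]
  have hcont : ContinuousOn (fun t => deriv (smoothStep r h) t * M t) (Icc r (r + h)) :=
    hdc.continuousOn.mul (hM.mono fun t ht => hR.trans_le ht.1)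
  have hz : ∀ t, t ∉ Icc r (r + h) → deriv (smoothStep r h) t * M t = 0 := by
    intro t ht
    by_cases h1 : t < r
    · rw [deriv_smoothStep_of_lt hh.1 h1, zero_mul]
    · have h2 : r + h < t := by
        by_contra h3
        exact ht ⟨not_lt.1 h1, not_lt.1 h3⟩
      rw [deriv_smoothStep_of_gt hh.1 h2, zero_mul]
  have hint : Integrable (fun t => deriv (smoothStep r h) t * M t) :=
    (hcont.integrableOn_Icc).integrable_of_forall_notMem_eq_zero hz
  refine ⟨hint.integrableOn, ?_⟩
  have e0 : (∫ t in Ioi a, deriv (smoothStep r h) t * M t)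
      = ∫ t in r..(r + h), deriv (smoothStep r h) t * M t := by
    rw [intervalIntegral.integral_of_le hle]
    apply setIntegral_eq_of_subset_of_ae_sdiff_eq_zero measurableSet_Ioi.nullMeasurableSet
      (fun t ht => ha.trans_lt ht.1)
    have : ∀ᵐ t : ℝ, t ≠ r := by simp [ae_iff]
    filter_upwards [this] with t ht1 ht2
    refine hz t fun h3 => ht2.2 ⟨lt_of_le_of_ne h3.1 ht1.symm, h3.2⟩
  have e1 : ∫ t in r..(r + h), deriv (smoothStep r h) t = 1 := by
    rw [intervalIntegral.integral_deriv_eq_sub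
      (fun t _ => (smoothStep_contDiff r h).differentiable (by simp) t) (hdc.intervalIntegrable _ _),
      smoothStep_of_ge hh.1 le_rfl, smoothStep_of_le hh.1 le_rfl, sub_zero]
  have e2 : (∫ t in r..(r + h), deriv (smoothStep r h) t * M t) - M r
      = ∫ t in r..(r + h), deriv (smoothStep r h) t * (M t - M r) := by
    have i1 : IntervalIntegrable (fun t => deriv (smoothStep r h) t * M t) volume r (r + h) :=
      hint.intervalIntegrable
    have i2 : IntervalIntegrable (fun t => deriv (smoothStep r h) t * M r) volume r (r + h) :=
      (hdc.intervalIntegrable _ _).mul_const _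
    simp only [mul_sub]
    rw [intervalIntegral.integral_sub i1 i2, intervalIntegral.integral_mul_const, e1, one_mul]
  rw [e0, e2]
  have e3 : ‖∫ t in r..(r + h), deriv (smoothStep r h) t * (M t - M r)‖
      ≤ ∫ t in r..(r + h), deriv (smoothStep r h) t * ε := by
    refine intervalIntegral.norm_integral_le_of_norm_le hle ?_ ((hdc.intervalIntegrable _ _).mul_const _)
    refine Eventually.of_forall fun t ht => ?_
    rw [norm_mul, Real.norm_of_nonneg (deriv_smoothStep_nonneg hh.1 t)]
    refine mul_le_mul_of_nonneg_left ?_ (deriv_smoothStep_nonneg hh.1 t)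
    have : dist t r < δ := by
      rw [Real.dist_eq, abs_of_nonneg (by linarith [ht.1])]
      linarith [ht.2, hh.2]
    exact (hd this).le
  rw [intervalIntegral.integral_mul_const, e1, one_mul] at e3
  exact e3

theorem integral_mul_le_of_cutoff {X : Type*} [MeasurableSpace X] {μ : Measure X} {S : Set X}
    {χ D : X → ℝ} (hD : IntegrableOn D S μ)
    (h1 : ∀ x, x ∉ S → χ x = 0) (h2 : ∀ x, |χ x| ≤ 1) :
    |∫ x, χ x * D x ∂μ| ≤ ∫ x in S, |D x| ∂μ := by
  rw [← setIntegral_eq_integral_of_forall_compl_eq_zero (s := S)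
    (fun x hx => by rw [h1 x hx, zero_mul]), ← Real.norm_eq_abs]
  refine norm_integral_le_of_norm_le hD.abs (Eventually.of_forall fun x => ?_)
  rw [norm_mul, Real.norm_eq_abs, Real.norm_eq_abs]
  exact mul_le_of_le_one_left (abs_nonneg _) (h2 x)

/-- The flux of the vector field `J` through `{|y| = t, y₀ ≤ s}` minus the flux of `Y`, a vector field
on the hyperplane `{y₀ = s}`, through the boundary sphere. -/
noncomputable def fluxDifference {m : ℕ} (s : ℝ) (J : Fin (m + 1 + 1) → E (m + 1 + 1) → ℝ)
    (Y : Fin (m + 1) → E (m + 1) → ℝ) (t : ℝ) : ℝ :=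
  t ^ (m + 1) * (∫ ξ in hemisphere (m + 1) s t, radialPart J (t • (ξ : E (m + 1 + 1)))
      ∂(volume : Measure (E (m + 1 + 1))).toSphere)
  - cornerRadius s t ^ m * ∫ ξ : Metric.sphere (0 : E (m + 1)) 1,
      radialPart Y (cornerRadius s t • (ξ : E (m + 1))) ∂(volume : Measure (E (m + 1))).toSphere

section FluxDifference

variable {m : ℕ} {s r₀ : ℝ} {J : Fin (m + 1 + 1) → E (m + 1 + 1) → ℝ}
  {Y : Fin (m + 1) → E (m + 1) → ℝ}

theorem continuous_sigmaPoint (m : ℕ) (s : ℝ) : Continuous (sigmaPoint s : E m → E (m + 1)) := by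
  refine (PiLp.continuous_toLp 2 _).comp (continuous_pi fun i => ?_)
  refine Fin.cases ?_ (fun j => ?_) i
  · simpa using continuous_const
  · simp only [Fin.cons_succ]; fun_prop

theorem sigmaPoint_mem {z : E (m + 1)} : (sigmaPoint s z : E (m + 1 + 1)) ∈ halfSpace s :=
  le_refl s

theorem continuousOn_flux (hs : |s| ≤ r₀) (hJ : ∀ i, ContDiffOn ℝ ∞ (J i) (modelEnd s r₀)) :
    ContinuousOn (fun t : ℝ => t ^ (m + 1) * ∫ ξ in hemisphere (m + 1) s t,
      radialPart J (t • (ξ : E (m + 1 + 1))) ∂(volume : Measure (E (m + 1 + 1))).toSphere)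
      (Ioi r₀) := fun _ ht =>
  ((continuousAt_id.pow _).mul (continuousAt_hemisphere_integral ((abs_nonneg s).trans hs) ht
    (hs.trans_lt ht).ne (continuousOn_radialPart ((abs_nonneg s).trans hs) hJ))).continuousWithinAt

theorem continuousOn_corner (hs : |s| ≤ r₀)
    (hY : ∀ i, ContDiffOn ℝ ∞ (Y i) {z | cornerRadius s r₀ < ‖z‖}) :
    ContinuousOn (fun t : ℝ => cornerRadius s t ^ m * ∫ ξ : Metric.sphere (0 : E (m + 1)) 1,
      radialPart Y (cornerRadius s t • (ξ : E (m + 1))) ∂(volume : Measure (E (m + 1))).toSphere)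
      (Ioi r₀) := by
  intro t ht
  have hc : Continuous (cornerRadius s) := by unfold cornerRadius; fun_prop
  have hlt : cornerRadius s r₀ < cornerRadius s t := cornerRadius_lt hs ht
  have hpos : 0 < cornerRadius s t := (cornerRadius_nonneg _ _).trans_lt hlt
  set S := cornerRadius s t + 1 with hS
  suffices h : ContinuousAt (fun ρ : ℝ => ∫ ξ : Metric.sphere (0 : E (m + 1)) 1,
      radialPart Y (ρ • (ξ : E (m + 1))) ∂(volume : Measure (E (m + 1))).toSphere)
      (cornerRadius s t) from
    ((hc.continuousAt.pow _).mul (h.comp (f := cornerRadius s) hc.continuousAt)).continuousWithinAt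
  have h1 := continuousAt_hemisphere_integral (m := m) (s := S) (cornerRadius_nonneg s r₀) hlt
    (by rw [abs_of_pos (by linarith)]; linarith) (continuousOn_radialPart (cornerRadius_nonneg s r₀)
      fun i => (hY i).mono fun z hz => hz.2)
  refine h1.congr ?_
  filter_upwards [Ioo_mem_nhds hpos (show cornerRadius s t < S by linarith)] with ρ hρ
  rw [hemisphere_eq_univ hρ.1.le hρ.2.le, setIntegral_univ]

/-- For a cutoff `φ` with values in `[-1, 1]`, the average of `fluxDifference` with weight `φ'` is
bounded by tails of convergent integrals. -/
theorem abs_integral_deriv_mul_fluxDifference_le (hs : |s| ≤ r₀)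
    (hJ : ∀ i, ContDiffOn ℝ ∞ (J i) (modelEnd s r₀))
    (hY : ∀ i, ContDiffOn ℝ ∞ (Y i) {z | cornerRadius s r₀ < ‖z‖}) {R : ℝ} (hR : r₀ ≤ R)
    (hD : IntegrableOn (divWithin (halfSpace s) J) (modelEnd s R))
    (hB : IntegrableOn (fun z => J 0 (sigmaPoint s z) + divWithin univ Y z)
      {z : E (m + 1) | R < ‖sigmaPoint s z‖}) {r₁ r₂ : ℝ} (h1 : R < r₁) (h2 : r₁ < r₂) {φ : ℝ → ℝ}
    (hφ : ContDiff ℝ ∞ φ) (hφ1 : ∀ t ≤ r₁, φ t = 0) (hφ2 : ∀ t, r₂ ≤ t → φ t = 0)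
    (hφ3 : ∀ t, |φ t| ≤ 1) :
    |∫ t in Ioi r₁, deriv φ t * fluxDifference s J Y t| ≤
      (∫ y in modelEnd s R, |divWithin (halfSpace s) J y|)
      + ∫ z in {z : E (m + 1) | R < ‖sigmaPoint s z‖}, |J 0 (sigmaPoint s z) + divWithin univ Y z| := by
  have hr0 : 0 ≤ r₀ := (abs_nonneg s).trans hs
  have h01 : r₀ < r₁ := hR.trans_lt h1
  have hφ'c : Continuous (deriv φ) := hφ.continuous_deriv (by simp)
  have hd2 : ∀ t, r₂ < t → deriv φ t = 0 := fun t ht => deriv_eq_zero_of_gt hφ2 ht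
  have hi : ∀ {f : ℝ → ℝ}, ContinuousOn f (Ioi r₀) →
      IntegrableOn (fun t => deriv φ t * f t) (Ioi r₁) := by
    intro f hf
    have hc : ContinuousOn (fun t => deriv φ t * f t) (Icc r₁ r₂) :=
      hφ'c.continuousOn.mul (hf.mono fun t ht => h01.trans_le ht.1)
    refine (hc.integrableOn_Icc.mono_set Ioc_subset_Icc_self).of_forall_sdiff_eq_zero measurableSet_Ioi ?_
    rintro t ⟨ht1, ht2⟩
    have : r₂ < t := by
      by_contra h
      exact ht2 ⟨ht1, not_lt.1 h⟩
    rw [hd2 t this, zero_mul]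
  have e1 : ∫ t in Ioi r₁, deriv φ t * fluxDifference s J Y t
      = (∫ z : E (m + 1), φ ‖sigmaPoint s z‖ * (J 0 (sigmaPoint s z) + divWithin univ Y z))
        - ∫ y in (halfSpace s : Set (E (m + 1 + 1))), φ ‖y‖ * divWithin (halfSpace s) J y := by
    simp only [fluxDifference, mul_sub]
    rw [integral_sub (hi (continuousOn_flux hs hJ)) (hi (continuousOn_corner hs hY)),
      integral_deriv_mul_flux hr0 h01 hφ hφ1 hφ2 hJ, integral_deriv_mul_corner hs h01 h2 hφ hφ1 hφ2 hY]
    have hcomp : ∀ {f : E (m + 1) → ℝ}, ContinuousOn f {z : E (m + 1) | r₀ < ‖sigmaPoint s z‖} →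
        Integrable (fun z => φ ‖sigmaPoint s z‖ * f z) := by
      intro f hf
      have hK : IsCompact {z : E (m + 1) | r₁ ≤ ‖sigmaPoint s z‖ ∧ ‖sigmaPoint s z‖ ≤ r₂} := by
        refine (isCompact_closedBall (0 : E (m + 1)) r₂).of_isClosed_subset ?_ ?_
        · have := (continuous_sigmaPoint (m + 1) s).norm
          exact (isClosed_le continuous_const this).inter (isClosed_le this continuous_const)
        · rintro z ⟨-, hz⟩
          rw [mem_closedBall_zero_iff]
          refine le_trans ?_ hz
          rw [norm_sigmaPoint]
          exact Real.le_sqrt_of_sq_le (by nlinarith [sq_nonneg s])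
      have hc : ContinuousOn (fun z => φ ‖sigmaPoint s z‖ * f z)
          {z : E (m + 1) | r₁ ≤ ‖sigmaPoint s z‖ ∧ ‖sigmaPoint s z‖ ≤ r₂} :=
        (hφ.continuous.comp (continuous_sigmaPoint (m + 1) s).norm).continuousOn.mul
          (hf.mono fun z hz => h01.trans_le hz.1)
      refine (hc.integrableOn_compact hK).integrable_of_forall_notMem_eq_zero fun z hz => ?_
      by_cases h : ‖sigmaPoint s z‖ ≤ r₁
      · rw [hφ1 _ h, zero_mul]
      · have : r₂ ≤ ‖sigmaPoint s z‖ := by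
          by_contra h'
          exact hz ⟨(not_le.1 h).le, (not_le.1 h').le⟩
        rw [hφ2 _ this, zero_mul]
    have hmem : ∀ z : E (m + 1), r₀ < ‖sigmaPoint s z‖ → cornerRadius s r₀ < ‖z‖ := by
      intro z hz
      have h3 := cornerRadius_lt hs hz
      rwa [norm_sigmaPoint, cornerRadius_sqrt (norm_nonneg z)] at h3
    have i1 : Integrable fun z => φ ‖sigmaPoint s z‖ * J 0 (sigmaPoint s z) := by
      refine hcomp ((hJ 0).continuousOn.comp (continuous_sigmaPoint (m + 1) s).continuousOn ?_)
      exact fun z hz => ⟨sigmaPoint_mem, hz⟩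
    have i2 : Integrable fun z => φ ‖sigmaPoint s z‖ * divWithin univ Y z := by
      refine hcomp ?_
      refine continuousOn_finsetSum _ fun i _ => ?_
      have hY' := ((hY i).continuousOn_fderiv_of_isOpen (isOpen_norm_gt _) (by simp)).clm_apply
        (continuousOn_const (c := EuclideanSpace.single i (1 : ℝ)))
      refine (hY'.mono hmem).congr fun z _ => ?_
      simp only [pd, fderivWithin_univ]
    simp only [mul_add]
    rw [integral_add i1 i2]
    ring
  rw [e1]
  have b1 := integral_mul_le_of_cutoff (χ := fun z : E (m + 1) => φ ‖sigmaPoint s z‖)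
    hB
    (fun z hz => hφ1 _ ((not_lt.1 hz).trans h1.le)) (fun z => hφ3 _)
  have b2 : |∫ y in (halfSpace s : Set (E (m + 1 + 1))), φ ‖y‖ * divWithin (halfSpace s) J y|
      ≤ ∫ y in modelEnd s R, |divWithin (halfSpace s) J y| := by
    have hms := (isClosed_halfSpace (m := m + 1) s).measurableSet
    rw [← integral_indicator hms]
    have := integral_mul_le_of_cutoff (χ := (halfSpace s : Set (E (m + 1 + 1))).indicator fun y => φ ‖y‖)
      hD ?_ ?_
    · refine le_trans (le_of_eq ?_) this
      congr 2
      funext y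
      by_cases hy : y ∈ (halfSpace s : Set (E (m + 1 + 1)))
      · simp only [indicator_of_mem hy]
      · simp only [indicator_of_notMem hy, zero_mul]
    · intro y hy
      by_cases hy' : y ∈ (halfSpace s : Set (E (m + 1 + 1)))
      · rw [indicator_of_mem hy']
        refine hφ1 _ ?_
        by_contra h
        exact hy ⟨hy', h1.trans (not_le.1 h)⟩
      · rw [indicator_of_notMem hy']
    · intro y
      by_cases hy' : y ∈ (halfSpace s : Set (E (m + 1 + 1)))
      · rw [indicator_of_mem hy']; exact hφ3 _
      · rw [indicator_of_notMem hy']; simp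
  exact (abs_sub _ _).trans (by linarith)

theorem tendsto_tail {X : Type*} [MeasurableSpace X] {μ : Measure X} {ρ : X → ℝ} {S : Set X}
    (hS : ∀ R : ℝ, MeasurableSet (S ∩ {x | R < ρ x})) {D : X → ℝ} {R₀ : ℝ}
    (hD : IntegrableOn D (S ∩ {x | R₀ < ρ x}) μ) :
    Tendsto (fun R : ℝ => ∫ x in S ∩ {x | R < ρ x}, |D x| ∂μ) atTop (𝓝 0) := by
  have h := tendsto_setIntegral_of_antitone (f := fun x => |D x|) (μ := μ) hS
    (fun R R' h x hx => ⟨hx.1, lt_of_le_of_lt h hx.2⟩) ⟨R₀, hD.abs⟩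
  have he : (⋂ R : ℝ, S ∩ {x | R < ρ x}) = ∅ := by
    refine eq_empty_of_forall_notMem fun x hx => ?_
    exact lt_irrefl (ρ x) (mem_iInter.1 hx (ρ x)).2
  rwa [he, setIntegral_empty] at h

/-- If the divergence of `J` in the region, and on the boundary the normal component of `J` plus the
divergence of `Y`, are integrable near infinity, then the difference of fluxes converges. -/
theorem exists_tendsto_fluxDifference (hs : |s| ≤ r₀)
    (hJ : ∀ i, ContDiffOn ℝ ∞ (J i) (modelEnd s r₀))
    (hY : ∀ i, ContDiffOn ℝ ∞ (Y i) {z | cornerRadius s r₀ < ‖z‖})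
    (hD : IntegrableOn (divWithin (halfSpace s) J) (modelEnd s r₀))
    (hB : IntegrableOn (fun z => J 0 (sigmaPoint s z) + divWithin univ Y z)
      {z : E (m + 1) | r₀ < ‖sigmaPoint s z‖}) :
    ∃ L, Tendsto (fluxDifference s J Y) atTop (𝓝 L) := by
  have ht1 := tendsto_tail (ρ := fun y : E (m + 1 + 1) => ‖y‖) (fun R => measurableSet_modelEnd s R) hD
  have ht2 := tendsto_tail (ρ := fun z : E (m + 1) => ‖sigmaPoint s z‖) (S := univ)
    (fun R => MeasurableSet.univ.inter
      (isOpen_lt continuous_const (continuous_sigmaPoint (m + 1) s).norm).measurableSet)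
    (R₀ := r₀) (by simpa using hB)
  have ht := ht1.add ht2
  rw [add_zero] at ht
  have hMc : ContinuousOn (fluxDifference s J Y) (Ioi r₀) :=
    (continuousOn_flux hs hJ).sub (continuousOn_corner hs hY)
  refine cauchy_map_iff_exists_tendsto.1 (Metric.cauchy_iff.2 ⟨inferInstance, fun ε hε => ?_⟩)
  obtain ⟨R, hR0, hR⟩ := ((eventually_gt_atTop r₀).and (ht.eventually_lt_const (half_pos hε))).exists
  refine ⟨_, image_mem_map (Ioi_mem_atTop R), ?_⟩
  -- test with the difference of a step at `r` and a step at `r'`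
  have hlt : ∀ r r', R < r → r < r' → dist (fluxDifference s J Y r) (fluxDifference s J Y r') < ε := by
    intro r r' hr hrr'
    have hDR : IntegrableOn (divWithin (halfSpace s) J) (modelEnd s R) :=
      hD.mono_set fun y hy => ⟨hy.1, hR0.trans hy.2⟩
    have hBR : IntegrableOn (fun z => J 0 (sigmaPoint s z) + divWithin univ Y z)
        {z : E (m + 1) | R < ‖sigmaPoint s z‖} := hB.mono_set fun y hy => hR0.trans hy
    set T := (∫ y in modelEnd s R, |divWithin (halfSpace s) J y|)
      + ∫ z in {z : E (m + 1) | R < ‖sigmaPoint s z‖}, |J 0 (sigmaPoint s z) + divWithin univ Y z|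
      with hT
    have hTε : T < ε / 2 := by
      have := hR
      simp only [univ_inter] at this
      exact this
    obtain ⟨δ, hδ, hd⟩ := integral_deriv_smoothStep_mul hMc (hR0.trans hr) le_rfl
      (show 0 < ε / 8 by positivity)
    obtain ⟨δ', hδ', hd'⟩ := integral_deriv_smoothStep_mul hMc (hR0.trans (hr.trans hrr')) hrr'.le
      (show 0 < ε / 8 by positivity)
    obtain ⟨h, hh0, hh⟩ := exists_between (lt_min hδ hδ')
    obtain ⟨i1, b1⟩ := hd h ⟨hh0, hh.trans_le (min_le_left _ _)⟩
    obtain ⟨i2, b2⟩ := hd' h ⟨hh0, hh.trans_le (min_le_right _ _)⟩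
    have b3 := abs_integral_deriv_mul_fluxDifference_le hs hJ hY hR0.le hDR hBR hr
      (r₂ := r' + h) (by linarith) (φ := fun t => smoothStep r h t - smoothStep r' h t)
      ((smoothStep_contDiff r h).sub (smoothStep_contDiff r' h)) ?_ ?_ ?_
    · have e : ∀ t, deriv (fun t => smoothStep r h t - smoothStep r' h t) t * fluxDifference s J Y t
          = deriv (smoothStep r h) t * fluxDifference s J Y t
            - deriv (smoothStep r' h) t * fluxDifference s J Y t := by
        intro t
        rw [deriv_fun_sub ((smoothStep_contDiff r h).differentiable (by simp) t)
          ((smoothStep_contDiff r' h).differentiable (by simp) t), sub_mul]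
      simp only [e] at b3
      rw [integral_sub i1 i2, ← hT] at b3
      rw [Real.dist_eq]
      rw [abs_le] at b1 b2 b3
      rw [abs_lt]
      constructor <;> linarith [b1.1, b1.2, b2.1, b2.2, b3.1, b3.2]
    · intro t ht
      simp only [smoothStep_of_le hh0 ht, smoothStep_of_le hh0 (ht.trans hrr'.le), sub_zero]
    · intro t ht
      simp only [smoothStep_of_ge hh0 ht, smoothStep_of_ge hh0 (show r + h ≤ t by linarith), sub_self]
    · intro t
      have p1 := Real.smoothTransition.nonneg ((t - r) / h)
      have p2 := Real.smoothTransition.nonneg ((t - r') / h)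
      have p3 := Real.smoothTransition.le_one ((t - r) / h)
      have p4 := Real.smoothTransition.le_one ((t - r') / h)
      rw [abs_le]
      unfold smoothStep
      constructor <;> linarith
  rintro _ ⟨r, hr, rfl⟩ _ ⟨r', hr', rfl⟩
  rcases lt_trichotomy r r' with h | h | h
  · exact hlt r r' hr h
  · rw [h, dist_self]; exact hε
  · rw [dist_comm]; exact hlt r' r hr' h

end FluxDifference

/-! ### Partial derivatives within a set -/

section PartialDerivatives

variable {n : ℕ} {S : Set (E n)} {f h : E n → ℝ} {y : E n}

theorem pd_of_hasFDerivWithinAt {f' : E n →L[ℝ] ℝ} (hS : UniqueDiffWithinAt ℝ S y)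
    (hf : HasFDerivWithinAt f f' S y) (i : Fin n) :
    pd S f i y = f' (EuclideanSpace.single i 1) := by rw [pd, hf.fderivWithin hS]

theorem pd_congr (hfh : EqOn f h S) (hy : y ∈ S) (i : Fin n) : pd S f i y = pd S h i y := by
  rw [pd, pd, fderivWithin_congr hfh (hfh hy)]

theorem pd_add (hS : UniqueDiffWithinAt ℝ S y) (hf : DifferentiableWithinAt ℝ f S y)
    (hh : DifferentiableWithinAt ℝ h S y) (i : Fin n) :
    pd S (fun z => f z + h z) i y = pd S f i y + pd S h i y := by
  rw [pd_of_hasFDerivWithinAt hS (hf.hasFDerivWithinAt.fun_add hh.hasFDerivWithinAt)]; rfl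

theorem pd_sub (hS : UniqueDiffWithinAt ℝ S y) (hf : DifferentiableWithinAt ℝ f S y)
    (hh : DifferentiableWithinAt ℝ h S y) (i : Fin n) :
    pd S (fun z => f z - h z) i y = pd S f i y - pd S h i y := by
  rw [pd_of_hasFDerivWithinAt hS (hf.hasFDerivWithinAt.fun_sub hh.hasFDerivWithinAt)]; rfl

theorem pd_mul (hS : UniqueDiffWithinAt ℝ S y) (hf : DifferentiableWithinAt ℝ f S y)
    (hh : DifferentiableWithinAt ℝ h S y) (i : Fin n) :
    pd S (fun z => f z * h z) i y = pd S f i y * h y + f y * pd S h i y := by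
  rw [pd_of_hasFDerivWithinAt hS (hf.hasFDerivWithinAt.fun_mul hh.hasFDerivWithinAt)]
  simp [pd]; ring

theorem pd_const_mul (hS : UniqueDiffWithinAt ℝ S y) (c : ℝ) (hf : DifferentiableWithinAt ℝ f S y)
    (i : Fin n) : pd S (fun z => c * f z) i y = c * pd S f i y := by
  rw [pd_of_hasFDerivWithinAt hS (hf.hasFDerivWithinAt.const_mul c)]
  simp [pd]

theorem pd_neg (hS : UniqueDiffWithinAt ℝ S y) (hf : DifferentiableWithinAt ℝ f S y) (i : Fin n) :
    pd S (fun z => - f z) i y = - pd S f i y := by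
  rw [pd_of_hasFDerivWithinAt hS hf.hasFDerivWithinAt.fun_neg]; rfl

theorem pd_const (c : ℝ) (i : Fin n) : pd S (fun _ => c) i y = 0 := by
  simp [pd]

theorem pd_sum {ι : Type*} (hS : UniqueDiffWithinAt ℝ S y) (u : Finset ι) {F : ι → E n → ℝ}
    (hF : ∀ a ∈ u, DifferentiableWithinAt ℝ (F a) S y) (i : Fin n) :
    pd S (fun z => ∑ a ∈ u, F a z) i y = ∑ a ∈ u, pd S (F a) i y := by
  rw [pd_of_hasFDerivWithinAt hS (HasFDerivWithinAt.fun_sum fun a ha => (hF a ha).hasFDerivWithinAt)]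
  simp [pd]

theorem differentiableWithinAt_coord (j : Fin n) :
    DifferentiableWithinAt ℝ (fun z : E n => z j) S y :=
  (EuclideanSpace.proj j : E n →L[ℝ] ℝ).differentiableWithinAt

theorem pd_coord (hS : UniqueDiffWithinAt ℝ S y) (j i : Fin n) :
    pd S (fun z => z j) i y = if i = j then 1 else 0 := by
  have h : HasFDerivWithinAt (fun z : E n => z j) (EuclideanSpace.proj j : E n →L[ℝ] ℝ) S y :=
    (EuclideanSpace.proj j : E n →L[ℝ] ℝ).hasFDerivWithinAt
  rw [pd_of_hasFDerivWithinAt hS h]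
  simp [eq_comm]

/-- The coordinate `x₀ = √(1 + |y|²)` of the hyperboloid. -/
noncomputable def height (y : E n) : ℝ := Real.sqrt (1 + ‖y‖ ^ 2)

theorem height_sq (y : E n) : height y ^ 2 = 1 + ‖y‖ ^ 2 := Real.sq_sqrt (by positivity)

theorem height_pos (y : E n) : 0 < height y := Real.sqrt_pos.2 (by positivity)

theorem contDiff_height : ContDiff ℝ ∞ (height : E n → ℝ) :=
  (contDiff_const.add (contDiff_norm_sq ℝ)).sqrt fun y => by positivity

theorem differentiableWithinAt_height : DifferentiableWithinAt ℝ (height : E n → ℝ) S y :=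
  (contDiff_height.differentiable (by simp) y).differentiableWithinAt

theorem pd_height (hS : UniqueDiffWithinAt ℝ S y) (i : Fin n) :
    pd S height i y = y i / height y := by
  have h1 : HasFDerivAt (fun z : E n => 1 + ‖z‖ ^ 2) (2 • innerSL ℝ y) y :=
    ((hasStrictFDerivAt_norm_sq y).hasFDerivAt).const_add 1
  have h2 := (h1.sqrt (by positivity)).hasFDerivWithinAt (s := S)
  have h3 := pd_of_hasFDerivWithinAt hS h2 i
  refine (show pd S height i y = _ from h3).trans ?_
  simp [EuclideanSpace.inner_single_right, height]
  field_simp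

theorem differentiableWithinAt_height_inv :
    DifferentiableWithinAt ℝ (fun z : E n => (height z)⁻¹) S y :=
  (differentiableWithinAt_height).fun_inv (height_pos y).ne'

theorem pd_height_inv (hS : UniqueDiffWithinAt ℝ S y) (i : Fin n) :
    pd S (fun z => (height z)⁻¹) i y = - y i * (height y)⁻¹ ^ 3 := by
  have h0 := (height_pos y).ne'
  have h := pd_mul hS (differentiableWithinAt_height) (differentiableWithinAt_height_inv) i
  have h1 : (fun z : E n => height z * (height z)⁻¹) = fun _ => 1 :=
    funext fun z => mul_inv_cancel₀ (height_pos z).ne'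
  rw [h1, pd_const, pd_height hS] at h
  field_simp at h ⊢
  linarith

theorem fderivWithin_eq_zero_of_pd (h : ∀ i, pd S f i y = 0) : fderivWithin ℝ f S y = 0 := by
  refine ContinuousLinearMap.coe_injective ?_
  refine (EuclideanSpace.basisFun (Fin n) ℝ).toBasis.ext fun i => ?_
  simpa [pd] using h i

end PartialDerivatives

/-! ### The hyperbolic metric and its orthonormal frame -/

section HyperbolicAlgebra

variable {n : ℕ} (y : E n)

/-- The matrix `1 + a y yᵀ`. -/
def rankOneUpdate (a : ℝ) : Matrix (Fin n) (Fin n) ℝ :=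
  Matrix.of fun i j => (if i = j then 1 else 0) + a * y i * y j

theorem sum_sq_eq : ∑ i, y i * y i = ‖y‖ ^ 2 := by
  rw [EuclideanSpace.norm_sq_eq]
  exact Finset.sum_congr rfl fun i _ => by rw [Real.norm_eq_abs, sq_abs, sq]

theorem rankOneUpdate_mul (a c : ℝ) :
    rankOneUpdate y a * rankOneUpdate y c = rankOneUpdate y (a + c + a * c * ‖y‖ ^ 2) := by
  ext i j
  simp only [Matrix.mul_apply, rankOneUpdate, Matrix.of_apply, add_mul, mul_add,
    Finset.sum_add_distrib, ite_mul, mul_ite, one_mul, mul_one, zero_mul, mul_zero,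
    Finset.sum_ite_eq, Finset.sum_ite_eq', Finset.mem_univ, if_true]
  have : ∑ k, a * y i * y k * (c * y k * y j) = a * c * y i * y j * ‖y‖ ^ 2 := by
    rw [← sum_sq_eq, Finset.mul_sum]
    exact Finset.sum_congr rfl fun k _ => by ring
  rw [this]; ring

theorem rankOneUpdate_zero : rankOneUpdate y 0 = 1 := by
  ext i j; simp [rankOneUpdate, Matrix.one_apply]

theorem rankOneUpdate_symm (a : ℝ) (i j : Fin n) :
    rankOneUpdate y a i j = rankOneUpdate y a j i := by
  simp only [rankOneUpdate, Matrix.of_apply, eq_comm (a := i)]; ring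

theorem sum_rankOneUpdate_mul (a : ℝ) (i : Fin n) :
    ∑ j, rankOneUpdate y a i j * y j = (1 + a * ‖y‖ ^ 2) * y i := by
  simp only [rankOneUpdate, Matrix.of_apply, add_mul, Finset.sum_add_distrib, ite_mul, one_mul,
    zero_mul, Finset.sum_ite_eq, Finset.mem_univ, if_true]
  rw [← sum_sq_eq, Finset.mul_sum, Finset.sum_mul]
  congr 1
  exact Finset.sum_congr rfl fun k _ => by ring

theorem det_rankOneUpdate (a : ℝ) : (rankOneUpdate y a).det = 1 + a * ‖y‖ ^ 2 := by
  have h : rankOneUpdate y a = 1 + Matrix.vecMulVec (fun i => a * y i) (fun j => y j) := by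
    ext i j; simp [rankOneUpdate, Matrix.one_apply, Matrix.vecMulVec_apply]
  rw [h, Matrix.vecMulVec_eq Unit, Matrix.det_one_add_replicateCol_mul_replicateRow]
  congr 1
  rw [← sum_sq_eq, Finset.mul_sum, dotProduct]
  exact Finset.sum_congr rfl fun k _ => by ring

theorem hypMetric_eq : hypMetric n y = rankOneUpdate y (-(height y ^ 2)⁻¹) := by
  ext i j
  simp only [hypMetric, rankOneUpdate, Matrix.of_apply, height_sq]
  ring

/-- `b⁻¹ = 1 + y yᵀ`. -/
def hypInv : Matrix (Fin n) (Fin n) ℝ := rankOneUpdate y 1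

/-- The positive square root of `b⁻¹`; its columns form a `b`-orthonormal frame. -/
noncomputable def frame : Matrix (Fin n) (Fin n) ℝ := rankOneUpdate y (1 / (1 + height y))

theorem frame_mul_frame : frame y * frame y = hypInv y := by
  have h : (1 : ℝ) + height y ≠ 0 := by have := height_pos y; positivity
  rw [frame, rankOneUpdate_mul, hypInv]
  congr 1
  have := height_sq y
  rw [show ‖y‖ ^ 2 = height y ^ 2 - 1 by linarith]
  field_simp
  ring

theorem hypMetric_mul_hypInv : hypMetric n y * hypInv y = 1 := by
  have h := height_sq y
  have h0 := (height_pos y).ne'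
  rw [hypMetric_eq, hypInv, rankOneUpdate_mul, ← rankOneUpdate_zero y]
  congr 1
  rw [show ‖y‖ ^ 2 = height y ^ 2 - 1 by linarith]
  field_simp
  ring

theorem hypMetric_inv : (hypMetric n y)⁻¹ = hypInv y :=
  Matrix.inv_eq_right_inv (hypMetric_mul_hypInv y)

theorem frame_symm (i j : Fin n) : frame y i j = frame y j i := rankOneUpdate_symm y _ i j

theorem frame_mul_hypMetric_mul_frame : frame y * hypMetric n y * frame y = 1 := by
  have hc : frame y * hypMetric n y = hypMetric n y * frame y := by
    rw [hypMetric_eq, frame, rankOneUpdate_mul, rankOneUpdate_mul]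
    congr 1; ring
  rw [hc, mul_assoc, frame_mul_frame, hypMetric_mul_hypInv]

theorem det_frame : (frame y).det = height y := by
  have h : (1 : ℝ) + height y ≠ 0 := by have := height_pos y; positivity
  rw [frame, det_rankOneUpdate]
  have := height_sq y
  rw [show ‖y‖ ^ 2 = height y ^ 2 - 1 by linarith]
  field_simp
  ring

theorem hypMetric_symm (i j : Fin n) : hypMetric n y i j = hypMetric n y j i := by
  rw [hypMetric_eq]; exact rankOneUpdate_symm y _ i j

theorem hypInv_symm (i j : Fin n) : hypInv y i j = hypInv y j i := rankOneUpdate_symm y _ i j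

theorem sum_hypInv_mul (i : Fin n) : ∑ j, hypInv y i j * y j = height y ^ 2 * y i := by
  rw [hypInv, sum_rankOneUpdate_mul, height_sq, one_mul]

theorem sum_hypMetric_mul (i : Fin n) :
    ∑ j, hypMetric n y i j * y j = y i / height y ^ 2 := by
  rw [hypMetric_eq, sum_rankOneUpdate_mul]
  have h := height_sq y
  have h0 := (height_pos y).ne'
  rw [show ‖y‖ ^ 2 = height y ^ 2 - 1 by linarith]
  field_simp
  ring

theorem sum_hypInv_mul_hypMetric (i j : Fin n) :
    ∑ k, hypInv y i k * hypMetric n y k j = if i = j then 1 else 0 := by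
  have h : hypInv y * hypMetric n y = 1 := mul_eq_one_comm.1 (hypMetric_mul_hypInv y)
  rw [← Matrix.mul_apply, h, Matrix.one_apply]

end HyperbolicAlgebra

/-! ### Curvature of the hyperbolic metric and static potentials -/

section HyperbolicGeometry

variable {m : ℕ} {s : ℝ} {y : E (m + 1)}

theorem contDiff_hypMetric {n : ℕ} (i j : Fin n) : ContDiff ℝ ∞ fun z : E n => hypMetric n z i j := by
  simp only [hypMetric, Matrix.of_apply]
  refine contDiff_const.sub (ContDiff.div (by fun_prop) (contDiff_const.add (contDiff_norm_sq ℝ)) ?_)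
  intro z
  positivity

theorem differentiableWithinAt_hypMetric {n : ℕ} {S : Set (E n)} {y : E n} (i j : Fin n) :
    DifferentiableWithinAt ℝ (fun z : E n => hypMetric n z i j) S y :=
  ((contDiff_hypMetric i j).differentiable (by simp) y).differentiableWithinAt

theorem pd_hypMetric (hy : y ∈ halfSpace s) (l i j : Fin (m + 1)) :
    pd (halfSpace s) (fun z => hypMetric (m + 1) z i j) l y
      = -(hypMetric (m + 1) y l i * y j + hypMetric (m + 1) y l j * y i) / height y ^ 2 := by
  have hS := uniqueDiffOn_halfSpace s y hy
  have hinv := differentiableWithinAt_height_inv (S := halfSpace s) (y := y)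
  have hc := fun k : Fin (m + 1) => differentiableWithinAt_coord (S := halfSpace s) (y := y) k
  have h1 : ∀ z : E (m + 1), hypMetric (m + 1) z i j
      = (if i = j then 1 else 0) - (z i * z j) * ((height z)⁻¹ * (height z)⁻¹) := by
    intro z
    simp only [hypMetric, Matrix.of_apply]
    rw [← height_sq]
    field_simp
  simp only [h1]
  rw [pd_sub hS (differentiableWithinAt_const _) (((hc i).fun_mul (hc j)).fun_mul (hinv.fun_mul hinv)),
    pd_const, pd_mul hS ((hc i).fun_mul (hc j)) (hinv.fun_mul hinv),
    pd_mul hS (hc i) (hc j), pd_mul hS hinv hinv, pd_coord hS, pd_coord hS, pd_height_inv hS]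
  have h0 := (height_pos y).ne'
  have hb : ∀ k, hypMetric (m + 1) y l k = (if l = k then 1 else 0) - y l * y k / height y ^ 2 := by
    intro k; simp only [hypMetric, Matrix.of_apply, height_sq]
  rw [hb, hb]
  field_simp
  ring

theorem christoffel_hypMetric (hy : y ∈ halfSpace s) (k i j : Fin (m + 1)) :
    christoffel (halfSpace s) (hypMetric (m + 1)) k i j y = - y k * hypMetric (m + 1) y i j := by
  have h0 := (height_pos y).ne'
  rw [christoffel, hypMetric_inv]
  have h : ∀ l, hypInv y k l * (pd (halfSpace s) (fun z => hypMetric (m + 1) z j l) i y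
      + pd (halfSpace s) (fun z => hypMetric (m + 1) z i l) j y
      - pd (halfSpace s) (fun z => hypMetric (m + 1) z i j) l y)
      = (hypInv y k l * y l) * (-2 * hypMetric (m + 1) y i j / height y ^ 2) := by
    intro l
    rw [pd_hypMetric hy, pd_hypMetric hy, pd_hypMetric hy, hypMetric_symm y l i,
      hypMetric_symm y l j, hypMetric_symm y j i]
    field_simp
    ring
  simp only [h]
  rw [← Finset.sum_mul, sum_hypInv_mul]
  field_simp

theorem pd_christoffel_hypMetric (hy : y ∈ halfSpace s) (l k i j : Fin (m + 1)) :
    pd (halfSpace s) (christoffel (halfSpace s) (hypMetric (m + 1)) k i j) l y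
      = - (if l = k then 1 else 0) * hypMetric (m + 1) y i j
        + y k * (hypMetric (m + 1) y l i * y j + hypMetric (m + 1) y l j * y i) / height y ^ 2 := by
  have hS := uniqueDiffOn_halfSpace s y hy
  have hc := differentiableWithinAt_coord (S := halfSpace s) (y := y) k
  rw [pd_congr (h := fun z => - z k * hypMetric (m + 1) z i j)
    (fun z hz => christoffel_hypMetric hz k i j) hy,
    pd_mul hS hc.fun_neg (differentiableWithinAt_hypMetric i j), pd_neg hS hc,
    pd_coord hS, pd_hypMetric hy]
  ring

theorem ricci_hypMetric (hy : y ∈ halfSpace s) (j k : Fin (m + 1)) :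
    ricci (halfSpace s) (hypMetric (m + 1)) j k y = -(m : ℝ) * hypMetric (m + 1) y j k := by
  have h0 := (height_pos y).ne'
  simp only [ricci, pd_christoffel_hypMetric hy, christoffel_hypMetric hy]
  have hinner : ∀ i, ∑ l, (-y i * hypMetric (m + 1) y i l * (-y l * hypMetric (m + 1) y j k)
      - -y i * hypMetric (m + 1) y j l * (-y l * hypMetric (m + 1) y i k))
      = y i * (y i / height y ^ 2) * hypMetric (m + 1) y j k
        - y i * (y j / height y ^ 2) * hypMetric (m + 1) y i k := by
    intro i
    rw [← sum_hypMetric_mul y i, ← sum_hypMetric_mul y j, Finset.sum_sub_distrib, Finset.mul_sum,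
      Finset.mul_sum, Finset.sum_mul, Finset.sum_mul]
    congr 1 <;> exact Finset.sum_congr rfl fun l _ => by ring
  have hsum : ∑ i, (- hypMetric (m + 1) y j k + if j = i then hypMetric (m + 1) y i k else 0)
      = -(m : ℝ) * hypMetric (m + 1) y j k := by
    simp only [Finset.sum_add_distrib, Finset.sum_ite_eq, Finset.mem_univ, if_true,
      Finset.sum_const, Finset.card_univ, Fintype.card_fin, nsmul_eq_mul]
    push_cast
    ring
  rw [← hsum]
  refine Finset.sum_congr rfl fun i _ => ?_
  rw [hinner, if_pos trivial, hypMetric_symm y j i]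
  by_cases h : j = i
  · simp only [if_pos h]
    field_simp
    ring
  · simp only [if_neg h]
    field_simp
    ring

theorem hessian_eq_of_isStaticPotential {V : E (m + 1) → ℝ} (hV : IsStaticPotential s V)
    (hy : y ∈ halfSpace s) (i j : Fin (m + 1)) :
    hessian (halfSpace s) (hypMetric (m + 1)) V i j y = V y * hypMetric (m + 1) y i j := by
  have h := hV.hessian_eq y hy i j
  rw [ricci_hypMetric hy] at h
  linarith

theorem halfSpace_eq_modelEnd (s : ℝ) : (halfSpace s : Set (E (m + 1))) = modelEnd s (-1) := by
  ext y
  exact ⟨fun h => ⟨h, by linarith [norm_nonneg y]⟩, fun h => h.1⟩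

theorem contDiffOn_pd_halfSpace {f : E (m + 1) → ℝ} (hf : ContDiffOn ℝ ∞ f (halfSpace s))
    (i : Fin (m + 1)) : ContDiffOn ℝ ∞ (pd (halfSpace s) f i) (halfSpace s) := by
  rw [halfSpace_eq_modelEnd] at hf
  have := contDiffOn_pd hf i
  rwa [← halfSpace_eq_modelEnd] at this

theorem eqOn_const_of_pd_eq_zero {f : E (m + 1) → ℝ} (hf : DifferentiableOn ℝ f (halfSpace s))
    (h : ∀ y ∈ halfSpace s, ∀ i, pd (halfSpace s) f i y = 0) :
    ∃ c, ∀ y ∈ halfSpace s, f y = c := by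
  by_cases hne : (halfSpace s : Set (E (m + 1))).Nonempty
  · obtain ⟨x, hx⟩ := hne
    exact ⟨f x, fun y hy => (convex_halfSpace s).is_const_of_fderivWithin_eq_zero hf
      (fun z hz => fderivWithin_eq_zero_of_pd (h z hz)) hy hx⟩
  · exact ⟨0, fun y hy => absurd ⟨y, hy⟩ hne⟩

/-- A static potential is a combination of the coordinates `x₀, …, xₙ` and a constant (which in fact
vanishes, but only linear growth matters). -/
theorem exists_affine_of_isStaticPotential {V : E (m + 1) → ℝ} (hV : IsStaticPotential s V) :
    ∃ (a : ℝ) (c : Fin (m + 1) → ℝ) (d : ℝ), ∀ y ∈ halfSpace s,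
      V y = a * height y + ∑ i, c i * y i + d := by
  have hdV : ∀ y ∈ halfSpace s, DifferentiableWithinAt ℝ V (halfSpace s) y := fun y hy =>
    hV.smooth.differentiableOn (by simp) y hy
  have hdp : ∀ y ∈ halfSpace s, ∀ i,
      DifferentiableWithinAt ℝ (pd (halfSpace s) V i) (halfSpace s) y := fun y hy i =>
    (contDiffOn_pd_halfSpace hV.smooth i).differentiableOn (by simp) y hy
  have hc := fun (y : E (m + 1)) k => differentiableWithinAt_coord (S := halfSpace s) (y := y) k
  have hh := fun y : E (m + 1) => differentiableWithinAt_height (S := halfSpace s) (y := y)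
  -- `∂ᵢ∂ⱼV = bᵢⱼ W`, and `√(1 + |y|²) W` is constant
  set W : E (m + 1) → ℝ := fun y => V y - ∑ k, y k * pd (halfSpace s) V k y with hW
  have hdS : ∀ y ∈ halfSpace s,
      DifferentiableWithinAt ℝ (fun y => ∑ k, y k * pd (halfSpace s) V k y) (halfSpace s) y :=
    fun y hy => DifferentiableWithinAt.fun_sum fun k _ => (hc y k).fun_mul (hdp y hy k)
  have hdW : ∀ y ∈ halfSpace s, DifferentiableWithinAt ℝ W (halfSpace s) y :=
    fun y hy => (hdV y hy).fun_sub (hdS y hy)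
  have hpp : ∀ y ∈ halfSpace s, ∀ i j, pd (halfSpace s) (pd (halfSpace s) V j) i y
      = hypMetric (m + 1) y i j * W y := by
    intro y hy i j
    have h := hessian_eq_of_isStaticPotential hV hy i j
    simp only [hessian, christoffel_hypMetric hy] at h
    have h2 : ∑ k, -y k * hypMetric (m + 1) y i j * pd (halfSpace s) V k y
        = - (hypMetric (m + 1) y i j * ∑ k, y k * pd (halfSpace s) V k y) := by
      rw [Finset.mul_sum, ← Finset.sum_neg_distrib]
      exact Finset.sum_congr rfl fun k _ => by ring
    rw [h2] at h
    simp only [hW]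
    linarith
  have hpW : ∀ y ∈ halfSpace s, ∀ i, pd (halfSpace s) W i y = - (y i / height y ^ 2) * W y := by
    intro y hy i
    have hS := uniqueDiffOn_halfSpace s y hy
    rw [pd_sub hS (hdV y hy) (hdS y hy), pd_sum hS _ fun k _ => (hc y k).fun_mul (hdp y hy k)]
    simp only [pd_mul hS (hc y _) (hdp y hy _), pd_coord hS, hpp y hy, Finset.sum_add_distrib,
      ite_mul, one_mul, zero_mul, Finset.sum_ite_eq, Finset.mem_univ, if_true]
    rw [← sum_hypMetric_mul, neg_mul, Finset.sum_mul]
    have : ∀ k, y k * (hypMetric (m + 1) y i k * W y) = hypMetric (m + 1) y i k * y k * W y :=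
      fun k => by ring
    simp only [this]
    ring
  obtain ⟨a, ha⟩ := eqOn_const_of_pd_eq_zero (f := fun y => height y * W y)
    (fun y hy => (hh y).fun_mul (hdW y hy)) (fun y hy i => by
      have hS := uniqueDiffOn_halfSpace s y hy
      have h0 := (height_pos y).ne'
      rw [pd_mul hS (hh y) (hdW y hy), pd_height hS, hpW y hy]
      field_simp
      ring)
  -- the first derivatives of `V - a x₀` are constant
  have hex : ∀ j, ∃ c, ∀ y ∈ halfSpace s, pd (halfSpace s) V j y - a * (y j * (height y)⁻¹) = c := by
    intro j
    have hi := fun y : E (m + 1) => differentiableWithinAt_height_inv (S := halfSpace s) (y := y)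
    refine eqOn_const_of_pd_eq_zero (fun y hy => (hdp y hy j).fun_sub
      (((hc y j).fun_mul (hi y)).const_mul a)) fun y hy i => ?_
    have hS := uniqueDiffOn_halfSpace s y hy
    have h0 := (height_pos y).ne'
    have hWa : W y = a / height y := by
      rw [eq_div_iff h0, mul_comm]; exact ha y hy
    rw [pd_sub hS (hdp y hy j) (((hc y j).fun_mul (hi y)).const_mul a),
      pd_const_mul hS a ((hc y j).fun_mul (hi y)), pd_mul hS (hc y j) (hi y), pd_coord hS,
      pd_height_inv hS, hpp y hy, hWa]
    simp only [hypMetric, Matrix.of_apply, ← height_sq]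
    field_simp
    ring
  choose c hcj using hex
  have hcs : ∀ y, DifferentiableWithinAt ℝ (fun y : E (m + 1) => ∑ k, c k * y k) (halfSpace s) y :=
    fun y => DifferentiableWithinAt.fun_sum fun k _ => (hc y k).const_mul _
  obtain ⟨d, hd⟩ := eqOn_const_of_pd_eq_zero (f := fun y => V y - a * height y - ∑ k, c k * y k)
    (fun y hy => ((hdV y hy).fun_sub ((hh y).const_mul a)).fun_sub (hcs y)) (fun y hy i => by
      have hS := uniqueDiffOn_halfSpace s y hy
      have h0 := (height_pos y).ne'
      rw [pd_sub hS ((hdV y hy).fun_sub ((hh y).const_mul a)) (hcs y),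
        pd_sub hS (hdV y hy) ((hh y).const_mul a), pd_const_mul hS a (hh y), pd_height hS,
        pd_sum hS _ fun k _ => (hc y k).const_mul _]
      simp only [pd_const_mul hS _ (hc y _), pd_coord hS, mul_ite, mul_one, mul_zero,
        Finset.sum_ite_eq, Finset.mem_univ, if_true]
      rw [← hcj i y hy]
      ring)
  exact ⟨a, c, d, fun y hy => by linarith [hd y hy]⟩

theorem isBigO_of_isStaticPotential {V : E (m + 1) → ℝ} (hV : IsStaticPotential s V) :
    V =O[comap norm atTop ⊓ 𝓟 (halfSpace s)] fun y => ‖y‖ := by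
  obtain ⟨a, c, d, h⟩ := exists_affine_of_isStaticPotential hV
  refine Asymptotics.IsBigO.of_bound (|a| * 2 + ∑ i, |c i| + |d|) ?_
  rw [eventually_inf_principal]
  filter_upwards [tendsto_comap.eventually (eventually_ge_atTop 1)] with y hy1 hy
  rw [h y hy, norm_norm, Real.norm_eq_abs]
  have h1 : |a * height y| ≤ |a| * 2 * ‖y‖ := by
    rw [abs_mul, abs_of_pos (height_pos y), mul_assoc]
    gcongr
    exact Real.sqrt_le_iff.2 ⟨by positivity, by nlinarith⟩
  have h2 : |∑ i, c i * y i| ≤ (∑ i, |c i|) * ‖y‖ := by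
    rw [Finset.sum_mul]
    refine (Finset.abs_sum_le_sum_abs _ _).trans (Finset.sum_le_sum fun i _ => ?_)
    rw [abs_mul]
    gcongr
    exact abs_coord_le_norm y i
  have h3 : |d| ≤ |d| * ‖y‖ := le_mul_of_one_le_right (abs_nonneg d) hy1
  calc _ ≤ |a * height y| + |∑ i, c i * y i| + |d| := abs_add_three _ _ _
    _ ≤ _ := by linarith

end HyperbolicGeometry

/-! ### Components of tensors in a frame -/

section FrameComponents

variable {n : ℕ} (P : Matrix (Fin n) (Fin n) ℝ)

/-- The contraction `∑ᵢ Pᵢₐ fᵢ` of one covariant slot with the `a`-th column of `P`. -/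
def frameComp (f : Fin n → ℝ) (a : Fin n) : ℝ := ∑ i, P i a * f i

theorem frameComp_add (f h : Fin n → ℝ) (a : Fin n) :
    frameComp P (fun i => f i + h i) a = frameComp P f a + frameComp P h a := by
  simp only [frameComp, mul_add, Finset.sum_add_distrib]

theorem frameComp_sub (f h : Fin n → ℝ) (a : Fin n) :
    frameComp P (fun i => f i - h i) a = frameComp P f a - frameComp P h a := by
  simp only [frameComp, mul_sub, Finset.sum_sub_distrib]

theorem frameComp_mul_left (c : ℝ) (f : Fin n → ℝ) (a : Fin n) :
    frameComp P (fun i => c * f i) a = c * frameComp P f a := by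
  simp only [frameComp, Finset.mul_sum, mul_left_comm]

theorem frameComp_mul_right (c : ℝ) (f : Fin n → ℝ) (a : Fin n) :
    frameComp P (fun i => f i * c) a = frameComp P f a * c := by
  simp only [frameComp, Finset.sum_mul, mul_assoc]

theorem frameComp_sum {ι : Type*} (u : Finset ι) (f : ι → Fin n → ℝ) (a : Fin n) :
    frameComp P (fun i => ∑ x ∈ u, f x i) a = ∑ x ∈ u, frameComp P (f x) a := by
  simp only [frameComp, Finset.mul_sum]
  exact Finset.sum_comm

theorem frameComp_comm (F : Fin n → Fin n → ℝ) (a c : Fin n) :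
    frameComp P (fun i => frameComp P (fun j => F i j) c) a
      = frameComp P (fun j => frameComp P (fun i => F i j) a) c := by
  simp only [frameComp, Finset.mul_sum]
  rw [Finset.sum_comm]
  exact Finset.sum_congr rfl fun i _ => Finset.sum_congr rfl fun j _ => by ring

/-- Contraction with `P Pᵀ` is summation over the frame. -/
theorem sum_mul_eq_sum_frameComp {β : Matrix (Fin n) (Fin n) ℝ}
    (hβ : ∀ i j, β i j = ∑ a, P i a * P j a) (F : Fin n → Fin n → ℝ) :
    ∑ i, ∑ j, β i j * F i j = ∑ a, frameComp P (fun i => frameComp P (fun j => F i j) a) a := by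
  simp only [hβ, frameComp, Finset.sum_mul, Finset.mul_sum, mul_assoc]
  rw [Finset.sum_comm (γ := Fin n)]
  conv_rhs => rw [Finset.sum_comm]
  rw [Finset.sum_comm]
  refine Finset.sum_congr rfl fun i _ => ?_
  rw [Finset.sum_comm]

theorem mul_mul_apply_eq_frameComp (hP : ∀ i j, P i j = P j i) (A : Matrix (Fin n) (Fin n) ℝ)
    (c d : Fin n) : (P * A * P) c d = frameComp P (fun i => frameComp P (fun j => A i j) d) c := by
  simp only [frameComp, Matrix.mul_apply, Finset.mul_sum, Finset.sum_mul]
  rw [Finset.sum_comm]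
  exact Finset.sum_congr rfl fun i _ => Finset.sum_congr rfl fun j _ => by rw [hP c i]; ring

/-- The components of a covariant tensor in the frame given by the columns of `P`. -/
def frameTensor {k : ℕ} (T : (Fin k → Fin n) → ℝ) (K : Fin k → Fin n) : ℝ :=
  ∑ I : Fin k → Fin n, (∏ a, P (I a) (K a)) * T I

theorem frameTensor_zero (T : (Fin 0 → Fin n) → ℝ) : frameTensor P T ![] = T ![] := by
  simp [frameTensor]
  exact congrArg T (Subsingleton.elim _ _)

theorem frameTensor_cons {k : ℕ} (T : (Fin (k + 1) → Fin n) → ℝ) (a : Fin n) (K : Fin k → Fin n) :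
    frameTensor P T (Matrix.vecCons a K)
      = frameComp P (fun i => frameTensor P (fun I => T (Matrix.vecCons i I)) K) a := by
  simp only [frameTensor, frameComp, Finset.mul_sum]
  rw [← (Fin.consEquiv fun _ => Fin n).sum_comp, Fintype.sum_prod_type]
  refine Finset.sum_congr rfl fun i _ => Finset.sum_congr rfl fun I _ => ?_
  simp [Fin.consEquiv, Fin.prod_univ_succ, Matrix.vecCons, mul_assoc]

theorem frameTensor_two (T : (Fin 2 → Fin n) → ℝ) (a b : Fin n) :
    frameTensor P T ![a, b] = frameComp P (fun i => frameComp P (fun j => T ![i, j]) b) a := by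
  simp only [frameTensor_cons, frameTensor_zero]

theorem frameTensor_three (T : (Fin 3 → Fin n) → ℝ) (a b c : Fin n) :
    frameTensor P T ![a, b, c] = frameComp P (fun i => frameComp P (fun j => frameComp P
      (fun k => T ![i, j, k]) c) b) a := by
  simp only [frameTensor_cons, frameTensor_zero]

theorem frameTensor_four (T : (Fin 4 → Fin n) → ℝ) (a b c d : Fin n) :
    frameTensor P T ![a, b, c, d] = frameComp P (fun i => frameComp P (fun j => frameComp P
      (fun k => frameComp P (fun l => T ![i, j, k, l]) d) c) b) a := by
  simp only [frameTensor_cons, frameTensor_zero]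

/-- `|T|²` with respect to the inverse metric `β = P Pᵀ` is the sum of squares of frame components. -/
theorem sum_frameTensor_sq {β : Matrix (Fin n) (Fin n) ℝ}
    (hβ : ∀ i j, β i j = ∑ a, P i a * P j a) {k : ℕ} (T : (Fin k → Fin n) → ℝ) :
    ∑ K, frameTensor P T K ^ 2
      = ∑ I : Fin k → Fin n, ∑ J : Fin k → Fin n, (∏ a, β (I a) (J a)) * T I * T J := by
  simp only [hβ, Finset.prod_univ_sum, Fintype.piFinset_univ, frameTensor, sq, Finset.sum_mul,
    Finset.mul_sum, Finset.prod_mul_distrib]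
  rw [Finset.sum_comm]
  refine Finset.sum_congr rfl fun I _ => ?_
  rw [Finset.sum_comm]
  refine Finset.sum_congr rfl fun J _ => Finset.sum_congr rfl fun K _ => ?_
  ring

end FrameComponents

theorem hypInv_eq_sum {n : ℕ} (y : E n) (i j : Fin n) :
    hypInv y i j = ∑ a, frame y i a * frame y j a := by
  rw [← frame_mul_frame, Matrix.mul_apply]
  exact Finset.sum_congr rfl fun a _ => by rw [frame_symm y j a]

theorem abs_frameTensor_le {n k : ℕ} (T : TensorField n k) (y : E n) (K : Fin k → Fin n) :
    |frameTensor (frame y) (T y) K| ≤ tensorNorm (hypMetric n) T y := by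
  rw [tensorNorm, hypMetric_inv, ← sum_frameTensor_sq (frame y) (hypInv_eq_sum y)]
  refine Real.abs_le_sqrt ?_
  exact Finset.single_le_sum (f := fun K => frameTensor (frame y) (T y) K ^ 2)
    (fun K _ => sq_nonneg _) (Finset.mem_univ K)

/-! ### Covariant derivatives for the hyperbolic metric -/

section CovariantDerivatives

variable {m : ℕ} {s : ℝ} {y : E (m + 1)}

/-- The covariant derivative `∇_b` of a tensor of rank two, by `christoffel_hypMetric`. -/
theorem covDeriv_two (hy : y ∈ halfSpace s) (e : TensorField (m + 1) 2) (i j k : Fin (m + 1)) :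
    covDeriv (halfSpace s) (hypMetric (m + 1)) e y ![i, j, k]
      = pd (halfSpace s) (fun z => e z ![j, k]) i y
        + hypMetric (m + 1) y i j * ∑ p, y p * e y ![p, k]
        + hypMetric (m + 1) y i k * ∑ p, y p * e y ![j, p] := by
  have h0 : ∀ p, e y (Function.update (Fin.tail ![i, j, k]) 0 p) = e y ![p, k] := fun p =>
    congrArg (e y) (funext fun a => by fin_cases a <;> rfl)
  have h1 : ∀ p, e y (Function.update (Fin.tail ![i, j, k]) 1 p) = e y ![j, p] := fun p =>
    congrArg (e y) (funext fun a => by fin_cases a <;> rfl)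
  rw [covDeriv, Fin.sum_univ_two]
  simp only [h0, h1, christoffel_hypMetric hy, Finset.mul_sum]
  have e1 : (fun z => e z (Fin.tail ![i, j, k])) = fun z => e z ![j, k] := rfl
  have e2 : ![i, j, k] 0 = i ∧ Fin.tail ![i, j, k] 0 = j ∧ Fin.tail ![i, j, k] 1 = k :=
    ⟨rfl, rfl, rfl⟩
  rw [e1, e2.1, e2.2.1, e2.2.2, ← sub_sub, sub_eq_add_neg, sub_eq_add_neg, ← Finset.sum_neg_distrib,
    ← Finset.sum_neg_distrib]
  congr 1
  · congr 1
    exact Finset.sum_congr rfl fun p _ => by ring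
  · exact Finset.sum_congr rfl fun p _ => by ring

/-- The covariant derivative `∇_b` of a tensor of rank three, by `christoffel_hypMetric`. -/
theorem covDeriv_three (hy : y ∈ halfSpace s) (T : TensorField (m + 1) 3) (l i j k : Fin (m + 1)) :
    covDeriv (halfSpace s) (hypMetric (m + 1)) T y ![l, i, j, k]
      = pd (halfSpace s) (fun z => T z ![i, j, k]) l y
        + hypMetric (m + 1) y l i * ∑ p, y p * T y ![p, j, k]
        + hypMetric (m + 1) y l j * ∑ p, y p * T y ![i, p, k]
        + hypMetric (m + 1) y l k * ∑ p, y p * T y ![i, j, p] := by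
  have h0 : ∀ p, T y (Function.update (Fin.tail ![l, i, j, k]) 0 p) = T y ![p, j, k] := fun p =>
    congrArg (T y) (funext fun a => by fin_cases a <;> rfl)
  have h1 : ∀ p, T y (Function.update (Fin.tail ![l, i, j, k]) 1 p) = T y ![i, p, k] := fun p =>
    congrArg (T y) (funext fun a => by fin_cases a <;> rfl)
  have h2 : ∀ p, T y (Function.update (Fin.tail ![l, i, j, k]) 2 p) = T y ![i, j, p] := fun p =>
    congrArg (T y) (funext fun a => by fin_cases a <;> rfl)
  rw [covDeriv, Fin.sum_univ_three]
  simp only [h0, h1, h2, christoffel_hypMetric hy, Finset.mul_sum]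
  have e1 : (fun z => T z (Fin.tail ![l, i, j, k])) = fun z => T z ![i, j, k] := rfl
  have e2 : ![l, i, j, k] 0 = l ∧ Fin.tail ![l, i, j, k] 0 = i ∧ Fin.tail ![l, i, j, k] 1 = j
    ∧ Fin.tail ![l, i, j, k] 2 = k := ⟨rfl, rfl, rfl, rfl⟩
  rw [e1, e2.1, e2.2.1, e2.2.2.1, e2.2.2.2, ← sub_sub, ← sub_sub, sub_eq_add_neg, sub_eq_add_neg,
    sub_eq_add_neg, ← Finset.sum_neg_distrib, ← Finset.sum_neg_distrib, ← Finset.sum_neg_distrib]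
  congr 1
  · congr 1
    · congr 1
      exact Finset.sum_congr rfl fun p _ => by ring
    · exact Finset.sum_congr rfl fun p _ => by ring
  · exact Finset.sum_congr rfl fun p _ => by ring

/-- The Levi-Civita connection commutes with contraction by `b⁻¹`. -/
theorem pd_contraction (hy : y ∈ halfSpace s) {A : Fin (m + 1) → Fin (m + 1) → E (m + 1) → ℝ}
    (hA : ∀ i j, DifferentiableWithinAt ℝ (A i j) (halfSpace s) y) (l : Fin (m + 1)) :
    pd (halfSpace s) (fun z => ∑ i, ∑ j, hypInv z i j * A i j z) l y
      = ∑ i, ∑ j, hypInv y i j * (pd (halfSpace s) (A i j) l y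
        + hypMetric (m + 1) y l i * ∑ p, y p * A p j y
        + hypMetric (m + 1) y l j * ∑ p, y p * A i p y) := by
  have hS := uniqueDiffOn_halfSpace s y hy
  have hc := fun k => differentiableWithinAt_coord (S := halfSpace s) (y := y) k
  have hβ : ∀ i j, (fun z : E (m + 1) => hypInv z i j)
      = fun z => (if i = j then 1 else 0) + z i * z j := by
    intro i j; funext z; simp [hypInv, rankOneUpdate]
  have hβd : ∀ i j, DifferentiableWithinAt ℝ (fun z : E (m + 1) => hypInv z i j) (halfSpace s) y := by
    intro i j
    rw [hβ]
    exact (differentiableWithinAt_const _).fun_add ((hc i).fun_mul (hc j))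
  have hβp : ∀ i j, pd (halfSpace s) (fun z : E (m + 1) => hypInv z i j) l y
      = (if l = i then 1 else 0) * y j + y i * if l = j then 1 else 0 := by
    intro i j
    rw [hβ, pd_add hS (differentiableWithinAt_const _) ((hc i).fun_mul (hc j)), pd_const,
      pd_mul hS (hc i) (hc j), pd_coord hS, pd_coord hS, zero_add]
  rw [pd_sum hS _ fun i _ => DifferentiableWithinAt.fun_sum fun j _ => (hβd i j).fun_mul (hA i j)]
  have e1 : ∀ i, pd (halfSpace s) (fun z => ∑ j, hypInv z i j * A i j z) l y
      = ∑ j, (((if l = i then 1 else 0) * y j + y i * if l = j then 1 else 0) * A i j y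
        + hypInv y i j * pd (halfSpace s) (A i j) l y) := by
    intro i
    rw [pd_sum hS _ fun j _ => (hβd i j).fun_mul (hA i j)]
    exact Finset.sum_congr rfl fun j _ => by rw [pd_mul hS (hβd i j) (hA i j), hβp]
  simp only [e1, mul_add, Finset.sum_add_distrib, add_mul]
  have e2 : ∑ i, ∑ j, hypInv y i j * (hypMetric (m + 1) y l i * ∑ p, y p * A p j y)
      = ∑ i, ∑ j, (y i * if l = j then 1 else 0) * A i j y := by
    rw [Finset.sum_comm]
    have : ∀ j, ∑ i, hypInv y i j * (hypMetric (m + 1) y l i * ∑ p, y p * A p j y)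
        = ∑ p, (y p * if l = j then 1 else 0) * A p j y := by
      intro j
      have h3 := sum_hypInv_mul_hypMetric y j l
      have h4 : ∀ i, hypInv y i j * (hypMetric (m + 1) y l i * ∑ p, y p * A p j y)
          = (hypInv y j i * hypMetric (m + 1) y i l) * ∑ p, y p * A p j y := by
        intro i; rw [hypInv_symm y i j, hypMetric_symm y l i]; ring
      simp only [h4]
      rw [← Finset.sum_mul, h3, Finset.mul_sum]
      refine Finset.sum_congr rfl fun p _ => ?_
      simp only [eq_comm (a := j)]; ring
    simp only [this]
    exact Finset.sum_comm
  have e3 : ∑ i, ∑ j, hypInv y i j * (hypMetric (m + 1) y l j * ∑ p, y p * A i p y)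
      = ∑ i, ∑ j, ((if l = i then 1 else 0) * y j) * A i j y := by
    refine Finset.sum_congr rfl fun i _ => ?_
    have h3 := sum_hypInv_mul_hypMetric y i l
    have h4 : ∀ j, hypInv y i j * (hypMetric (m + 1) y l j * ∑ p, y p * A i p y)
        = (hypInv y i j * hypMetric (m + 1) y j l) * ∑ p, y p * A i p y := by
      intro j; rw [hypMetric_symm y l j]; ring
    simp only [h4]
    rw [← Finset.sum_mul, h3, Finset.mul_sum]
    refine Finset.sum_congr rfl fun p _ => ?_
    simp only [eq_comm (a := i)]; ring
  rw [e2, e3]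
  ring

end CovariantDerivatives

/-! ### The covariant derivative of the charge -/

section ChargeDivergence

variable {m : ℕ} {s r₀ : ℝ} {y : E (m + 1)}

theorem pd_congr_modelEnd {f h : E (m + 1) → ℝ} (hfh : EqOn f h (modelEnd s r₀))
    (hy : y ∈ modelEnd s r₀) (i : Fin (m + 1)) :
    pd (halfSpace s) f i y = pd (halfSpace s) h i y := by
  rw [pd, pd, fderivWithin_halfSpace_eq hy, fderivWithin_halfSpace_eq hy,
    fderivWithin_congr hfh (hfh hy)]

theorem contDiffOn_hypInv (i j : Fin (m + 1)) {S : Set (E (m + 1))} :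
    ContDiffOn ℝ ∞ (fun z : E (m + 1) => hypInv z i j) S := by
  have : (fun z : E (m + 1) => hypInv z i j) = fun z => (if i = j then 1 else 0) + z i * z j := by
    funext z; simp [hypInv, rankOneUpdate]
  rw [this]
  exact (contDiff_const.add (by fun_prop)).contDiffOn

theorem contDiffOn_covDeriv {k : ℕ} {T : TensorField (m + 1) k}
    (hT : ∀ I, ContDiffOn ℝ ∞ (fun z => T z I) (modelEnd s r₀)) (J : Fin (k + 1) → Fin (m + 1)) :
    ContDiffOn ℝ ∞ (fun z => covDeriv (halfSpace s) (hypMetric (m + 1)) T z J) (modelEnd s r₀) := by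
  refine (contDiffOn_pd (hT _) _).sub (ContDiffOn.sum fun a _ => ContDiffOn.sum fun p _ => ?_)
  refine ContDiffOn.mul ?_ (hT _)
  have h : ContDiff ℝ ∞ fun z : E (m + 1) =>
      - z p * hypMetric (m + 1) z (J 0) (Fin.tail J a) :=
    ContDiff.mul (by fun_prop) (contDiff_hypMetric _ _)
  exact h.contDiffOn.congr fun z hz => christoffel_hypMetric hz.1 _ _ _

theorem traceTwo_hypMetric {n : ℕ} (e : TensorField n 2) :
    traceTwo (hypMetric n) e = fun z => ∑ i, ∑ j, hypInv z i j * e z ![i, j] := by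
  funext z; simp only [traceTwo, hypMetric_inv]

theorem divTwo_hypMetric {n : ℕ} (S : Set (E n)) (e : TensorField n 2) (j : Fin n) :
    divTwo S (hypMetric n) e j
      = fun z => ∑ i, ∑ k, hypInv z i k * covDeriv S (hypMetric n) e z ![i, k, j] := by
  funext z; simp only [divTwo, hypMetric_inv]

variable {e : TensorField (m + 1) 2}

/-- `d tr e = tr ∇e`. -/
theorem pd_traceTwo (he : ∀ I, ContDiffOn ℝ ∞ (fun z => e z I) (modelEnd s r₀))
    (hy : y ∈ modelEnd s r₀) (l : Fin (m + 1)) :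
    pd (halfSpace s) (traceTwo (hypMetric (m + 1)) e) l y
      = ∑ i, ∑ j, hypInv y i j *
        covDeriv (halfSpace s) (hypMetric (m + 1)) e y ![l, i, j] := by
  rw [traceTwo_hypMetric, pd_contraction hy.1 (A := fun i j z => e z ![i, j])
    fun i j => differentiableWithinAt_halfSpace (he _) hy]
  simp only [covDeriv_two hy.1]

/-- `∇ d tr e = tr ∇²e`; the left side is `∇` of a 1-form written out. -/
theorem covDeriv_pd_traceTwo (he : ∀ I, ContDiffOn ℝ ∞ (fun z => e z I) (modelEnd s r₀))
    (hy : y ∈ modelEnd s r₀) (l j : Fin (m + 1)) :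
    pd (halfSpace s) (pd (halfSpace s) (traceTwo (hypMetric (m + 1)) e) j) l y
      + hypMetric (m + 1) y l j * ∑ p, y p * pd (halfSpace s) (traceTwo (hypMetric (m + 1)) e) p y
      = ∑ i, ∑ k, hypInv y i k * covDeriv (halfSpace s) (hypMetric (m + 1))
          (covDeriv (halfSpace s) (hypMetric (m + 1)) e) y ![l, j, i, k] := by
  rw [pd_congr_modelEnd (fun z hz => pd_traceTwo he hz j) hy, pd_contraction hy.1
    (A := fun i k z => covDeriv (halfSpace s) (hypMetric (m + 1)) e z ![j, i, k])
    fun i k => differentiableWithinAt_halfSpace (contDiffOn_covDeriv he _) hy]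
  simp only [pd_traceTwo he hy, covDeriv_three hy.1, mul_add, Finset.sum_add_distrib]
  have : hypMetric (m + 1) y l j * ∑ p, y p * ∑ i, ∑ k, hypInv y i k *
        covDeriv (halfSpace s) (hypMetric (m + 1)) e y ![p, i, k]
      = ∑ i, ∑ k, hypInv y i k * (hypMetric (m + 1) y l j * ∑ p, y p *
        covDeriv (halfSpace s) (hypMetric (m + 1)) e y ![p, i, k]) := by
    simp only [Finset.mul_sum]
    rw [Finset.sum_comm]
    refine Finset.sum_congr rfl fun i _ => ?_
    rw [Finset.sum_comm]
    exact Finset.sum_congr rfl fun k _ => Finset.sum_congr rfl fun p _ => by ring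
  rw [this]
  ring

/-- `∇ div e` as a contraction of `∇²e`; the left side is `∇` of a 1-form written out. -/
theorem covDeriv_divTwo (he : ∀ I, ContDiffOn ℝ ∞ (fun z => e z I) (modelEnd s r₀))
    (hy : y ∈ modelEnd s r₀) (l j : Fin (m + 1)) :
    pd (halfSpace s) (divTwo (halfSpace s) (hypMetric (m + 1)) e j) l y
      + hypMetric (m + 1) y l j * ∑ p, y p * divTwo (halfSpace s) (hypMetric (m + 1)) e p y
      = ∑ i, ∑ k, hypInv y i k * covDeriv (halfSpace s) (hypMetric (m + 1))
          (covDeriv (halfSpace s) (hypMetric (m + 1)) e) y ![l, i, k, j] := by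
  simp only [divTwo_hypMetric]
  rw [pd_contraction hy.1
    (A := fun i k z => covDeriv (halfSpace s) (hypMetric (m + 1)) e z ![i, k, j])
    fun i k => differentiableWithinAt_halfSpace (contDiffOn_covDeriv he _) hy]
  simp only [covDeriv_three hy.1, mul_add, Finset.sum_add_distrib]
  have : hypMetric (m + 1) y l j * ∑ p, y p * ∑ i, ∑ k, hypInv y i k *
        covDeriv (halfSpace s) (hypMetric (m + 1)) e y ![i, k, p]
      = ∑ i, ∑ k, hypInv y i k * (hypMetric (m + 1) y l j * ∑ p, y p *
        covDeriv (halfSpace s) (hypMetric (m + 1)) e y ![i, k, p]) := by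
    simp only [Finset.mul_sum]
    rw [Finset.sum_comm]
    refine Finset.sum_congr rfl fun i _ => ?_
    rw [Finset.sum_comm]
    exact Finset.sum_congr rfl fun k _ => Finset.sum_congr rfl fun p _ => by ring
  rw [this]

variable {V : E (m + 1) → ℝ}

theorem contDiffOn_modelEnd_of_isStaticPotential (hV : IsStaticPotential s V) :
    ContDiffOn ℝ ∞ V (modelEnd s r₀) := hV.smooth.mono fun _ h => h.1

theorem pd_pd_of_isStaticPotential (hV : IsStaticPotential s V) (hy : y ∈ halfSpace s)
    (l k : Fin (m + 1)) :
    pd (halfSpace s) (pd (halfSpace s) V k) l y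
      = V y * hypMetric (m + 1) y l k
        - hypMetric (m + 1) y l k * ∑ p, y p * pd (halfSpace s) V p y := by
  have h := hessian_eq_of_isStaticPotential hV hy l k
  simp only [hessian, christoffel_hypMetric hy] at h
  rw [← h, Finset.mul_sum, sub_sub, ← Finset.sum_add_distrib]
  rw [eq_comm, sub_eq_self]
  exact Finset.sum_eq_zero fun p _ => by ring

/-- The 1-form `∇V ⌟ e`. -/
noncomputable def gradContraction (S : Set (E (m + 1))) (V : E (m + 1) → ℝ) (e : TensorField (m + 1) 2)
    (i : Fin (m + 1)) (z : E (m + 1)) : ℝ :=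
  ∑ j, ∑ k, hypInv z j k * (pd S V k z * e z ![j, i])

theorem sum_gradient_mul (S : Set (E (m + 1))) (i : Fin (m + 1)) (z : E (m + 1)) :
    ∑ j, gradient S (hypMetric (m + 1)) V j z * e z ![j, i] = gradContraction S V e i z := by
  simp only [gradient, hypMetric_inv, gradContraction, Finset.sum_mul, mul_assoc]

theorem sum_hypInv_hypMetric_mul (l : Fin (m + 1)) (f : Fin (m + 1) → ℝ) :
    ∑ j, ∑ k, hypInv y j k * (hypMetric (m + 1) y l k * f j) = f l := by
  have h : ∀ j, ∑ k, hypInv y j k * (hypMetric (m + 1) y l k * f j) = if j = l then f j else 0 := by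
    intro j
    have := sum_hypInv_mul_hypMetric y j l
    have h2 : ∀ k, hypInv y j k * (hypMetric (m + 1) y l k * f j)
        = (hypInv y j k * hypMetric (m + 1) y k l) * f j := fun k => by
      rw [hypMetric_symm y l k]; ring
    simp only [h2]
    rw [← Finset.sum_mul, this, ite_mul, one_mul, zero_mul]
  simp [h]

/-- `∇(∇V ⌟ e) = V e + ∇V ⌟ ∇e`, by `∇²V = V b`. -/
theorem covDeriv_gradContraction (hV : IsStaticPotential s V)
    (he : ∀ I, ContDiffOn ℝ ∞ (fun z => e z I) (modelEnd s r₀))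
    (hy : y ∈ modelEnd s r₀) (l i : Fin (m + 1)) :
    pd (halfSpace s) (gradContraction (halfSpace s) V e i) l y
      + hypMetric (m + 1) y l i * ∑ p, y p * gradContraction (halfSpace s) V e p y
      = V y * e y ![l, i] + ∑ j, ∑ k, hypInv y j k * (pd (halfSpace s) V k y *
          covDeriv (halfSpace s) (hypMetric (m + 1)) e y ![l, j, i]) := by
  have hS := uniqueDiffOn_halfSpace s y hy.1
  have hVk := fun k => differentiableWithinAt_halfSpace (contDiffOn_pd
    (contDiffOn_modelEnd_of_isStaticPotential hV) k) hy
  have hed := fun I => differentiableWithinAt_halfSpace (he I) hy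
  have h1 := pd_contraction hy.1 (A := fun j k z => pd (halfSpace s) V k z * e z ![j, i])
    (fun j k => (hVk k).fun_mul (hed _)) l
  rw [show gradContraction (halfSpace s) V e i = fun z => ∑ j, ∑ k, hypInv z j k *
    (pd (halfSpace s) V k z * e z ![j, i]) from rfl, h1]
  have h2 : V y * e y ![l, i] = ∑ j, ∑ k, hypInv y j k * (hypMetric (m + 1) y l k *
      (V y * e y ![j, i])) := (sum_hypInv_hypMetric_mul l fun j => V y * e y ![j, i]).symm
  have h3 : hypMetric (m + 1) y l i * ∑ p, y p * gradContraction (halfSpace s) V e p y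
      = ∑ j, ∑ k, hypInv y j k * (pd (halfSpace s) V k y *
        (hypMetric (m + 1) y l i * ∑ p, y p * e y ![j, p])) := by
    simp only [gradContraction, Finset.mul_sum]
    rw [Finset.sum_comm]
    refine Finset.sum_congr rfl fun j _ => ?_
    rw [Finset.sum_comm]
    exact Finset.sum_congr rfl fun k _ => Finset.sum_congr rfl fun p _ => by ring
  rw [h2, h3, ← Finset.sum_add_distrib, ← Finset.sum_add_distrib]
  refine Finset.sum_congr rfl fun j _ => ?_
  rw [← Finset.sum_add_distrib, ← Finset.sum_add_distrib]
  refine Finset.sum_congr rfl fun k _ => ?_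
  rw [pd_mul hS (hVk k) (hed _), pd_pd_of_isStaticPotential hV hy.1, covDeriv_two hy.1]
  have h4 : ∑ p, y p * (pd (halfSpace s) V k y * e y ![p, i])
      = pd (halfSpace s) V k y * ∑ p, y p * e y ![p, i] := by
    rw [Finset.mul_sum]; exact Finset.sum_congr rfl fun p _ => by ring
  have h5 : ∑ p, y p * (pd (halfSpace s) V p y * e y ![j, i])
      = (∑ p, y p * pd (halfSpace s) V p y) * e y ![j, i] := by
    rw [Finset.sum_mul]; exact Finset.sum_congr rfl fun p _ => by ring
  rw [h4, h5]
  ring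

theorem charge_eq (S : Set (E (m + 1))) (i : Fin (m + 1)) :
    charge S (hypMetric (m + 1)) V e i = fun z =>
      V z * (divTwo S (hypMetric (m + 1)) e i z - pd S (traceTwo (hypMetric (m + 1)) e) i z)
        - gradContraction S V e i z + traceTwo (hypMetric (m + 1)) e z * pd S V i z := by
  funext z; rw [charge, sum_gradient_mul]

theorem contDiffOn_traceTwo (he : ∀ I, ContDiffOn ℝ ∞ (fun z => e z I) (modelEnd s r₀)) :
    ContDiffOn ℝ ∞ (traceTwo (hypMetric (m + 1)) e) (modelEnd s r₀) := by
  rw [traceTwo_hypMetric]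
  exact ContDiffOn.sum fun i _ => ContDiffOn.sum fun j _ => (contDiffOn_hypInv i j).mul (he _)

theorem contDiffOn_divTwo (he : ∀ I, ContDiffOn ℝ ∞ (fun z => e z I) (modelEnd s r₀))
    (j : Fin (m + 1)) :
    ContDiffOn ℝ ∞ (divTwo (halfSpace s) (hypMetric (m + 1)) e j) (modelEnd s r₀) := by
  rw [divTwo_hypMetric]
  exact ContDiffOn.sum fun i _ => ContDiffOn.sum fun k _ =>
    (contDiffOn_hypInv i k).mul (contDiffOn_covDeriv he _)

theorem contDiffOn_gradContraction (hV : IsStaticPotential s V)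
    (he : ∀ I, ContDiffOn ℝ ∞ (fun z => e z I) (modelEnd s r₀)) (i : Fin (m + 1)) :
    ContDiffOn ℝ ∞ (gradContraction (halfSpace s) V e i) (modelEnd s r₀) :=
  ContDiffOn.sum fun j _ => ContDiffOn.sum fun k _ => (contDiffOn_hypInv j k).mul
    ((contDiffOn_pd (contDiffOn_modelEnd_of_isStaticPotential hV) k).mul (he _))

theorem contDiffOn_charge (hV : IsStaticPotential s V)
    (he : ∀ I, ContDiffOn ℝ ∞ (fun z => e z I) (modelEnd s r₀)) (i : Fin (m + 1)) :
    ContDiffOn ℝ ∞ (charge (halfSpace s) (hypMetric (m + 1)) V e i) (modelEnd s r₀) := by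
  have hV' := contDiffOn_modelEnd_of_isStaticPotential (r₀ := r₀) hV
  rw [charge_eq]
  exact ((hV'.mul ((contDiffOn_divTwo he i).sub (contDiffOn_pd (contDiffOn_traceTwo he) i))).sub
    (contDiffOn_gradContraction hV he i)).add ((contDiffOn_traceTwo he).mul (contDiffOn_pd hV' i))

/-- The covariant derivative of `𝕌(V, e)`, with `∇²V = V b` inserted. -/
theorem covDeriv_charge (hV : IsStaticPotential s V)
    (he : ∀ I, ContDiffOn ℝ ∞ (fun z => e z I) (modelEnd s r₀))
    (hy : y ∈ modelEnd s r₀) (l i : Fin (m + 1)) :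
    pd (halfSpace s) (charge (halfSpace s) (hypMetric (m + 1)) V e i) l y
      + hypMetric (m + 1) y l i * ∑ p, y p * charge (halfSpace s) (hypMetric (m + 1)) V e p y
      = pd (halfSpace s) V l y * (divTwo (halfSpace s) (hypMetric (m + 1)) e i y
          - pd (halfSpace s) (traceTwo (hypMetric (m + 1)) e) i y)
        + V y * ((∑ j, ∑ k, hypInv y j k * covDeriv (halfSpace s) (hypMetric (m + 1))
            (covDeriv (halfSpace s) (hypMetric (m + 1)) e) y ![l, j, k, i])
          - ∑ j, ∑ k, hypInv y j k * covDeriv (halfSpace s) (hypMetric (m + 1))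
            (covDeriv (halfSpace s) (hypMetric (m + 1)) e) y ![l, i, j, k])
        - (V y * e y ![l, i] + ∑ j, ∑ k, hypInv y j k * (pd (halfSpace s) V k y *
          covDeriv (halfSpace s) (hypMetric (m + 1)) e y ![l, j, i]))
        + pd (halfSpace s) (traceTwo (hypMetric (m + 1)) e) l y * pd (halfSpace s) V i y
        + traceTwo (hypMetric (m + 1)) e y * V y * hypMetric (m + 1) y l i := by
  have hS := uniqueDiffOn_halfSpace s y hy.1
  have hV' := contDiffOn_modelEnd_of_isStaticPotential (r₀ := r₀) hV
  have dV := differentiableWithinAt_halfSpace hV' hy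
  have dVi := differentiableWithinAt_halfSpace (contDiffOn_pd hV' i) hy
  have dD := differentiableWithinAt_halfSpace (contDiffOn_divTwo he i) hy
  have dt := differentiableWithinAt_halfSpace (contDiffOn_traceTwo he) hy
  have dti := differentiableWithinAt_halfSpace (contDiffOn_pd (contDiffOn_traceTwo he) i) hy
  have dX := differentiableWithinAt_halfSpace (contDiffOn_gradContraction hV he i) hy
  rw [← covDeriv_gradContraction hV he hy, ← covDeriv_divTwo he hy, ← covDeriv_pd_traceTwo he hy]
  simp only [charge_eq]
  rw [pd_add hS ((dV.fun_mul (dD.fun_sub dti)).fun_sub dX) (dt.fun_mul dVi),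
    pd_sub hS (dV.fun_mul (dD.fun_sub dti)) dX, pd_mul hS dV (dD.fun_sub dti), pd_sub hS dD dti,
    pd_mul hS dt dVi, pd_pd_of_isStaticPotential hV hy.1]
  have h1 : ∑ p, y p * (V y * (divTwo (halfSpace s) (hypMetric (m + 1)) e p y
        - pd (halfSpace s) (traceTwo (hypMetric (m + 1)) e) p y)
        - gradContraction (halfSpace s) V e p y
        + traceTwo (hypMetric (m + 1)) e y * pd (halfSpace s) V p y)
      = V y * ((∑ p, y p * divTwo (halfSpace s) (hypMetric (m + 1)) e p y)
        - ∑ p, y p * pd (halfSpace s) (traceTwo (hypMetric (m + 1)) e) p y)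
        - (∑ p, y p * gradContraction (halfSpace s) V e p y)
        + traceTwo (hypMetric (m + 1)) e y * ∑ p, y p * pd (halfSpace s) V p y := by
    simp only [Finset.mul_sum, ← Finset.sum_sub_distrib, ← Finset.sum_add_distrib]
    exact Finset.sum_congr rfl fun p _ => by ring
  rw [h1]
  ring

/-- The vector density `√det b · b^{ij} U_j` of a 1-form `U`; here `√det b = 1 / √(1 + |y|²)`. -/
noncomputable def vectorDensity (U : Fin (m + 1) → E (m + 1) → ℝ) (i : Fin (m + 1)) (z : E (m + 1)) : ℝ :=
  (height z)⁻¹ * ∑ j, hypInv z i j * U j z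

theorem contDiffOn_vectorDensity {U : Fin (m + 1) → E (m + 1) → ℝ}
    (hU : ∀ i, ContDiffOn ℝ ∞ (U i) (modelEnd s r₀)) (i : Fin (m + 1)) :
    ContDiffOn ℝ ∞ (vectorDensity U i) (modelEnd s r₀) :=
  (contDiff_height.inv fun z => (height_pos z).ne').contDiffOn.mul
    (ContDiffOn.sum fun j _ => (contDiffOn_hypInv i j).mul (hU j))

/-- The coordinate divergence of the density is `√det b` times the `b`-divergence of the 1-form; here
`√det b = 1 / height`, and the bracket is `∇ᵢUⱼ`. -/
theorem divWithin_vectorDensity {U : Fin (m + 1) → E (m + 1) → ℝ}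
    (hU : ∀ i, ContDiffOn ℝ ∞ (U i) (modelEnd s r₀)) (hy : y ∈ modelEnd s r₀) :
    height y * divWithin (halfSpace s) (vectorDensity U) y
      = ∑ i, ∑ j, hypInv y i j * (pd (halfSpace s) (U j) i y
        + hypMetric (m + 1) y i j * ∑ p, y p * U p y) := by
  have hS := uniqueDiffOn_halfSpace s y hy.1
  have h0 := (height_pos y).ne'
  have hc := fun k => differentiableWithinAt_coord (S := halfSpace s) (y := y) k
  have dU := fun j => differentiableWithinAt_halfSpace (hU j) hy
  have dβ := fun i j => differentiableWithinAt_halfSpace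
    (contDiffOn_hypInv (m := m) i j (S := modelEnd s r₀)) hy
  have hβp : ∀ i j l, pd (halfSpace s) (fun z : E (m + 1) => hypInv z i j) l y
      = (if l = i then 1 else 0) * y j + y i * if l = j then 1 else 0 := by
    intro i j l
    have : (fun z : E (m + 1) => hypInv z i j) = fun z => (if i = j then 1 else 0) + z i * z j := by
      funext z; simp [hypInv, rankOneUpdate]
    rw [this, pd_add hS (differentiableWithinAt_const _) ((hc i).fun_mul (hc j)), pd_const,
      pd_mul hS (hc i) (hc j), pd_coord hS, pd_coord hS, zero_add]
  have dsum : ∀ i, DifferentiableWithinAt ℝ (fun z => ∑ j, hypInv z i j * U j z) (halfSpace s) y :=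
    fun i => DifferentiableWithinAt.fun_sum fun j _ => (dβ i j).fun_mul (dU j)
  have h1 : ∀ i, pd (halfSpace s) (vectorDensity U i) i y
      = - y i * (height y)⁻¹ ^ 3 * (∑ j, hypInv y i j * U j y)
        + (height y)⁻¹ * ∑ j, ((y j + y i * if i = j then 1 else 0) * U j y
          + hypInv y i j * pd (halfSpace s) (U j) i y) := by
    intro i
    rw [show vectorDensity U i = fun z => (height z)⁻¹ * ∑ j, hypInv z i j * U j z from rfl,
      pd_mul hS differentiableWithinAt_height_inv (dsum i), pd_height_inv hS,
      pd_sum hS _ fun j _ => (dβ i j).fun_mul (dU j)]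
    congr 2
    refine Finset.sum_congr rfl fun j _ => ?_
    rw [pd_mul hS (dβ i j) (dU j), hβp, if_pos rfl, one_mul]
  have h2 : ∑ i, y i * ∑ j, hypInv y i j * U j y = height y ^ 2 * ∑ p, y p * U p y := by
    simp only [Finset.mul_sum]
    rw [Finset.sum_comm]
    refine Finset.sum_congr rfl fun j _ => ?_
    rw [← mul_assoc, ← sum_hypInv_mul, Finset.sum_mul]
    refine Finset.sum_congr rfl fun i _ => ?_
    rw [hypInv_symm y j i]; ring
  have h3 : ∑ i, ∑ j, hypInv y i j * hypMetric (m + 1) y i j = (m : ℝ) + 1 := by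
    have : ∀ i, ∑ j, hypInv y i j * hypMetric (m + 1) y i j = 1 := by
      intro i
      have h := sum_hypInv_mul_hypMetric y i i
      rw [if_pos rfl] at h
      rw [← h]
      exact Finset.sum_congr rfl fun j _ => by rw [hypMetric_symm y i j]
    simp [this]
  have h4 : ∑ i, ∑ j, (y j + y i * if i = j then 1 else 0) * U j y
      = ((m : ℝ) + 2) * ∑ p, y p * U p y := by
    have : ∀ i, ∑ j, (y j + y i * if i = j then 1 else 0) * U j y
        = (∑ p, y p * U p y) + y i * U i y := by
      intro i
      simp only [add_mul, Finset.sum_add_distrib, mul_ite, mul_one, mul_zero, ite_mul, zero_mul,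
        Finset.sum_ite_eq, Finset.mem_univ, if_true]
    simp only [this, Finset.sum_add_distrib, Finset.sum_const, Finset.card_univ, Fintype.card_fin,
      nsmul_eq_mul]
    push_cast
    ring
  have h5 : ∑ i, ∑ j, hypInv y i j * (pd (halfSpace s) (U j) i y
        + hypMetric (m + 1) y i j * ∑ p, y p * U p y)
      = (∑ i, ∑ j, hypInv y i j * pd (halfSpace s) (U j) i y)
        + ((m : ℝ) + 1) * ∑ p, y p * U p y := by
    rw [← h3]
    simp only [mul_add, Finset.sum_add_distrib, Finset.sum_mul, mul_assoc]
  have h6 : ∑ i, (- y i * (height y)⁻¹ ^ 3 * (∑ j, hypInv y i j * U j y))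
      = - (height y)⁻¹ ^ 3 * ∑ i, y i * ∑ j, hypInv y i j * U j y := by
    rw [Finset.mul_sum]
    exact Finset.sum_congr rfl fun i _ => by ring
  rw [h5, divWithin]
  simp only [h1, Finset.sum_add_distrib]
  rw [h6, h2, ← Finset.mul_sum]
  simp only [Finset.sum_add_distrib]
  rw [h4]
  field_simp
  ring

end ChargeDivergence

/-! ### The divergence of the charge -/

section ChargeDivergenceFrame

variable {m : ℕ} {s r₀ : ℝ} {y : E (m + 1)} {e : TensorField (m + 1) 2} {V : E (m + 1) → ℝ}

theorem covDeriv_two_symm (hy : y ∈ modelEnd s r₀)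
    (hs : ∀ z ∈ modelEnd s r₀, ∀ i j, e z ![i, j] = e z ![j, i]) (i j k : Fin (m + 1)) :
    covDeriv (halfSpace s) (hypMetric (m + 1)) e y ![i, j, k]
      = covDeriv (halfSpace s) (hypMetric (m + 1)) e y ![i, k, j] := by
  rw [covDeriv_two hy.1, covDeriv_two hy.1, pd_congr_modelEnd (fun z hz => hs z hz j k) hy]
  simp only [hs y hy _ k, hs y hy j]
  ring

theorem covDeriv_covDeriv_symm (hy : y ∈ modelEnd s r₀)
    (hs : ∀ z ∈ modelEnd s r₀, ∀ i j, e z ![i, j] = e z ![j, i]) (l i j k : Fin (m + 1)) :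
    covDeriv (halfSpace s) (hypMetric (m + 1)) (covDeriv (halfSpace s) (hypMetric (m + 1)) e) y
        ![l, i, j, k]
      = covDeriv (halfSpace s) (hypMetric (m + 1)) (covDeriv (halfSpace s) (hypMetric (m + 1)) e) y
        ![l, i, k, j] := by
  have h := fun i j k => covDeriv_two_symm hy hs i j k
  rw [covDeriv_three hy.1, covDeriv_three hy.1,
    pd_congr_modelEnd (fun z hz => covDeriv_two_symm hz hs i j k) hy]
  simp only [h _ j k, h i _ k, h i j _]
  ring

theorem sum_hypInv_sum_hypInv (T : TensorField (m + 1) 4) :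
    ∑ l, ∑ i, hypInv y l i * ∑ j, ∑ k, hypInv y j k * T y ![l, j, k, i]
      = ∑ a, ∑ b, frameTensor (frame y) (T y) ![a, b, b, a] := by
  simp only [sum_mul_eq_sum_frameComp (frame y) (hypInv_eq_sum y), frameComp_sum, frameTensor_four]
  refine Finset.sum_congr rfl fun a _ => Finset.sum_congr rfl fun b _ => ?_
  congr 1; funext l
  rw [frameComp_comm]
  congr 1; funext j
  exact frameComp_comm _ _ _ _

theorem sum_hypInv_sum_hypInv' (T : TensorField (m + 1) 4) :
    ∑ l, ∑ i, hypInv y l i * ∑ j, ∑ k, hypInv y j k * T y ![l, i, j, k]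
      = ∑ a, ∑ b, frameTensor (frame y) (T y) ![a, a, b, b] := by
  simp only [sum_mul_eq_sum_frameComp (frame y) (hypInv_eq_sum y), frameComp_sum, frameTensor_four]

theorem traceTwo_eq_sum_frameTensor :
    traceTwo (hypMetric (m + 1)) e y = ∑ a, frameTensor (frame y) (e y) ![a, a] := by
  rw [traceTwo_hypMetric]
  simp only [sum_mul_eq_sum_frameComp (frame y) (hypInv_eq_sum y), frameTensor_two]

theorem sum_hypInv_mul_hypMetric_eq :
    ∑ i, ∑ j, hypInv y i j * hypMetric (m + 1) y i j = (m : ℝ) + 1 := by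
  have : ∀ i, ∑ j, hypInv y i j * hypMetric (m + 1) y i j = 1 := by
    intro i
    have h := sum_hypInv_mul_hypMetric y i i
    rw [if_pos rfl] at h
    rw [← h]
    exact Finset.sum_congr rfl fun j _ => by rw [hypMetric_symm y i j]
  simp [this]

/-- The `b`-divergence of the charge: because `V` is a static potential, all terms with
derivatives of `V` cancel, and what remains is `V` times the linearization at `b` of the scalar
curvature. -/
theorem divWithin_vectorDensity_charge (hV : IsStaticPotential s V)
    (he : ∀ I, ContDiffOn ℝ ∞ (fun z => e z I) (modelEnd s r₀))
    (hs : ∀ z ∈ modelEnd s r₀, ∀ i j, e z ![i, j] = e z ![j, i]) (hy : y ∈ modelEnd s r₀) :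
    height y * divWithin (halfSpace s)
        (vectorDensity (charge (halfSpace s) (hypMetric (m + 1)) V e)) y
      = V y * ((∑ a, ∑ b, frameTensor (frame y) (covDeriv (halfSpace s) (hypMetric (m + 1))
            (covDeriv (halfSpace s) (hypMetric (m + 1)) e) y) ![a, b, b, a])
          - (∑ a, ∑ b, frameTensor (frame y) (covDeriv (halfSpace s) (hypMetric (m + 1))
            (covDeriv (halfSpace s) (hypMetric (m + 1)) e) y) ![a, a, b, b])
          + m * ∑ a, frameTensor (frame y) (e y) ![a, a]) := by
  rw [divWithin_vectorDensity (contDiffOn_charge hV he) hy]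
  simp only [covDeriv_charge hV he hy]
  rw [← sum_hypInv_sum_hypInv, ← sum_hypInv_sum_hypInv', ← traceTwo_eq_sum_frameTensor]
  have h1 : ∑ i, ∑ j, hypInv y i j * (pd (halfSpace s) V i y *
        divTwo (halfSpace s) (hypMetric (m + 1)) e j y)
      = ∑ i, ∑ j, hypInv y i j * ∑ p, ∑ q, hypInv y p q * (pd (halfSpace s) V q y *
          covDeriv (halfSpace s) (hypMetric (m + 1)) e y ![i, p, j]) := by
    have e1 : ∀ j, divTwo (halfSpace s) (hypMetric (m + 1)) e j y
        = ∑ i, ∑ k, hypInv y i k * covDeriv (halfSpace s) (hypMetric (m + 1)) e y ![i, k, j] :=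
      fun j => congrFun (divTwo_hypMetric _ e j) y
    simp only [e1, sum_mul_eq_sum_frameComp (frame y) (hypInv_eq_sum y), frameComp_sum,
      frameComp_mul_left, frameComp_mul_right]
    rw [Finset.sum_comm]
    refine Finset.sum_congr rfl fun a _ => ?_
    rw [Finset.mul_sum]
    refine Finset.sum_congr rfl fun b _ => ?_
    congr 1
    rw [frameComp_comm]
    congr 1; funext i
    rw [frameComp_comm]
    congr 1; funext j; congr 1; funext p
    exact covDeriv_two_symm hy hs i j p
  have h2 : ∑ i, ∑ j, hypInv y i j * (pd (halfSpace s) V i y *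
        pd (halfSpace s) (traceTwo (hypMetric (m + 1)) e) j y)
      = ∑ i, ∑ j, hypInv y i j * (pd (halfSpace s) (traceTwo (hypMetric (m + 1)) e) i y *
        pd (halfSpace s) V j y) := by
    rw [Finset.sum_comm]
    refine Finset.sum_congr rfl fun i _ => Finset.sum_congr rfl fun j _ => ?_
    rw [hypInv_symm y j i]; ring
  have h3 : traceTwo (hypMetric (m + 1)) e y = ∑ i, ∑ j, hypInv y i j * e y ![i, j] :=
    congrFun (traceTwo_hypMetric e) y
  have h4 : ∀ c : ℝ, ∑ i, ∑ j, hypInv y i j * (c * hypMetric (m + 1) y i j) = c * ((m : ℝ) + 1) := by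
    intro c
    rw [← sum_hypInv_mul_hypMetric_eq (y := y), Finset.mul_sum]
    simp only [Finset.mul_sum, mul_left_comm]
  have h5 : ∀ (c : ℝ) (f : Fin (m + 1) → Fin (m + 1) → ℝ),
      ∑ i, ∑ j, hypInv y i j * (c * f i j) = c * ∑ i, ∑ j, hypInv y i j * f i j := by
    intro c f
    simp only [Finset.mul_sum, mul_left_comm]
  simp only [mul_add, mul_sub, Finset.sum_add_distrib, Finset.sum_sub_distrib, h1, h2, h4, h5]
  rw [← h3]
  ring

end ChargeDivergenceFrame

/-! ### The difference of two Levi-Civita connections -/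

section ConnectionDifference

variable {m : ℕ} {s r₀ : ℝ} {y : E (m + 1)} {G : MetricField (m + 1)}

theorem deviation_apply (G : MetricField (m + 1)) (z : E (m + 1)) (i j : Fin (m + 1)) :
    deviation G z ![i, j] = G z i j - hypMetric (m + 1) z i j := rfl

theorem contDiffOn_deviation (hG : ∀ i j, ContDiffOn ℝ ∞ (fun z => G z i j) (modelEnd s r₀))
    (I : Fin 2 → Fin (m + 1)) : ContDiffOn ℝ ∞ (fun z => deviation G z I) (modelEnd s r₀) :=
  (hG _ _).sub (contDiff_hypMetric _ _).contDiffOn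

/-- The covariant derivative `∇_b e` of `e = G - b`. -/
noncomputable def devDeriv (s : ℝ) (G : MetricField (m + 1)) : TensorField (m + 1) 3 :=
  covDeriv (halfSpace s) (hypMetric (m + 1)) (deviation G)

/-- The second covariant derivative `∇_b² e` of `e = G - b`. -/
noncomputable def devDerivTwo (s : ℝ) (G : MetricField (m + 1)) : TensorField (m + 1) 4 :=
  covDeriv (halfSpace s) (hypMetric (m + 1)) (devDeriv s G)

/-- `Sᵢₗⱼ = ∇ᵢeⱼₗ + ∇ⱼeᵢₗ - ∇ₗeᵢⱼ`; the difference of the Levi-Civita connections of `G` and `b`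
is `½ Gᵏˡ Sᵢₗⱼ`. -/
noncomputable def koszul (s : ℝ) (G : MetricField (m + 1)) (i l j : Fin (m + 1))
    (y : E (m + 1)) : ℝ :=
  devDeriv s G y ![i, j, l] + devDeriv s G y ![j, i, l] - devDeriv s G y ![l, i, j]

/-- The components `∇ₚSᵢₗⱼ` of the covariant derivative of `koszul`. -/
noncomputable def koszulDeriv (s : ℝ) (G : MetricField (m + 1)) (p i l j : Fin (m + 1))
    (y : E (m + 1)) : ℝ :=
  devDerivTwo s G y ![p, i, j, l] + devDerivTwo s G y ![p, j, i, l] - devDerivTwo s G y ![p, l, i, j]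

/-- The difference `Cᵏᵢⱼ` of the Christoffel symbols of `G` and `b`. -/
noncomputable def connDiff (s : ℝ) (G : MetricField (m + 1)) (k i j : Fin (m + 1))
    (y : E (m + 1)) : ℝ :=
  1 / 2 * ∑ l, (G y)⁻¹ k l * koszul s G i l j y

theorem contDiffOn_koszul (hG : ∀ i j, ContDiffOn ℝ ∞ (fun z => G z i j) (modelEnd s r₀))
    (i l j : Fin (m + 1)) : ContDiffOn ℝ ∞ (koszul s G i l j) (modelEnd s r₀) :=
  ((contDiffOn_covDeriv (contDiffOn_deviation hG) _).add
    (contDiffOn_covDeriv (contDiffOn_deviation hG) _)).sub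
    (contDiffOn_covDeriv (contDiffOn_deviation hG) _)

/-- `∂ₗ Gᵢⱼ` in terms of the covariant derivative `∇_b G = ∇_b e`. -/
theorem pd_metric (hG : ∀ i j, ContDiffOn ℝ ∞ (fun z => G z i j) (modelEnd s r₀))
    (hy : y ∈ modelEnd s r₀) (l i j : Fin (m + 1)) :
    pd (halfSpace s) (fun z => G z i j) l y
      = devDeriv s G y ![l, i, j] - hypMetric (m + 1) y l i * ∑ p, y p * G y p j
        - hypMetric (m + 1) y l j * ∑ p, y p * G y i p := by
  have hS := uniqueDiffOn_halfSpace s y hy.1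
  have hb : ∀ i, ∑ p, y p * hypMetric (m + 1) y i p = y i / height y ^ 2 := by
    intro i
    rw [← sum_hypMetric_mul]
    exact Finset.sum_congr rfl fun p _ => mul_comm _ _
  have hb' : ∀ j, ∑ p, y p * hypMetric (m + 1) y p j = y j / height y ^ 2 := by
    intro j
    rw [← hb]
    exact Finset.sum_congr rfl fun p _ => by rw [hypMetric_symm]
  rw [devDeriv, covDeriv_two hy.1]
  simp only [deviation_apply]
  rw [pd_sub hS (differentiableWithinAt_halfSpace (hG i j) hy) (differentiableWithinAt_hypMetric i j),
    pd_hypMetric hy.1]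
  simp only [mul_sub, Finset.sum_sub_distrib, hb, hb']
  ring

theorem inv_symm (hs : ∀ i j, G y i j = G y j i) (i j : Fin (m + 1)) :
    (G y)⁻¹ i j = (G y)⁻¹ j i := by
  have h : Matrix.transpose (G y) = G y := by ext i j; exact hs j i
  have h2 := Matrix.transpose_nonsing_inv (G y)
  rw [h] at h2
  exact congrFun (congrFun h2 j) i

theorem sum_inv_mul (hs : ∀ i j, G y i j = G y j i) (hd : IsUnit (G y).det) (k : Fin (m + 1)) :
    ∑ l, (G y)⁻¹ k l * ∑ p, y p * G y p l = y k := by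
  have h : ((G y)⁻¹ * G y).mulVec y k = y k := by
    rw [Matrix.nonsing_inv_mul _ hd, Matrix.one_mulVec]
  rw [← Matrix.mulVec_mulVec, Matrix.mulVec, dotProduct] at h
  rw [← h]
  refine Finset.sum_congr rfl fun l _ => ?_
  congr 1
  exact Finset.sum_congr rfl fun p _ => by rw [hs p l, mul_comm]

/-- The Christoffel symbols of `G` are those of `b` plus the tensor `connDiff`. -/
theorem christoffel_eq (hG : ∀ i j, ContDiffOn ℝ ∞ (fun z => G z i j) (modelEnd s r₀))
    (hs : ∀ z ∈ modelEnd s r₀, ∀ i j, G z i j = G z j i)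
    (hd : ∀ z ∈ modelEnd s r₀, IsUnit (G z).det) (hy : y ∈ modelEnd s r₀) (k i j : Fin (m + 1)) :
    christoffel (halfSpace s) G k i j y
      = - y k * hypMetric (m + 1) y i j + connDiff s G k i j y := by
  rw [christoffel, ← sum_inv_mul (hs y hy) (hd y hy) k, connDiff]
  simp only [pd_metric hG hy, koszul]
  rw [← Finset.sum_neg_distrib, Finset.sum_mul, Finset.mul_sum, Finset.mul_sum,
    ← Finset.sum_add_distrib]
  refine Finset.sum_congr rfl fun l _ => ?_
  have h1 : ∀ i, ∑ p, y p * G y i p = ∑ p, y p * G y p i := fun i =>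
    Finset.sum_congr rfl fun p _ => by rw [hs y hy i p]
  rw [h1 j, h1 i, hypMetric_symm y j i, hypMetric_symm y l i, hypMetric_symm y l j]
  ring

theorem contDiffOn_inv (hG : ∀ i j, ContDiffOn ℝ ∞ (fun z => G z i j) (modelEnd s r₀))
    (hd : ∀ z ∈ modelEnd s r₀, IsUnit (G z).det) (k l : Fin (m + 1)) :
    ContDiffOn ℝ ∞ (fun z => (G z)⁻¹ k l) (modelEnd s r₀) := by
  have hdet : ∀ (A : MetricField (m + 1)),
      (∀ i j, ContDiffOn ℝ ∞ (fun z => A z i j) (modelEnd s r₀)) →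
      ContDiffOn ℝ ∞ (fun z => (A z).det) (modelEnd s r₀) := by
    intro A hA
    simp only [Matrix.det_apply']
    exact ContDiffOn.sum fun σ _ => contDiffOn_const.mul (contDiffOn_prod fun i _ => hA _ _)
  simp only [Matrix.inv_def, Matrix.smul_apply, smul_eq_mul, Ring.inverse_eq_inv',
    Matrix.adjugate_apply]
  refine ContDiffOn.mul ((hdet G hG).inv fun z hz => (hd z hz).ne_zero) (hdet _ fun i j => ?_)
  by_cases h : i = l
  · subst h; simpa using contDiffOn_const
  · simpa [Matrix.updateRow_ne h] using hG i j

/-- `∂ₚ Gᵏˡ`, from `∂ G⁻¹ = -G⁻¹ (∂G) G⁻¹` and `pd_metric`. -/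
theorem pd_inv (hG : ∀ i j, ContDiffOn ℝ ∞ (fun z => G z i j) (modelEnd s r₀))
    (hs : ∀ z ∈ modelEnd s r₀, ∀ i j, G z i j = G z j i)
    (hd : ∀ z ∈ modelEnd s r₀, IsUnit (G z).det) (hy : y ∈ modelEnd s r₀) (p k l : Fin (m + 1)) :
    pd (halfSpace s) (fun z => (G z)⁻¹ k l) p y
      = -(∑ a, ∑ c, (G y)⁻¹ k a * devDeriv s G y ![p, a, c] * (G y)⁻¹ c l)
        + (∑ a, (G y)⁻¹ k a * hypMetric (m + 1) y p a) * y l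
        + y k * ∑ c, hypMetric (m + 1) y p c * (G y)⁻¹ c l := by
  have hS := uniqueDiffOn_halfSpace s y hy.1
  have dG := fun i j => differentiableWithinAt_halfSpace (hG i j) hy
  have dA := fun i j => differentiableWithinAt_halfSpace (contDiffOn_inv hG hd i j) hy
  let A' : Matrix (Fin (m + 1)) (Fin (m + 1)) ℝ :=
    Matrix.of fun i j => pd (halfSpace s) (fun z => (G z)⁻¹ i j) p y
  let G' : Matrix (Fin (m + 1)) (Fin (m + 1)) ℝ :=
    Matrix.of fun i j => pd (halfSpace s) (fun z => G z i j) p y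
  have h0 : A' * G y + (G y)⁻¹ * G' = 0 := by
    ext i j
    have h1 : pd (halfSpace s) (fun z => ∑ a, (G z)⁻¹ i a * G z a j) p y = 0 := by
      rw [pd_congr_modelEnd (h := fun _ => (1 : Matrix (Fin (m + 1)) (Fin (m + 1)) ℝ) i j)
        (fun z hz => ?_) hy, pd_const]
      rw [← Matrix.mul_apply, Matrix.nonsing_inv_mul _ (hd z hz)]
    rw [pd_sum hS _ fun a _ => (dA i a).fun_mul (dG a j)] at h1
    simp only [pd_mul hS (dA _ _) (dG _ _), Finset.sum_add_distrib] at h1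
    simpa [Matrix.mul_apply, A', G'] using h1
  have h1 : A' = -((G y)⁻¹ * G' * (G y)⁻¹) := by
    have : A' * G y * (G y)⁻¹ = A' := by
      rw [mul_assoc, Matrix.mul_nonsing_inv _ (hd y hy), mul_one]
    rw [← this, eq_neg_of_add_eq_zero_left h0, neg_mul]
  have h2 := congrFun (congrFun h1 k) l
  have h3 : ((G y)⁻¹ * G' * (G y)⁻¹) k l = ∑ a, ∑ c, (G y)⁻¹ k a * G' a c * (G y)⁻¹ c l := by
    simp only [Matrix.mul_apply, Finset.sum_mul]
    exact Finset.sum_comm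
  have hw : ∀ k, ∑ a, (G y)⁻¹ k a * ∑ q, y q * G y q a = y k :=
    sum_inv_mul (hs y hy) (hd y hy)
  have hw' : ∀ l, ∑ c, (∑ q, y q * G y q c) * (G y)⁻¹ c l = y l := by
    intro l
    rw [← hw l]
    exact Finset.sum_congr rfl fun c _ => by rw [inv_symm (hs y hy) l c, mul_comm]
  have hw2 : ∀ a, ∑ q, y q * G y a q = ∑ q, y q * G y q a := fun a =>
    Finset.sum_congr rfl fun q _ => by rw [hs y hy]
  change A' k l = _
  rw [h2, Matrix.neg_apply, h3]
  simp only [G', Matrix.of_apply, pd_metric hG hy, hw2]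
  have h4 : ∑ a, ∑ c, (G y)⁻¹ k a * (devDeriv s G y ![p, a, c]
        - hypMetric (m + 1) y p a * (∑ q, y q * G y q c)
        - hypMetric (m + 1) y p c * ∑ q, y q * G y q a) * (G y)⁻¹ c l
      = (∑ a, ∑ c, (G y)⁻¹ k a * devDeriv s G y ![p, a, c] * (G y)⁻¹ c l)
        - (∑ a, (G y)⁻¹ k a * hypMetric (m + 1) y p a)
          * (∑ c, (∑ q, y q * G y q c) * (G y)⁻¹ c l)
        - (∑ a, (G y)⁻¹ k a * ∑ q, y q * G y q a)
          * ∑ c, hypMetric (m + 1) y p c * (G y)⁻¹ c l := by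
    rw [Finset.sum_mul_sum, Finset.sum_mul_sum]
    simp only [← Finset.sum_sub_distrib]
    exact Finset.sum_congr rfl fun a _ => Finset.sum_congr rfl fun c _ => by ring
  rw [h4, hw, hw']
  ring

theorem pd_koszul (hG : ∀ i j, ContDiffOn ℝ ∞ (fun z => G z i j) (modelEnd s r₀))
    (hy : y ∈ modelEnd s r₀) (p i l j : Fin (m + 1)) :
    pd (halfSpace s) (koszul s G i l j) p y
      = koszulDeriv s G p i l j y - hypMetric (m + 1) y p i * (∑ q, y q * koszul s G q l j y)
        - hypMetric (m + 1) y p l * (∑ q, y q * koszul s G i q j y)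
        - hypMetric (m + 1) y p j * (∑ q, y q * koszul s G i l q y) := by
  have hS := uniqueDiffOn_halfSpace s y hy.1
  have d : ∀ I, DifferentiableWithinAt ℝ (fun z => devDeriv s G z I) (halfSpace s) y := fun I =>
    differentiableWithinAt_halfSpace (contDiffOn_covDeriv (contDiffOn_deviation hG) I) hy
  rw [show koszul s G i l j = fun z => devDeriv s G z ![i, j, l] + devDeriv s G z ![j, i, l]
    - devDeriv s G z ![l, i, j] from rfl, pd_sub hS ((d _).fun_add (d _)) (d _),
    pd_add hS (d _) (d _), koszulDeriv]
  simp only [devDerivTwo, covDeriv_three hy.1, koszul, mul_add, mul_sub, Finset.sum_add_distrib,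
    Finset.sum_sub_distrib]
  ring

/-- The covariant derivative of `connDiff` with respect to `b`. -/
noncomputable def connDiffDeriv (s : ℝ) (G : MetricField (m + 1)) (p k i j : Fin (m + 1))
    (y : E (m + 1)) : ℝ :=
  1 / 2 * ((∑ l, (G y)⁻¹ k l * koszulDeriv s G p i l j y)
    - ∑ l, (∑ a, ∑ c, (G y)⁻¹ k a * devDeriv s G y ![p, a, c] * (G y)⁻¹ c l) * koszul s G i l j y)

/-- `∂ₚ Cᵏᵢⱼ` in terms of the covariant derivative with respect to `b`. -/
theorem pd_connDiff (hG : ∀ i j, ContDiffOn ℝ ∞ (fun z => G z i j) (modelEnd s r₀))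
    (hs : ∀ z ∈ modelEnd s r₀, ∀ i j, G z i j = G z j i)
    (hd : ∀ z ∈ modelEnd s r₀, IsUnit (G z).det) (hy : y ∈ modelEnd s r₀)
    (p k i j : Fin (m + 1)) :
    pd (halfSpace s) (connDiff s G k i j) p y
      = connDiffDeriv s G p k i j y + y k * (∑ q, hypMetric (m + 1) y p q * connDiff s G q i j y)
        - hypMetric (m + 1) y p i * (∑ q, y q * connDiff s G k q j y)
        - hypMetric (m + 1) y p j * (∑ q, y q * connDiff s G k i q y) := by
  have hS := uniqueDiffOn_halfSpace s y hy.1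
  have dA := fun i j => differentiableWithinAt_halfSpace (contDiffOn_inv hG hd i j) hy
  have dS := fun i l j => differentiableWithinAt_halfSpace (contDiffOn_koszul hG i l j) hy
  rw [show connDiff s G k i j = fun z => 1 / 2 * ∑ l, (G z)⁻¹ k l * koszul s G i l j z from rfl,
    pd_const_mul hS _ (DifferentiableWithinAt.fun_sum fun l _ => (dA k l).fun_mul (dS i l j)),
    pd_sum hS _ fun l _ => (dA k l).fun_mul (dS i l j)]
  simp only [pd_mul hS (dA _ _) (dS _ _ _), pd_inv hG hs hd hy, pd_koszul hG hy, connDiff,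
    connDiffDeriv]
  have h1 : ∑ q, y q * (1 / 2 * ∑ l, (G y)⁻¹ k l * koszul s G q l j y)
      = 1 / 2 * ∑ l, (G y)⁻¹ k l * ∑ q, y q * koszul s G q l j y := by
    simp only [Finset.mul_sum]
    rw [Finset.sum_comm]
    exact Finset.sum_congr rfl fun _ _ => Finset.sum_congr rfl fun _ _ => by ring
  have h2 : ∑ q, y q * (1 / 2 * ∑ l, (G y)⁻¹ k l * koszul s G i l q y)
      = 1 / 2 * ∑ l, (G y)⁻¹ k l * ∑ q, y q * koszul s G i l q y := by
    simp only [Finset.mul_sum]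
    rw [Finset.sum_comm]
    exact Finset.sum_congr rfl fun _ _ => Finset.sum_congr rfl fun _ _ => by ring
  have h3 : ∑ q, hypMetric (m + 1) y p q * (1 / 2 * ∑ l, (G y)⁻¹ q l * koszul s G i l j y)
      = 1 / 2 * ∑ l, (∑ c, hypMetric (m + 1) y p c * (G y)⁻¹ c l) * koszul s G i l j y := by
    simp only [Finset.mul_sum, Finset.sum_mul]
    rw [Finset.sum_comm]
    exact Finset.sum_congr rfl fun _ _ => Finset.sum_congr rfl fun _ _ => by ring
  have h4 : ∑ l, (∑ a, (G y)⁻¹ k a * hypMetric (m + 1) y p a) * y l * koszul s G i l j y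
      = ∑ l, (G y)⁻¹ k l * (hypMetric (m + 1) y p l * ∑ q, y q * koszul s G i q j y) := by
    simp only [mul_assoc]
    rw [← Finset.mul_sum, Finset.sum_mul]
    exact Finset.sum_congr rfl fun _ _ => by ring
  have h5 : ∀ (c : ℝ) (f : Fin (m + 1) → ℝ),
      ∑ l, (G y)⁻¹ k l * (c * f l) = c * ∑ l, (G y)⁻¹ k l * f l := by
    intro c f; rw [Finset.mul_sum]; exact Finset.sum_congr rfl fun _ _ => by ring
  simp only [add_mul, neg_mul, mul_sub, Finset.sum_add_distrib, Finset.sum_sub_distrib,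
    Finset.sum_neg_distrib, h4, h5, h1, h2, h3]
  have h6 : ∑ l, y k * (∑ c, hypMetric (m + 1) y p c * (G y)⁻¹ c l) * koszul s G i l j y
      = y k * ∑ l, (∑ c, hypMetric (m + 1) y p c * (G y)⁻¹ c l) * koszul s G i l j y := by
    rw [Finset.mul_sum]; simp only [mul_assoc]
  rw [h6]
  ring

end ConnectionDifference

/-! ### Scalar curvature in terms of the deviation from the hyperbolic metric -/

section ScalarCurvature

variable {m : ℕ} {s r₀ : ℝ} {y : E (m + 1)} {G : MetricField (m + 1)}

/-- `Ric_G - Ric_b = ∇ᵢCⁱⱼₖ - ∇ⱼCⁱᵢₖ + C * C`, with covariant derivatives taken with respect to `b`. -/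
theorem ricci_eq (hG : ∀ i j, ContDiffOn ℝ ∞ (fun z => G z i j) (modelEnd s r₀))
    (hs : ∀ z ∈ modelEnd s r₀, ∀ i j, G z i j = G z j i)
    (hd : ∀ z ∈ modelEnd s r₀, IsUnit (G z).det) (hy : y ∈ modelEnd s r₀) (j k : Fin (m + 1)) :
    ricci (halfSpace s) G j k y = -(m : ℝ) * hypMetric (m + 1) y j k
      + ∑ i, (connDiffDeriv s G i i j k y - connDiffDeriv s G j i i k y
        + ∑ l, (connDiff s G i i l y * connDiff s G l j k y
          - connDiff s G i j l y * connDiff s G l i k y)) := by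
  have hS := uniqueDiffOn_halfSpace s y hy.1
  have dC : ∀ k i j, DifferentiableWithinAt ℝ (connDiff s G k i j) (halfSpace s) y := fun k i j =>
    ((DifferentiableWithinAt.fun_sum fun l _ =>
      (differentiableWithinAt_halfSpace (contDiffOn_inv hG hd k l) hy).fun_mul
      (differentiableWithinAt_halfSpace (contDiffOn_koszul hG i l j) hy)).const_mul (1 / 2))
  have dΓ : ∀ k i j : Fin (m + 1), DifferentiableWithinAt ℝ
      (fun z : E (m + 1) => - z k * hypMetric (m + 1) z i j) (halfSpace s) y := fun k i j =>
    ((differentiableWithinAt_coord k).fun_neg).fun_mul (differentiableWithinAt_hypMetric i j)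
  have h1 : ∀ p k i j, pd (halfSpace s) (christoffel (halfSpace s) G k i j) p y
      = pd (halfSpace s) (christoffel (halfSpace s) (hypMetric (m + 1)) k i j) p y
        + pd (halfSpace s) (connDiff s G k i j) p y := by
    intro p k i j
    rw [pd_congr_modelEnd (fun z hz => christoffel_eq hG hs hd hz k i j) hy,
      pd_congr_modelEnd (r₀ := r₀) (fun z hz => christoffel_hypMetric hz.1 k i j) hy,
      pd_add hS (dΓ k i j) (dC k i j)]
  rw [← ricci_hypMetric hy.1, ricci, ricci, ← Finset.sum_add_distrib]
  refine Finset.sum_congr rfl fun i _ => ?_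
  simp only [h1, christoffel_eq hG hs hd hy, christoffel_hypMetric hy.1, pd_connDiff hG hs hd hy]
  rw [hypMetric_symm y j i]
  have h2 : ∑ l, ((-y i * hypMetric (m + 1) y i l + connDiff s G i i l y)
        * (-y l * hypMetric (m + 1) y j k + connDiff s G l j k y)
        - (-y i * hypMetric (m + 1) y j l + connDiff s G i j l y)
        * (-y l * hypMetric (m + 1) y i k + connDiff s G l i k y))
      = (∑ l, (-y i * hypMetric (m + 1) y i l * (-y l * hypMetric (m + 1) y j k)
        - -y i * hypMetric (m + 1) y j l * (-y l * hypMetric (m + 1) y i k)))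
        - y i * (∑ l, hypMetric (m + 1) y i l * connDiff s G l j k y)
        - hypMetric (m + 1) y j k * (∑ l, y l * connDiff s G i i l y)
        + y i * (∑ l, hypMetric (m + 1) y j l * connDiff s G l i k y)
        + hypMetric (m + 1) y i k * (∑ l, y l * connDiff s G i j l y)
        + ∑ l, (connDiff s G i i l y * connDiff s G l j k y
          - connDiff s G i j l y * connDiff s G l i k y) := by
    simp only [Finset.mul_sum, ← Finset.sum_sub_distrib, ← Finset.sum_add_distrib]
    exact Finset.sum_congr rfl fun l _ => by ring
  rw [h2]
  ring

theorem comp_vecCons {α β : Type*} {k : ℕ} (f : α → β) (a : α) (g : Fin k → α) :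
    f ∘ Matrix.vecCons a g = Matrix.vecCons (f a) (f ∘ g) := by
  funext x
  refine Fin.cases rfl (fun _ => rfl) x

theorem comp_vecEmpty {α β : Type*} (f : α → β) : f ∘ (![] : Fin 0 → α) = ![] :=
  Subsingleton.elim _ _

/-- Permuting the slots of a tensor permutes its frame components. -/
theorem frameTensor_comp {n k : ℕ} (P : Matrix (Fin n) (Fin n) ℝ) {σ : Fin k → Fin k}
    (hσ : Function.Bijective σ) (T : (Fin k → Fin n) → ℝ) (K : Fin k → Fin n) :
    frameTensor P (fun I => T (I ∘ σ)) K = frameTensor P T (K ∘ σ) := by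
  have h : ∀ I : Fin k → Fin n, ∏ a, P (I a) (K a) = ∏ a, P ((I ∘ σ) a) ((K ∘ σ) a) := fun I =>
    (hσ.prod_comp fun a => P (I a) (K a)).symm
  simp only [frameTensor, h]
  exact ((Equiv.ofBijective σ hσ).symm.arrowCongr (Equiv.refl (Fin n))).sum_comp
    fun J : Fin k → Fin n => (∏ a, P (J a) ((K ∘ σ) a)) * T J

theorem frameComp_three_perm {n : ℕ} (P : Matrix (Fin n) (Fin n) ℝ) {σ : Fin 3 → Fin 3}
    (hσ : Function.Bijective σ) (T : (Fin 3 → Fin n) → ℝ) (a b c : Fin n) :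
    frameComp P (fun i => frameComp P (fun j => frameComp P
      (fun k => T (![i, j, k] ∘ σ)) c) b) a = frameTensor P T (![a, b, c] ∘ σ) := by
  rw [← frameTensor_comp P hσ, frameTensor_three]

theorem frameComp_four_perm {n : ℕ} (P : Matrix (Fin n) (Fin n) ℝ) {σ : Fin 4 → Fin 4}
    (hσ : Function.Bijective σ) (T : (Fin 4 → Fin n) → ℝ) (a b c d : Fin n) :
    frameComp P (fun i => frameComp P (fun j => frameComp P (fun k => frameComp P
      (fun l => T (![i, j, k, l] ∘ σ)) d) c) b) a = frameTensor P T (![a, b, c, d] ∘ σ) := by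
  rw [← frameTensor_comp P hσ, frameTensor_four]

/-- The Gram matrix of `G` in the `b`-orthonormal frame. -/
noncomputable def gram (G : MetricField (m + 1)) (y : E (m + 1)) :
    Matrix (Fin (m + 1)) (Fin (m + 1)) ℝ :=
  1 + Matrix.of fun a b => frameTensor (frame y) (deviation G y) ![a, b]

theorem frame_mul_mul_frame : frame y * G y * frame y = gram G y := by
  have h : G y = hypMetric (m + 1) y + Matrix.of fun i j => deviation G y ![i, j] := by
    ext i j
    simp [deviation_apply]
  rw [h, mul_add, add_mul, frame_mul_hypMetric_mul_frame, gram]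
  congr 1
  ext a b
  rw [mul_mul_apply_eq_frameComp _ (frame_symm y), Matrix.of_apply, frameTensor_two]
  rfl

theorem det_gram : (gram G y).det = height y ^ 2 * (G y).det := by
  rw [← frame_mul_mul_frame, Matrix.det_mul, Matrix.det_mul, det_frame]; ring

theorem inv_eq_frame_mul_mul_frame : (G y)⁻¹ = frame y * (gram G y)⁻¹ * frame y := by
  have hd : IsUnit (frame y).det := by
    rw [det_frame]; exact (height_pos y).ne'.isUnit
  rw [← frame_mul_mul_frame, Matrix.mul_inv_rev, Matrix.mul_inv_rev, ← mul_assoc, ← mul_assoc,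
    Matrix.mul_nonsing_inv _ hd, one_mul, mul_assoc, Matrix.nonsing_inv_mul _ hd, mul_one]

/-- Contraction with `G⁻¹` in frame components. -/
theorem sum_inv_mul_eq_sum_gram (G : MetricField (m + 1)) (y : E (m + 1))
    (F : Fin (m + 1) → Fin (m + 1) → ℝ) :
    ∑ i, ∑ j, (G y)⁻¹ i j * F i j = ∑ a, ∑ b, (gram G y)⁻¹ a b *
      frameComp (frame y) (fun i => frameComp (frame y) (fun j => F i j) b) a := by
  rw [inv_eq_frame_mul_mul_frame]
  simp only [frameComp, Matrix.mul_apply, Finset.sum_mul, Finset.mul_sum]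
  calc _ = ∑ x : Fin (m + 1) × Fin (m + 1) × Fin (m + 1) × Fin (m + 1),
        frame y x.1 x.2.2.2 * (gram G y)⁻¹ x.2.2.2 x.2.2.1 * frame y x.2.2.1 x.2.1 * F x.1 x.2.1 := by
        simp only [Fintype.sum_prod_type]
    _ = ∑ x : Fin (m + 1) × Fin (m + 1) × Fin (m + 1) × Fin (m + 1),
        (gram G y)⁻¹ x.1 x.2.1 * (frame y x.2.2.1 x.1 * (frame y x.2.2.2 x.2.1 * F x.2.2.1 x.2.2.2)) := by
        refine Fintype.sum_bijective (fun x => (x.2.2.2, x.2.2.1, x.1, x.2.1))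
          ⟨fun a b h => ?_, fun x => ⟨(x.2.2.1, x.2.2.2, x.2.1, x.1), rfl⟩⟩ _ _ fun x => ?_
        · simp only [Prod.mk.injEq] at h
          ext <;> simp [h]
        · simp only
          rw [frame_symm y x.2.2.1 x.2.1]; ring
    _ = _ := by simp only [Fintype.sum_prod_type]

/-- The part of the scalar curvature that is quadratic in first derivatives of `G - b`. -/
noncomputable def curvQuadratic (s : ℝ) (G : MetricField (m + 1)) (y : E (m + 1)) : ℝ :=
  ∑ j, ∑ k, (G y)⁻¹ j k * ∑ i, ∑ a, (G y)⁻¹ i a * ∑ l, ∑ c, (G y)⁻¹ l c *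
    (1 / 4 * (koszul s G i a l y * koszul s G j c k y)
      - 1 / 4 * (koszul s G j a l y * koszul s G i c k y)
      - 1 / 2 * (devDeriv s G y ![i, a, c] * koszul s G j l k y)
      + 1 / 2 * (devDeriv s G y ![j, a, c] * koszul s G i l k y))

/-- Exact expansion of the scalar curvature: a trace, a part linear in `∇_b² e`, and a part quadratic
in `∇_b e`, each contracted with `G⁻¹`. -/
theorem scalarCurvature_eq (hG : ∀ i j, ContDiffOn ℝ ∞ (fun z => G z i j) (modelEnd s r₀))
    (hs : ∀ z ∈ modelEnd s r₀, ∀ i j, G z i j = G z j i)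
    (hd : ∀ z ∈ modelEnd s r₀, IsUnit (G z).det) (hy : y ∈ modelEnd s r₀) :
    scalarCurvature (halfSpace s) G y
      = -(m : ℝ) * (∑ j, ∑ k, (G y)⁻¹ j k * hypMetric (m + 1) y j k)
        + (∑ j, ∑ k, (G y)⁻¹ j k * ∑ i, ∑ l, (G y)⁻¹ i l *
          (1 / 2 * (koszulDeriv s G i j l k y - koszulDeriv s G j i l k y)))
        + curvQuadratic s G y := by
  rw [scalarCurvature, curvQuadratic, Finset.mul_sum, ← Finset.sum_add_distrib,
    ← Finset.sum_add_distrib]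
  refine Finset.sum_congr rfl fun j _ => ?_
  rw [Finset.mul_sum, ← Finset.sum_add_distrib, ← Finset.sum_add_distrib]
  refine Finset.sum_congr rfl fun k _ => ?_
  rw [ricci_eq hG hs hd hy, mul_left_comm (-(m : ℝ)), ← mul_add, ← mul_add]
  congr 1
  rw [add_assoc]
  congr 1
  rw [← Finset.sum_add_distrib]
  refine Finset.sum_congr rfl fun i _ => ?_
  have hsym := inv_symm (hs y hy)
  have e1 : ∀ p r t, ∑ l, (∑ a, ∑ c, (G y)⁻¹ i a * devDeriv s G y ![p, a, c] * (G y)⁻¹ c l)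
        * koszul s G r l t y
      = ∑ a, (G y)⁻¹ i a * ∑ l, ∑ c, (G y)⁻¹ l c * (devDeriv s G y ![p, a, c] * koszul s G r l t y) := by
    intro p r t
    simp only [Finset.mul_sum, Finset.sum_mul]
    rw [Finset.sum_comm]
    refine Finset.sum_congr rfl fun a _ => Finset.sum_congr rfl fun l _ =>
      Finset.sum_congr rfl fun c _ => ?_
    rw [hsym c l]; ring
  have e2 : ∀ p r t, ∑ l, connDiff s G i p l y * connDiff s G l r t y
      = 1 / 4 * ∑ a, (G y)⁻¹ i a * ∑ l, ∑ c, (G y)⁻¹ l c * (koszul s G p a l y * koszul s G r c t y) := by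
    intro p r t
    simp only [connDiff, Finset.mul_sum, Finset.sum_mul]
    refine (Finset.sum_congr rfl fun l _ => Finset.sum_comm).trans ?_
    rw [Finset.sum_comm]
    refine Finset.sum_congr rfl fun a _ => Finset.sum_congr rfl fun l _ =>
      Finset.sum_congr rfl fun c _ => ?_
    ring
  rw [Finset.sum_sub_distrib, e2 i j k, e2 j i k]
  simp only [connDiffDeriv, e1]
  simp only [mul_sub, mul_add, Finset.sum_sub_distrib, Finset.sum_add_distrib]
  have e3 : ∀ (u : ℝ) (f : Fin (m + 1) → ℝ),
      ∑ l, (G y)⁻¹ i l * (u * f l) = u * ∑ l, (G y)⁻¹ i l * f l := by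
    intro u f; rw [Finset.mul_sum]; exact Finset.sum_congr rfl fun _ _ => by ring
  have e4 : ∀ (u : ℝ) (f : Fin (m + 1) → Fin (m + 1) → ℝ),
      ∑ l, ∑ c, (G y)⁻¹ l c * (u * f l c) = u * ∑ l, ∑ c, (G y)⁻¹ l c * f l c := by
    intro u f; simp only [Finset.mul_sum, mul_left_comm]
  simp only [e4, e3]
  ring

theorem sum_inv_mul_hypMetric :
    ∑ j, ∑ k, (G y)⁻¹ j k * hypMetric (m + 1) y j k = ∑ a, (gram G y)⁻¹ a a := by
  refine (sum_inv_mul_eq_sum_gram G y fun i j => hypMetric (m + 1) y i j).trans ?_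
  simp only [← mul_mul_apply_eq_frameComp _ (frame_symm y), frame_mul_hypMetric_mul_frame,
    Matrix.one_apply, mul_ite, mul_one, mul_zero, Finset.sum_ite_eq, Finset.mem_univ, if_true]

/-- The frame components of `½ (∇ᵢSⱼₗₖ - ∇ⱼSᵢₗₖ)`, in the order `j, k, i, l`. -/
noncomputable def curvLinear (s : ℝ) (G : MetricField (m + 1)) (c d a b : Fin (m + 1))
    (y : E (m + 1)) : ℝ :=
  1 / 2 * (frameTensor (frame y) (devDerivTwo s G y) ![a, c, d, b]
    + frameTensor (frame y) (devDerivTwo s G y) ![a, d, c, b]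
    - frameTensor (frame y) (devDerivTwo s G y) ![a, b, c, d]
    - frameTensor (frame y) (devDerivTwo s G y) ![c, a, d, b]
    - frameTensor (frame y) (devDerivTwo s G y) ![c, d, a, b]
    + frameTensor (frame y) (devDerivTwo s G y) ![c, b, a, d])

theorem sum_inv_mul_koszulDeriv :
    ∑ j, ∑ k, (G y)⁻¹ j k * ∑ i, ∑ l, (G y)⁻¹ i l *
        (1 / 2 * (koszulDeriv s G i j l k y - koszulDeriv s G j i l k y))
      = ∑ c, ∑ d, (gram G y)⁻¹ c d * ∑ a, ∑ b, (gram G y)⁻¹ a b * curvLinear s G c d a b y := by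
  simp only [sum_inv_mul_eq_sum_gram G y, frameComp_sum, frameComp_mul_left]
  refine Finset.sum_congr rfl fun c _ => Finset.sum_congr rfl fun d _ => ?_
  congr 1
  refine Finset.sum_congr rfl fun a _ => Finset.sum_congr rfl fun b _ => ?_
  congr 1
  simp only [koszulDeriv, frameComp_sub, frameComp_add, curvLinear]
  have h := fun (σ : Fin 4 → Fin 4) (hσ : Function.Bijective σ) =>
    frameComp_four_perm (frame y) hσ (devDerivTwo s G y) c d a b
  have h1 := h ![2, 0, 1, 3] (by decide)
  have h2 := h ![2, 1, 0, 3] (by decide)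
  have h3 := h ![2, 3, 0, 1] (by decide)
  have h4 := h ![0, 2, 1, 3] (by decide)
  have h5 := h ![0, 1, 2, 3] (by decide)
  have h6 := h ![0, 3, 2, 1] (by decide)
  simp [comp_vecCons, comp_vecEmpty] at h1 h2 h3 h4 h5 h6
  rw [h1, h2, h3, h4, h5, h6]
  ring

end ScalarCurvature

/-! ### Asymptotics of the metric at infinity -/

section Asymptotics

variable {m : ℕ} {s r₀ : ℝ} {G : MetricField (m + 1)} {ρ : E (m + 1) → ℝ}

/-- The filter `r → ∞` on `{y₀ ≤ s}`. -/
noncomputable def atInfinity (m : ℕ) (s : ℝ) : Filter (E (m + 1)) := comap norm atTop ⊓ 𝓟 (halfSpace s)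

theorem eventually_atInfinity {p : E (m + 1) → Prop} :
    (∀ᶠ y in atInfinity m s, p y) ↔ ∃ R, ∀ y ∈ modelEnd s R, p y := by
  rw [atInfinity, eventually_inf_principal, eventually_comap, eventually_atTop]
  constructor
  · rintro ⟨R, h⟩
    exact ⟨R, fun y hy => h ‖y‖ hy.2.le y rfl hy.1⟩
  · rintro ⟨R, h⟩
    refine ⟨R + 1, fun b hb y hyb hy => h y ⟨hy, ?_⟩⟩
    rw [hyb]; linarith

theorem eventually_mem_modelEnd (s R : ℝ) : ∀ᶠ y in atInfinity m s, y ∈ modelEnd s R :=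
  eventually_atInfinity.2 ⟨R, fun _ h => h⟩

theorem isBigO_frameTensor {k : ℕ} {T : TensorField (m + 1) k}
    (hT : tensorNorm (hypMetric (m + 1)) T =O[atInfinity m s] ρ) (K : Fin k → Fin (m + 1)) :
    (fun y => frameTensor (frame y) (T y) K) =O[atInfinity m s] ρ :=
  (Asymptotics.IsBigO.of_bound 1 (Eventually.of_forall fun y => by
    rw [one_mul, Real.norm_eq_abs]
    exact (abs_frameTensor_le T y K).trans (le_abs_self _))).trans hT

theorem tendsto_gram (hρ : Tendsto ρ (atInfinity m s) (𝓝 0))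
    (he : tensorNorm (hypMetric (m + 1)) (deviation G) =O[atInfinity m s] ρ) :
    Tendsto (gram G) (atInfinity m s) (𝓝 1) := by
  have h : Tendsto (fun y => (Matrix.of fun a b => frameTensor (frame y) (deviation G y) ![a, b] :
      Matrix (Fin (m + 1)) (Fin (m + 1)) ℝ)) (atInfinity m s) (𝓝 0) :=
    tendsto_pi_nhds.2 fun a => tendsto_pi_nhds.2 fun b =>
      (isBigO_frameTensor he ![a, b]).trans_tendsto hρ
  have h2 := h.const_add (1 : Matrix (Fin (m + 1)) (Fin (m + 1)) ℝ)
  rw [add_zero] at h2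
  exact h2

theorem tendsto_det_gram (hρ : Tendsto ρ (atInfinity m s) (𝓝 0))
    (he : tensorNorm (hypMetric (m + 1)) (deviation G) =O[atInfinity m s] ρ) :
    Tendsto (fun y => (gram G y).det) (atInfinity m s) (𝓝 1) := by
  have h := (Continuous.matrix_det (continuous_id (X := Matrix (Fin (m + 1)) (Fin (m + 1)) ℝ))).tendsto 1
  rw [id, Matrix.det_one] at h
  exact h.comp (tendsto_gram hρ he)

theorem exists_isUnit_det (hρ : Tendsto ρ (atInfinity m s) (𝓝 0))
    (he : tensorNorm (hypMetric (m + 1)) (deviation G) =O[atInfinity m s] ρ) :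
    ∃ R, ∀ y ∈ modelEnd s R, IsUnit (G y).det := by
  refine eventually_atInfinity.1 ?_
  filter_upwards [(tendsto_det_gram hρ he).eventually_ne one_ne_zero] with y hy
  rw [det_gram] at hy
  exact (right_ne_zero_of_mul hy).isUnit

theorem tendsto_gram_inv (hρ : Tendsto ρ (atInfinity m s) (𝓝 0))
    (he : tensorNorm (hypMetric (m + 1)) (deviation G) =O[atInfinity m s] ρ) :
    Tendsto (fun y => (gram G y)⁻¹) (atInfinity m s) (𝓝 1) := by
  have h1 := (tendsto_det_gram hρ he).inv₀ one_ne_zero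
  have h2 := ((Continuous.matrix_adjugate
    (continuous_id (X := Matrix (Fin (m + 1)) (Fin (m + 1)) ℝ))).tendsto 1).comp (tendsto_gram hρ he)
  have h3 := h1.smul h2
  simp only [inv_one, id, Matrix.adjugate_one, one_smul] at h3
  refine h3.congr fun y => ?_
  rw [Matrix.inv_def, Ring.inverse_eq_inv']
  rfl

theorem isBigO_gram_inv (hρ : Tendsto ρ (atInfinity m s) (𝓝 0))
    (he : tensorNorm (hypMetric (m + 1)) (deviation G) =O[atInfinity m s] ρ) (a b : Fin (m + 1)) :
    (fun y => (gram G y)⁻¹ a b) =O[atInfinity m s] fun _ => (1 : ℝ) :=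
  ((tendsto_pi_nhds.1 (tendsto_pi_nhds.1 (tendsto_gram_inv hρ he) a)) b).isBigO_one ℝ

/-- `(1 + ε)⁻¹ - 1 = -(1 + ε)⁻¹ ε`. -/
theorem eventually_gram_inv_eq (hρ : Tendsto ρ (atInfinity m s) (𝓝 0))
    (he : tensorNorm (hypMetric (m + 1)) (deviation G) =O[atInfinity m s] ρ) (a b : Fin (m + 1)) :
    ∀ᶠ y in atInfinity m s, (gram G y)⁻¹ a b - (1 : Matrix (Fin (m + 1)) (Fin (m + 1)) ℝ) a b
      = -∑ c, (gram G y)⁻¹ a c * frameTensor (frame y) (deviation G y) ![c, b] := by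
  filter_upwards [(tendsto_det_gram hρ he).eventually_ne one_ne_zero] with y hy
  have h : (gram G y)⁻¹ * gram G y = 1 := Matrix.nonsing_inv_mul _ hy.isUnit
  have h2 := congrFun (congrFun h a) b
  rw [gram, mul_add, mul_one, ← gram] at h2
  rw [← h2, Matrix.add_apply, Matrix.mul_apply]
  simp

theorem isBigO_gram_inv_sub_one (hρ : Tendsto ρ (atInfinity m s) (𝓝 0))
    (he : tensorNorm (hypMetric (m + 1)) (deviation G) =O[atInfinity m s] ρ) (a b : Fin (m + 1)) :
    (fun y => (gram G y)⁻¹ a b - (1 : Matrix (Fin (m + 1)) (Fin (m + 1)) ℝ) a b)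
      =O[atInfinity m s] ρ := by
  refine Asymptotics.IsBigO.congr' ?_ ((eventually_gram_inv_eq hρ he a b).mono fun y h => h.symm)
    EventuallyEq.rfl
  refine (Asymptotics.IsBigO.fun_sum fun c _ => ?_).neg_left
  simpa using (isBigO_gram_inv hρ he a c).mul (isBigO_frameTensor he ![c, b])

/-- `(1 + ε)⁻¹ = 1 - ε + O(ε²)`. -/
theorem isBigO_gram_inv_sub_one_add (hρ : Tendsto ρ (atInfinity m s) (𝓝 0))
    (he : tensorNorm (hypMetric (m + 1)) (deviation G) =O[atInfinity m s] ρ) (a b : Fin (m + 1)) :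
    (fun y => (gram G y)⁻¹ a b - (1 : Matrix (Fin (m + 1)) (Fin (m + 1)) ℝ) a b
      + frameTensor (frame y) (deviation G y) ![a, b]) =O[atInfinity m s] fun y => ρ y * ρ y := by
  have h : ∀ᶠ y in atInfinity m s,
      -∑ c, ((gram G y)⁻¹ a c - (1 : Matrix (Fin (m + 1)) (Fin (m + 1)) ℝ) a c) *
        frameTensor (frame y) (deviation G y) ![c, b]
      = (gram G y)⁻¹ a b - (1 : Matrix (Fin (m + 1)) (Fin (m + 1)) ℝ) a b
      + frameTensor (frame y) (deviation G y) ![a, b] := by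
    filter_upwards [eventually_gram_inv_eq hρ he a b] with y hy
    rw [hy]
    simp only [sub_mul, Finset.sum_sub_distrib, Matrix.one_apply, ite_mul, one_mul, zero_mul,
      Finset.sum_ite_eq, Finset.mem_univ, if_true]
    ring
  refine Asymptotics.IsBigO.congr' ?_ h EventuallyEq.rfl
  exact (Asymptotics.IsBigO.fun_sum fun c _ =>
    (isBigO_gram_inv_sub_one hρ he a c).mul (isBigO_frameTensor he ![c, b])).neg_left

/-- Frame components of `koszul`, with its slots in any order. -/
theorem isBigO_koszul (hE : tensorNorm (hypMetric (m + 1)) (devDeriv s G) =O[atInfinity m s] ρ)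
    {σ : Fin 3 → Fin 3} (hσ : Function.Bijective σ) (a b c : Fin (m + 1)) :
    (fun y => frameComp (frame y) (fun i => frameComp (frame y) (fun j => frameComp (frame y)
      (fun k => koszul s G (![i, j, k] (σ 0)) (![i, j, k] (σ 1)) (![i, j, k] (σ 2)) y) c) b) a)
      =O[atInfinity m s] ρ := by
  have h : ∀ τ : Fin 3 → Fin 3, Function.Bijective τ → (fun y => frameComp (frame y) (fun i =>
      frameComp (frame y) (fun j => frameComp (frame y)
      (fun k => devDeriv s G y (![i, j, k] ∘ (σ ∘ τ))) c) b) a) =O[atInfinity m s] ρ := by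
    intro τ hτ
    simp only [frameComp_three_perm _ (hσ.comp hτ)]
    exact isBigO_frameTensor hE _
  have h1 := h ![0, 2, 1] (by decide)
  have h2 := h ![2, 0, 1] (by decide)
  have h3 := h ![1, 0, 2] (by decide)
  simp only [comp_vecCons, comp_vecEmpty] at h1 h2 h3
  simp only [koszul, frameComp_add, frameComp_sub]
  exact (h1.add h2).sub h3

theorem isBigO_curvQuadratic (hρ : Tendsto ρ (atInfinity m s) (𝓝 0))
    (he : tensorNorm (hypMetric (m + 1)) (deviation G) =O[atInfinity m s] ρ)
    (hE : tensorNorm (hypMetric (m + 1)) (devDeriv s G) =O[atInfinity m s] ρ) :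
    curvQuadratic s G =O[atInfinity m s] fun y => ρ y * ρ y := by
  have hq := isBigO_gram_inv hρ he
  have hS := fun (σ : Fin 3 → Fin 3) (hσ : Function.Bijective σ) => isBigO_koszul hE hσ
  have hS1 := hS ![0, 1, 2] (by decide)
  have hS2 := hS ![0, 2, 1] (by decide)
  have hS3 := hS ![1, 2, 0] (by decide)
  have hE' := fun a b c => isBigO_frameTensor hE ![a, b, c]
  simp [frameTensor_three] at hS1 hS2 hS3 hE'
  unfold curvQuadratic
  simp only [sum_inv_mul_eq_sum_gram G, frameComp_sum, frameComp_mul_left, frameComp_mul_right,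
    frameComp_add, frameComp_sub]
  have hmul : ∀ {f g : E (m + 1) → ℝ}, f =O[atInfinity m s] (fun _ => (1 : ℝ)) →
      g =O[atInfinity m s] (fun y => ρ y * ρ y) →
      (fun y => f y * g y) =O[atInfinity m s] fun y => ρ y * ρ y := fun hf hg => by
    simpa using hf.mul hg
  refine Asymptotics.IsBigO.fun_sum fun j _ => Asymptotics.IsBigO.fun_sum fun k _ => hmul (hq _ _) ?_
  refine Asymptotics.IsBigO.fun_sum fun i _ => Asymptotics.IsBigO.fun_sum fun a _ => hmul (hq _ _) ?_
  refine Asymptotics.IsBigO.fun_sum fun l _ => Asymptotics.IsBigO.fun_sum fun c _ => hmul (hq _ _) ?_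
  refine (((Asymptotics.IsBigO.const_mul_left ?_ _).sub
    (Asymptotics.IsBigO.const_mul_left ?_ _)).sub
    (Asymptotics.IsBigO.const_mul_left ?_ _)).add (Asymptotics.IsBigO.const_mul_left ?_ _)
  · exact (hS1 i a l).mul (hS2 j k c)
  · exact (hS1 j a l).mul (hS3 k i c)
  · exact (hE' i a c).mul (hS2 j k l)
  · exact (hE' j a c).mul (hS3 k i l)

end Asymptotics

/-! ### First-order expansion of the scalar curvature -/

section ScalarCurvatureExpansion

variable {m : ℕ} {s r₀ : ℝ} {G : MetricField (m + 1)} {ρ : E (m + 1) → ℝ}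

theorem deviation_symm (hs : ∀ z ∈ modelEnd s r₀, ∀ i j, G z i j = G z j i) :
    ∀ z ∈ modelEnd s r₀, ∀ i j, deviation G z ![i, j] = deviation G z ![j, i] := fun z hz i j => by
  rw [deviation_apply, deviation_apply, hs z hz, hypMetric_symm]

theorem modelEnd_mono {R R' : ℝ} (h : R ≤ R') :
    (modelEnd s R' : Set (E (m + 1))) ⊆ modelEnd s R := fun _ hy => ⟨hy.1, h.trans_lt hy.2⟩

/-- The linearization at `b` of the scalar curvature, applied to `e = G - b`:
`div div e - Δ tr e + (n - 1) tr e`. -/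
noncomputable def scalarLinear (s : ℝ) (G : MetricField (m + 1)) (y : E (m + 1)) : ℝ :=
  (∑ a, ∑ b, frameTensor (frame y) (devDerivTwo s G y) ![a, b, b, a])
    - (∑ a, ∑ b, frameTensor (frame y) (devDerivTwo s G y) ![a, a, b, b])
    + m * ∑ a, frameTensor (frame y) (deviation G y) ![a, a]

theorem sum_curvLinear (hs : ∀ z ∈ modelEnd s r₀, ∀ i j, G z i j = G z j i)
    {y : E (m + 1)} (hy : y ∈ modelEnd s r₀) :
    ∑ c, ∑ a, curvLinear s G c c a a y
      = (∑ a, ∑ b, frameTensor (frame y) (devDerivTwo s G y) ![a, b, b, a])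
        - ∑ a, ∑ b, frameTensor (frame y) (devDerivTwo s G y) ![a, a, b, b] := by
  have h1 : ∀ c a, frameTensor (frame y) (devDerivTwo s G y) ![c, a, c, a]
      = frameTensor (frame y) (devDerivTwo s G y) ![c, a, a, c] := by
    intro c a
    rw [frameTensor_four, frameTensor_four]
    congr 1; funext i
    congr 1; funext j
    rw [frameComp_comm]
    congr 1; funext k; congr 1; funext l
    exact covDeriv_covDeriv_symm hy (deviation_symm hs) i j l k
  have h2 : ∑ c, ∑ a, frameTensor (frame y) (devDerivTwo s G y) ![c, a, c, a]
      = ∑ c, ∑ a, frameTensor (frame y) (devDerivTwo s G y) ![c, a, a, c] :=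
    Finset.sum_congr rfl fun c _ => Finset.sum_congr rfl fun a _ => h1 c a
  simp only [curvLinear, ← Finset.mul_sum, Finset.sum_add_distrib, Finset.sum_sub_distrib]
  rw [Finset.sum_comm (f := fun c a => frameTensor (frame y) (devDerivTwo s G y) ![a, c, c, a]),
    Finset.sum_comm (f := fun c a => frameTensor (frame y) (devDerivTwo s G y) ![a, a, c, c]), h2]
  ring

/-- The scalar curvature of `G` is `-n(n-1)` plus its linearization plus a quadratic remainder. -/
theorem isBigO_scalarCurvature (hG : ∀ i j, ContDiffOn ℝ ∞ (fun z => G z i j) (modelEnd s r₀))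
    (hs : ∀ z ∈ modelEnd s r₀, ∀ i j, G z i j = G z j i)
    (hρ : Tendsto ρ (atInfinity m s) (𝓝 0))
    (he : tensorNorm (hypMetric (m + 1)) (deviation G) =O[atInfinity m s] ρ)
    (hE : tensorNorm (hypMetric (m + 1)) (devDeriv s G) =O[atInfinity m s] ρ)
    (hN : tensorNorm (hypMetric (m + 1)) (devDerivTwo s G) =O[atInfinity m s] ρ) :
    (fun y => scalarCurvature (halfSpace s) G y + ((m : ℝ) + 1) * m - scalarLinear s G y)
      =O[atInfinity m s] fun y => ρ y * ρ y := by
  obtain ⟨R, hR⟩ := exists_isUnit_det hρ he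
  have hL : ∀ c d a b, curvLinear s G c d a b =O[atInfinity m s] ρ := by
    intro c d a b
    have h := fun K => isBigO_frameTensor hN K
    exact ((((((h ![a, c, d, b]).add (h ![a, d, c, b])).sub (h ![a, b, c, d])).sub
      (h ![c, a, d, b])).sub (h ![c, d, a, b])).add (h ![c, b, a, d])).const_mul_left _
  have h1 : (fun y => -(m : ℝ) * ∑ a, ((gram G y)⁻¹ a a
      - (1 : Matrix (Fin (m + 1)) (Fin (m + 1)) ℝ) a a
      + frameTensor (frame y) (deviation G y) ![a, a])) =O[atInfinity m s] fun y => ρ y * ρ y :=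
    (Asymptotics.IsBigO.fun_sum fun a _ => isBigO_gram_inv_sub_one_add hρ he a a).const_mul_left _
  have h2 : (fun y => ∑ c, ∑ d, ∑ a, ∑ b,
      (((gram G y)⁻¹ c d - (1 : Matrix (Fin (m + 1)) (Fin (m + 1)) ℝ) c d) * (gram G y)⁻¹ a b
        + (1 : Matrix (Fin (m + 1)) (Fin (m + 1)) ℝ) c d * ((gram G y)⁻¹ a b
          - (1 : Matrix (Fin (m + 1)) (Fin (m + 1)) ℝ) a b)) * curvLinear s G c d a b y)
      =O[atInfinity m s] fun y => ρ y * ρ y := by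
    refine Asymptotics.IsBigO.fun_sum fun c _ => Asymptotics.IsBigO.fun_sum fun d _ =>
      Asymptotics.IsBigO.fun_sum fun a _ => Asymptotics.IsBigO.fun_sum fun b _ =>
      Asymptotics.IsBigO.mul (Asymptotics.IsBigO.add ?_ ?_) (hL c d a b)
    · simpa using (isBigO_gram_inv_sub_one hρ he c d).mul (isBigO_gram_inv hρ he a b)
    · exact (isBigO_gram_inv_sub_one hρ he a b).const_mul_left _
  refine ((h1.add h2).add (isBigO_curvQuadratic hρ he hE)).congr' ?_ EventuallyEq.rfl
  filter_upwards [eventually_mem_modelEnd s (max r₀ R)] with y hy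
  have hr : (modelEnd s (max r₀ R) : Set (E (m + 1))) ⊆ modelEnd s r₀ := modelEnd_mono (le_max_left _ _)
  rw [scalarCurvature_eq (fun i j => (hG i j).mono hr) (fun z hz => hs z (hr hz))
    (fun z hz => hR z (modelEnd_mono (le_max_right _ _) hz)) hy, sum_inv_mul_hypMetric,
    sum_inv_mul_koszulDeriv, scalarLinear, ← sum_curvLinear hs (hr hy)]
  have h3 : ∑ c, ∑ a, curvLinear s G c c a a y = ∑ c, ∑ d, ∑ a, ∑ b,
      (1 : Matrix (Fin (m + 1)) (Fin (m + 1)) ℝ) c d *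
        (1 : Matrix (Fin (m + 1)) (Fin (m + 1)) ℝ) a b * curvLinear s G c d a b y := by
    simp [Matrix.one_apply]
  have h4 : ∑ c, ∑ d, (gram G y)⁻¹ c d * ∑ a, ∑ b, (gram G y)⁻¹ a b * curvLinear s G c d a b y
      = ∑ c, ∑ d, ∑ a, ∑ b, (gram G y)⁻¹ c d * (gram G y)⁻¹ a b * curvLinear s G c d a b y := by
    simp only [Finset.mul_sum, mul_assoc]
  have h5 : ∑ a, ((gram G y)⁻¹ a a - (1 : Matrix (Fin (m + 1)) (Fin (m + 1)) ℝ) a a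
      + frameTensor (frame y) (deviation G y) ![a, a])
      = (∑ a, (gram G y)⁻¹ a a) - ((m : ℝ) + 1)
        + ∑ a, frameTensor (frame y) (deviation G y) ![a, a] := by
    simp [Finset.sum_add_distrib, Finset.sum_sub_distrib]
  rw [h3, h4, h5]
  have h6 : ∑ c, ∑ d, ∑ a, ∑ b,
      (((gram G y)⁻¹ c d - (1 : Matrix (Fin (m + 1)) (Fin (m + 1)) ℝ) c d) * (gram G y)⁻¹ a b
        + (1 : Matrix (Fin (m + 1)) (Fin (m + 1)) ℝ) c d * ((gram G y)⁻¹ a b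
          - (1 : Matrix (Fin (m + 1)) (Fin (m + 1)) ℝ) a b)) * curvLinear s G c d a b y
      = (∑ c, ∑ d, ∑ a, ∑ b, (gram G y)⁻¹ c d * (gram G y)⁻¹ a b * curvLinear s G c d a b y)
        - ∑ c, ∑ d, ∑ a, ∑ b, (1 : Matrix (Fin (m + 1)) (Fin (m + 1)) ℝ) c d *
        (1 : Matrix (Fin (m + 1)) (Fin (m + 1)) ℝ) a b * curvLinear s G c d a b y := by
    simp only [← Finset.sum_sub_distrib]
    exact Finset.sum_congr rfl fun c _ => Finset.sum_congr rfl fun d _ =>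
      Finset.sum_congr rfl fun a _ => Finset.sum_congr rfl fun b _ => by ring
  rw [h6]
  ring

end ScalarCurvatureExpansion

/-! ### Integrability of the divergence of the charge -/

section BulkIntegrability

variable {m : ℕ} {s r₀ σ : ℝ} {G : MetricField (m + 1)} {V : E (m + 1) → ℝ}

theorem tendsto_norm_rpow_neg {σ : ℝ} (hσ : 0 < σ) :
    Tendsto (fun y : E (m + 1) => ‖y‖ ^ (-σ)) (atInfinity m s) (𝓝 0) :=
  (tendsto_rpow_neg_atTop hσ).comp (tendsto_comap.mono_left inf_le_left)

theorem integrableOn_norm_rpow_neg {d : ℕ} {τ : ℝ} (hτ : (d : ℝ) < τ) {R : ℝ} (hR : 1 ≤ R) :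
    IntegrableOn (fun y : E d => ‖y‖ ^ (-τ)) {y | R < ‖y‖} := by
  have h0 : 0 ≤ τ := (Nat.cast_nonneg d).trans hτ.le
  have h := ((integrable_one_add_norm (E := E d) (μ := volume) (r := τ) (by simpa using hτ)).const_mul
    ((2 : ℝ) ^ τ)).integrableOn (s := {y : E d | R < ‖y‖})
  refine h.mono' ?_ ?_
  · exact ((measurable_norm.pow_const (-τ)).aestronglyMeasurable)
  · refine (ae_restrict_mem (isOpen_norm_gt R).measurableSet).mono fun y hy => ?_
    have hy1 : 1 ≤ ‖y‖ := hR.trans (le_of_lt hy)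
    have hy0 : 0 < ‖y‖ := by linarith
    rw [Real.norm_of_nonneg (by positivity)]
    calc ‖y‖ ^ (-τ) = (2 : ℝ) ^ τ * (2 * ‖y‖) ^ (-τ) := by
          rw [Real.mul_rpow zero_le_two hy0.le, ← mul_assoc, ← Real.rpow_add two_pos,
            add_neg_cancel, Real.rpow_zero, one_mul]
      _ ≤ (2 : ℝ) ^ τ * (1 + ‖y‖) ^ (-τ) := by
          refine mul_le_mul_of_nonneg_left ?_ (by positivity)
          exact Real.rpow_le_rpow_of_nonpos (by positivity) (by linarith) (by linarith)

/-- The divergence of the charge is integrable near infinity. -/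
theorem exists_integrableOn_divWithin_charge (hV : IsStaticPotential s V)
    (hG : ∀ i j, ContDiffOn ℝ ∞ (fun z => G z i j) (modelEnd s r₀))
    (hs : ∀ z ∈ modelEnd s r₀, ∀ i j, G z i j = G z j i)
    (hσ : ((m : ℝ) + 1) / 2 < σ)
    (he : tensorNorm (hypMetric (m + 1)) (deviation G) =O[atInfinity m s] fun y => ‖y‖ ^ (-σ))
    (hE : tensorNorm (hypMetric (m + 1)) (devDeriv s G) =O[atInfinity m s] fun y => ‖y‖ ^ (-σ))
    (hN : tensorNorm (hypMetric (m + 1)) (devDerivTwo s G) =O[atInfinity m s] fun y => ‖y‖ ^ (-σ))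
    (hint : IntegrableOn (fun y => ‖y‖ * (scalarCurvature (halfSpace s) G y + ((m : ℝ) + 1) * m) *
      Real.sqrt (G y).det) (modelEnd s r₀)) :
    ∃ R₀, ∀ R, R₀ ≤ R → IntegrableOn (divWithin (halfSpace s)
      (vectorDensity (charge (halfSpace s) (hypMetric (m + 1)) V (deviation G)))) (modelEnd s R) := by
  have hσ0 : 0 < σ := lt_trans (by positivity) hσ
  have hρ := tendsto_norm_rpow_neg (m := m) (s := s) hσ0
  obtain ⟨C₁, hC₁, hV₁⟩ := (isBigO_of_isStaticPotential hV).exists_pos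
  obtain ⟨C₂, hC₂, hR₂⟩ := (isBigO_scalarCurvature hG hs hρ he hE hN).exists_pos
  obtain ⟨R₁, hR₁⟩ := eventually_atInfinity.1 (hV₁.bound.and (hR₂.bound.and
    ((tendsto_det_gram hρ he).eventually (lt_mem_nhds (show (1 / 4 : ℝ) < 1 by norm_num)))))
  refine ⟨max (max r₀ R₁) 1, fun R hR => ?_⟩
  have hr : (modelEnd s R : Set (E (m + 1))) ⊆ modelEnd s r₀ :=
    modelEnd_mono (((le_max_left _ _).trans (le_max_left _ _)).trans hR)
  have hr₁ : (modelEnd s R : Set (E (m + 1))) ⊆ modelEnd s R₁ :=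
    modelEnd_mono (((le_max_right _ _).trans (le_max_left _ _)).trans hR)
  have hR1 : 1 ≤ R := (le_max_right _ _).trans hR
  have hG' := fun i j => (hG i j).mono hr
  have hs' : ∀ z ∈ modelEnd s R, ∀ i j, G z i j = G z j i := fun z hz => hs z (hr hz)
  have hpow : IntegrableOn (fun y : E (m + 1) => ‖y‖ ^ (-(2 * σ))) (modelEnd s R) :=
    (integrableOn_norm_rpow_neg (by push_cast; linarith) hR1).mono_set fun y hy => hy.2
  refine (((hint.mono_set hr).norm.const_mul (2 * C₁)).add (hpow.const_mul (C₁ * C₂))).mono'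
    ((continuousOn_divWithin fun i => contDiffOn_vectorDensity (contDiffOn_charge hV
      (contDiffOn_deviation hG')) i).aestronglyMeasurable (measurableSet_modelEnd s R)) ?_
  refine (ae_restrict_mem (measurableSet_modelEnd s R)).mono fun y hy => ?_
  obtain ⟨hv, hsc, hdet⟩ := hR₁ y (hr₁ hy)
  have hdiv := divWithin_vectorDensity_charge hV (contDiffOn_deviation hG') (deviation_symm hs') hy
  change _ = V y * scalarLinear s G y at hdiv
  have h0 := height_pos y
  have hy1 : 1 ≤ ‖y‖ := hR1.trans hy.2.le
  have hy0 : 0 < ‖y‖ := by linarith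
  have hyh : ‖y‖ ≤ height y := Real.le_sqrt_of_sq_le (by linarith)
  rw [det_gram] at hdet
  -- the measures of `G` and `b` are comparable
  have hdh : 1 ≤ 2 * (height y * Real.sqrt (G y).det) := by
    have : height y * Real.sqrt (G y).det = Real.sqrt (height y ^ 2 * (G y).det) := by
      rw [Real.sqrt_mul (by positivity), Real.sqrt_sq h0.le]
    rw [this]
    have h2 : (1 / 2 : ℝ) ≤ Real.sqrt (height y ^ 2 * (G y).det) :=
      Real.le_sqrt_of_sq_le (by norm_num; linarith)
    linarith
  simp only [Real.norm_eq_abs, Pi.add_apply] at hv hsc ⊢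
  rw [abs_of_pos hy0] at hv
  have hρρ : ‖y‖ ^ (-σ) * ‖y‖ ^ (-σ) = ‖y‖ ^ (-(2 * σ)) := by
    rw [← Real.rpow_add hy0]; congr 1; ring
  rw [hρρ, abs_of_pos (show 0 < ‖y‖ ^ (-(2 * σ)) by positivity)] at hsc
  set X := scalarCurvature (halfSpace s) G y + ((m : ℝ) + 1) * m
  set D := divWithin (halfSpace s)
    (vectorDensity (charge (halfSpace s) (hypMetric (m + 1)) V (deviation G))) y
  have hL : |scalarLinear s G y| ≤ |X| + C₂ * ‖y‖ ^ (-(2 * σ)) := by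
    have := abs_sub_abs_le_abs_sub (scalarLinear s G y) X
    rw [abs_sub_comm] at this
    linarith
  have h1 : height y * |D| ≤ C₁ * ‖y‖ * (|X| + C₂ * ‖y‖ ^ (-(2 * σ))) := by
    rw [show height y * |D| = |height y * D| by rw [abs_mul, abs_of_pos h0], hdiv, abs_mul]
    exact mul_le_mul hv hL (abs_nonneg _) (by positivity)
  have h2 : C₁ * ‖y‖ * (|X| + C₂ * ‖y‖ ^ (-(2 * σ)))
      ≤ height y * (2 * C₁ * |‖y‖ * X * Real.sqrt (G y).det| + C₁ * C₂ * ‖y‖ ^ (-(2 * σ))) := by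
    rw [abs_mul, abs_mul, abs_of_pos hy0, abs_of_nonneg (Real.sqrt_nonneg _)]
    have e1 : C₁ * ‖y‖ * |X| ≤ C₁ * ‖y‖ * |X| * (2 * (height y * Real.sqrt (G y).det)) :=
      le_mul_of_one_le_right (by positivity) hdh
    have e2 : C₁ * C₂ * ‖y‖ ^ (-(2 * σ)) * ‖y‖ ≤ C₁ * C₂ * ‖y‖ ^ (-(2 * σ)) * height y :=
      mul_le_mul_of_nonneg_left hyh (by positivity)
    linarith
  exact le_of_mul_le_mul_left (h1.trans h2) h0

end BulkIntegrability

/-! ### Mean curvature of the level sets of the first coordinate -/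

section MeanCurvature

variable {m : ℕ} {s r₀ : ℝ} {G : MetricField (m + 1)} {y : E (m + 1)}

/-- The inverse of the induced metric on the level sets of `y₀`, extended by zero. -/
noncomputable def tangentialInv (G : MetricField (m + 1)) (y : E (m + 1)) (i j : Fin (m + 1)) : ℝ :=
  (G y)⁻¹ i j - (G y)⁻¹ i 0 * (G y)⁻¹ 0 j / (G y)⁻¹ 0 0

theorem tangentialInv_zero_left (h0 : (G y)⁻¹ 0 0 ≠ 0) (j : Fin (m + 1)) :
    tangentialInv G y 0 j = 0 := by
  rw [tangentialInv]; field_simp; ring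

theorem tangentialInv_zero_right (h0 : (G y)⁻¹ 0 0 ≠ 0) (i : Fin (m + 1)) :
    tangentialInv G y i 0 = 0 := by
  rw [tangentialInv]; field_simp; ring

/-- The inverse of a principal submatrix, as a Schur complement. -/
theorem inv_inducedMetric (hd : IsUnit (G y).det) (h0 : (G y)⁻¹ 0 0 ≠ 0) :
    (inducedMetric G y)⁻¹ = Matrix.of fun α β : Fin m => tangentialInv G y α.succ β.succ := by
  refine Matrix.inv_eq_left_inv ?_
  have hinv : (G y)⁻¹ * G y = 1 := Matrix.nonsing_inv_mul _ hd
  have h1 : ∀ i k, ∑ j, (G y)⁻¹ i j * G y j k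
      = (1 : Matrix (Fin (m + 1)) (Fin (m + 1)) ℝ) i k := fun i k => by
    rw [← Matrix.mul_apply, hinv]
  ext α γ
  have h2 : ∑ j, tangentialInv G y α.succ j * G y j γ.succ
      = (1 : Matrix (Fin (m + 1)) (Fin (m + 1)) ℝ) α.succ γ.succ := by
    have h3 : ∀ j, tangentialInv G y α.succ j * G y j γ.succ
        = (G y)⁻¹ α.succ j * G y j γ.succ
          - (G y)⁻¹ α.succ 0 / (G y)⁻¹ 0 0 * ((G y)⁻¹ 0 j * G y j γ.succ) := fun j => by
      rw [tangentialInv]; ring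
    simp only [h3, Finset.sum_sub_distrib, ← Finset.mul_sum, h1]
    rw [Matrix.one_apply_ne (Fin.succ_ne_zero γ).symm]
    ring
  rw [Fin.sum_univ_succ, tangentialInv_zero_right h0, zero_mul, zero_add] at h2
  simp only [Matrix.mul_apply, Matrix.of_apply, inducedMetric, Matrix.submatrix_apply]
  rw [h2, Matrix.one_apply, Matrix.one_apply]
  simp

theorem sum_inv_inducedMetric (hd : IsUnit (G y).det) (h0 : (G y)⁻¹ 0 0 ≠ 0)
    (F : Fin (m + 1) → Fin (m + 1) → ℝ) :
    ∑ α, ∑ β, (inducedMetric G y)⁻¹ α β * F (Fin.succ α) (Fin.succ β)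
      = ∑ i, ∑ j, tangentialInv G y i j * F i j := by
  rw [inv_inducedMetric hd h0, Fin.sum_univ_succ (n := m)]
  simp only [tangentialInv_zero_left h0, zero_mul, Finset.sum_const_zero, zero_add]
  refine Finset.sum_congr rfl fun α _ => ?_
  rw [Fin.sum_univ_succ, tangentialInv_zero_right h0, zero_mul, zero_add]
  rfl

theorem det_inducedMetric (hd : IsUnit (G y).det) :
    (inducedMetric G y).det = (G y).det * (G y)⁻¹ 0 0 := by
  rw [Matrix.inv_def, Ring.inverse_eq_inv', Matrix.smul_apply, smul_eq_mul, ← mul_assoc,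
    mul_inv_cancel₀ hd.ne_zero, one_mul, Matrix.adjugate_fin_succ_eq_det_submatrix]
  simp [inducedMetric]

/-- `Π_{αβ} = -Γ⁰_{αβ} / |dy₀|_G`. -/
theorem secondFundamentalForm_eq (hd : IsUnit (G y).det) (S : Set (E (m + 1))) (α β : Fin m) :
    secondFundamentalForm S G α β y
      = -christoffel S G 0 α.succ β.succ y / Real.sqrt ((G y)⁻¹ 0 0) := by
  have hinv : G y * (G y)⁻¹ = 1 := Matrix.mul_nonsing_inv _ hd
  have h1 : ∀ k, ∑ l, christoffel S G k α.succ β.succ y * G y k l * outwardNormal G y l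
      = christoffel S G k α.succ β.succ y
        * (1 : Matrix (Fin (m + 1)) (Fin (m + 1)) ℝ) k 0 / Real.sqrt ((G y)⁻¹ 0 0) := by
    intro k
    rw [← hinv, Matrix.mul_apply, Finset.mul_sum, Finset.sum_div]
    exact Finset.sum_congr rfl fun l _ => by rw [outwardNormal]; ring
  simp only [secondFundamentalForm, h1]
  rw [← Finset.sum_div]
  simp [Matrix.one_apply, neg_div]

/-- The components `uₐ` of the `b`-unit normal to the level sets of `y₀` in the orthonormal
frame. -/
noncomputable def normalComp (y : E (m + 1)) (a : Fin (m + 1)) : ℝ :=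
  frame y 0 a / Real.sqrt (1 + y 0 ^ 2)

theorem hypInv_zero_zero : hypInv y 0 0 = 1 + y 0 ^ 2 := by
  simp [hypInv, rankOneUpdate]; ring

theorem sqrt_one_add_sq_pos (x : ℝ) : 0 < Real.sqrt (1 + x ^ 2) := Real.sqrt_pos.2 (by positivity)

theorem frame_zero (a : Fin (m + 1)) :
    frame y 0 a = Real.sqrt (1 + y 0 ^ 2) * normalComp y a := by
  have := (sqrt_one_add_sq_pos (y 0)).ne'
  rw [normalComp]; field_simp

theorem sum_normalComp_sq : ∑ a, normalComp y a * normalComp y a = 1 := by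
  have h := hypInv_eq_sum y 0 0
  rw [hypInv_zero_zero] at h
  have hw := sqrt_one_add_sq_pos (y 0)
  have hw2 : Real.sqrt (1 + y 0 ^ 2) ^ 2 = 1 + y 0 ^ 2 := Real.sq_sqrt (by positivity)
  simp only [frame_zero] at h
  have h2 : ∑ a, Real.sqrt (1 + y 0 ^ 2) * normalComp y a * (Real.sqrt (1 + y 0 ^ 2) * normalComp y a)
      = Real.sqrt (1 + y 0 ^ 2) ^ 2 * ∑ a, normalComp y a * normalComp y a := by
    rw [Finset.mul_sum]; exact Finset.sum_congr rfl fun a _ => by ring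
  rw [h2, hw2] at h
  have h3 : (1 + y 0 ^ 2) ≠ 0 := by positivity
  exact mul_left_cancel₀ h3 (by rw [mul_one]; exact h.symm)

theorem abs_normalComp_le (a : Fin (m + 1)) : |normalComp y a| ≤ 1 := by
  refine abs_le_one_iff_mul_self_le_one.2 ?_
  rw [← sum_normalComp_sq (y := y)]
  exact Finset.single_le_sum (f := fun a => normalComp y a * normalComp y a)
    (fun a _ => mul_self_nonneg _) (Finset.mem_univ a)

theorem hypInv_zero (i : Fin (m + 1)) :
    hypInv y i 0 = Real.sqrt (1 + y 0 ^ 2) * ∑ a, frame y i a * normalComp y a := by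
  rw [hypInv_eq_sum, Finset.mul_sum]
  exact Finset.sum_congr rfl fun a _ => by rw [frame_zero]; ring

theorem sum_hypInv_zero_mul (f : Fin (m + 1) → ℝ) :
    ∑ i, hypInv y i 0 * f i
      = Real.sqrt (1 + y 0 ^ 2) * ∑ a, normalComp y a * frameComp (frame y) f a := by
  simp only [hypInv_zero, frameComp, Finset.mul_sum, Finset.sum_mul]
  rw [Finset.sum_comm]
  exact Finset.sum_congr rfl fun a _ => Finset.sum_congr rfl fun i _ => by ring

/-- The frame components of the `G`-gradient of `y₀`, normalized by `|dy₀|_b`. -/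
noncomputable def gramNormal (G : MetricField (m + 1)) (y : E (m + 1)) (a : Fin (m + 1)) : ℝ :=
  ∑ b, (gram G y)⁻¹ a b * normalComp y b

/-- `|dy₀|²_G / |dy₀|²_b`. -/
noncomputable def gramNormalSq (G : MetricField (m + 1)) (y : E (m + 1)) : ℝ :=
  ∑ a, normalComp y a * gramNormal G y a

theorem inv_zero (i : Fin (m + 1)) :
    (G y)⁻¹ i 0 = Real.sqrt (1 + y 0 ^ 2) * ∑ a, frame y i a * gramNormal G y a := by
  rw [inv_eq_frame_mul_mul_frame, mul_assoc, Matrix.mul_apply, Finset.mul_sum]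
  refine Finset.sum_congr rfl fun a _ => ?_
  rw [Matrix.mul_apply, gramNormal, mul_left_comm]
  congr 1
  rw [Finset.mul_sum]
  exact Finset.sum_congr rfl fun b _ => by rw [frame_symm y b 0, frame_zero]; ring

theorem inv_zero_zero : (G y)⁻¹ 0 0 = (1 + y 0 ^ 2) * gramNormalSq G y := by
  have hw2 : Real.sqrt (1 + y 0 ^ 2) * Real.sqrt (1 + y 0 ^ 2) = 1 + y 0 ^ 2 :=
    Real.mul_self_sqrt (by positivity)
  have h1 : ∑ a, frame y 0 a * gramNormal G y a
      = Real.sqrt (1 + y 0 ^ 2) * ∑ a, normalComp y a * gramNormal G y a := by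
    rw [Finset.mul_sum]
    exact Finset.sum_congr rfl fun a _ => by rw [frame_zero]; ring
  rw [inv_zero, h1, ← mul_assoc, hw2, gramNormalSq]

theorem sum_inv_zero_mul (f : Fin (m + 1) → ℝ) :
    ∑ i, (G y)⁻¹ i 0 * f i
      = Real.sqrt (1 + y 0 ^ 2) * ∑ a, gramNormal G y a * frameComp (frame y) f a := by
  simp only [inv_zero, frameComp, Finset.mul_sum, Finset.sum_mul]
  rw [Finset.sum_comm]
  exact Finset.sum_congr rfl fun a _ => Finset.sum_congr rfl fun i _ => by ring

/-- The frame components of `tangentialInv`. -/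
noncomputable def gramTangential (G : MetricField (m + 1)) (y : E (m + 1)) (a b : Fin (m + 1)) : ℝ :=
  (gram G y)⁻¹ a b - gramNormal G y a * gramNormal G y b / gramNormalSq G y

theorem sum_tangentialInv_mul (hs : ∀ i j, G y i j = G y j i)
    (F : Fin (m + 1) → Fin (m + 1) → ℝ) :
    ∑ i, ∑ j, tangentialInv G y i j * F i j = ∑ a, ∑ b, gramTangential G y a b *
      frameComp (frame y) (fun i => frameComp (frame y) (fun j => F i j) b) a := by
  have hw2 : Real.sqrt (1 + y 0 ^ 2) * Real.sqrt (1 + y 0 ^ 2) = 1 + y 0 ^ 2 :=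
    Real.mul_self_sqrt (by positivity)
  have h1 : (1 + y 0 ^ 2) ≠ 0 := by positivity
  have h2 : ∑ i, ∑ j, tangentialInv G y i j * F i j = (∑ i, ∑ j, (G y)⁻¹ i j * F i j)
      - (∑ i, (G y)⁻¹ i 0 * ∑ j, (G y)⁻¹ j 0 * F i j) / (G y)⁻¹ 0 0 := by
    simp only [tangentialInv, Finset.mul_sum, Finset.sum_div, ← Finset.sum_sub_distrib]
    refine Finset.sum_congr rfl fun i _ => Finset.sum_congr rfl fun j _ => ?_
    rw [inv_symm hs 0 j]; ring
  rw [h2, sum_inv_mul_eq_sum_gram]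
  simp only [sum_inv_zero_mul, frameComp_mul_left, frameComp_sum]
  rw [inv_zero_zero]
  simp only [gramTangential, sub_mul, Finset.sum_sub_distrib]
  congr 1
  have h3 : ∀ a, gramNormal G y a * (Real.sqrt (1 + y 0 ^ 2) * ∑ x, gramNormal G y x *
      frameComp (frame y) (fun i => frameComp (frame y) (fun j => F i j) x) a)
      = Real.sqrt (1 + y 0 ^ 2) * ∑ x, gramNormal G y a * gramNormal G y x *
      frameComp (frame y) (fun i => frameComp (frame y) (fun j => F i j) x) a := fun a => by
    rw [mul_left_comm, Finset.mul_sum]; simp only [mul_assoc]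
  simp only [h3]
  rw [← Finset.mul_sum, ← mul_assoc, hw2, mul_div_mul_left _ _ h1, Finset.sum_div]
  refine Finset.sum_congr rfl fun a _ => ?_
  rw [Finset.sum_div]
  exact Finset.sum_congr rfl fun b _ => by ring

/-- The frame components of `koszul`. -/
noncomputable def koszulFrame (s : ℝ) (G : MetricField (m + 1)) (a c b : Fin (m + 1))
    (y : E (m + 1)) : ℝ :=
  frameTensor (frame y) (devDeriv s G y) ![a, b, c] + frameTensor (frame y) (devDeriv s G y) ![b, a, c]
    - frameTensor (frame y) (devDeriv s G y) ![c, a, b]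

theorem frameComp_koszul (a c b : Fin (m + 1)) :
    frameComp (frame y) (fun i => frameComp (frame y) (fun j => frameComp (frame y)
      (fun l => koszul s G i l j y) c) b) a = koszulFrame s G a c b y := by
  have h := fun (σ : Fin 3 → Fin 3) (hσ : Function.Bijective σ) =>
    frameComp_three_perm (frame y) hσ (devDeriv s G y) a b c
  have h1 := h ![0, 1, 2] (by decide)
  have h2 := h ![1, 0, 2] (by decide)
  have h3 := h ![2, 0, 1] (by decide)
  simp [comp_vecCons, comp_vecEmpty] at h1 h2 h3
  simp only [koszul, frameComp_add, frameComp_sub, koszulFrame]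
  rw [h1, h2, h3]

/-- Exact formula for the mean curvature of the level sets of `y₀`: the Christoffel symbol `Γ⁰ᵢⱼ` is
`-y₀ bᵢⱼ + C⁰ᵢⱼ`, and `λ = y₀ / |dy₀|_b`. -/
theorem meanCurvature_eq (hG : ∀ i j, ContDiffOn ℝ ∞ (fun z => G z i j) (modelEnd s r₀))
    (hs : ∀ z ∈ modelEnd s r₀, ∀ i j, G z i j = G z j i)
    (hd : ∀ z ∈ modelEnd s r₀, IsUnit (G z).det) (hy : y ∈ modelEnd s r₀)
    (h0 : gramNormalSq G y ≠ 0) :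
    meanCurvature (halfSpace s) G y = (Real.sqrt (gramNormalSq G y))⁻¹ *
      (lam (y 0) * (∑ a, gramTangential G y a a)
        - 1 / 2 * ∑ a, ∑ b, gramTangential G y a b *
          ∑ c, gramNormal G y c * koszulFrame s G a c b y) := by
  have h1 : (1 + y 0 ^ 2) ≠ 0 := by positivity
  have h00 : (G y)⁻¹ 0 0 ≠ 0 := by rw [inv_zero_zero]; exact mul_ne_zero h1 h0
  have hw := (sqrt_one_add_sq_pos (y 0)).ne'
  rw [meanCurvature]
  have h2 : ∀ α β, secondFundamentalForm (halfSpace s) G α β y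
      = (fun i j => (Real.sqrt ((G y)⁻¹ 0 0))⁻¹ * (y 0 * hypMetric (m + 1) y i j
        - 1 / 2 * ∑ l, (G y)⁻¹ l 0 * koszul s G i l j y)) (Fin.succ α) (Fin.succ β) := by
    intro α β
    rw [secondFundamentalForm_eq (hd y hy), christoffel_eq hG hs hd hy, connDiff]
    simp only [inv_symm (hs y hy) 0]
    ring
  -- both sums over tangential indices extend over all indices
  simp only [h2]
  rw [sum_inv_inducedMetric (hd y hy) h00 (fun i j => (Real.sqrt ((G y)⁻¹ 0 0))⁻¹ *
    (y 0 * hypMetric (m + 1) y i j - 1 / 2 * ∑ l, (G y)⁻¹ l 0 * koszul s G i l j y)),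
    sum_tangentialInv_mul (hs y hy)]
  simp only [sum_inv_zero_mul, frameComp_mul_left, frameComp_sub, frameComp_sum, frameComp_koszul]
  have h3 : ∀ a b, frameComp (frame y) (fun i => frameComp (frame y)
      (fun j => hypMetric (m + 1) y i j) b) a
      = (1 : Matrix (Fin (m + 1)) (Fin (m + 1)) ℝ) a b := fun a b => by
    rw [← mul_mul_apply_eq_frameComp _ (frame_symm y), frame_mul_hypMetric_mul_frame]
  simp only [h3]
  rw [inv_zero_zero, Real.sqrt_mul (by positivity), mul_inv]
  have h4 : ∑ a, gramTangential G y a a = ∑ a, ∑ b, gramTangential G y a b *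
      (1 : Matrix (Fin (m + 1)) (Fin (m + 1)) ℝ) a b := by
    simp [Matrix.one_apply]
  rw [h4, lam]
  simp only [Finset.mul_sum, ← Finset.sum_sub_distrib]
  refine Finset.sum_congr rfl fun a _ => Finset.sum_congr rfl fun b _ => ?_
  rw [← Finset.mul_sum, ← Finset.mul_sum, ← Finset.mul_sum, ← Finset.mul_sum]
  field_simp

end MeanCurvature

/-! ### First-order expansion of the mean curvature -/

section MeanCurvatureExpansion

variable {m : ℕ} {s r₀ : ℝ} {G : MetricField (m + 1)} {ρ : E (m + 1) → ℝ}

theorem isBigO_one_mul {l : Filter (E (m + 1))} {f g k : E (m + 1) → ℝ}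
    (hf : f =O[l] fun _ => (1 : ℝ)) (hg : g =O[l] k) : (fun y => f y * g y) =O[l] k := by
  simpa using hf.mul hg

theorem isBigO_mul_one {l : Filter (E (m + 1))} {f g k : E (m + 1) → ℝ}
    (hf : f =O[l] k) (hg : g =O[l] fun _ => (1 : ℝ)) : (fun y => f y * g y) =O[l] k := by
  simpa using hf.mul hg

theorem isBigO_normalComp {l : Filter (E (m + 1))} (a : Fin (m + 1)) :
    (fun y => normalComp y a) =O[l] fun _ => (1 : ℝ) :=
  Asymptotics.IsBigO.of_bound 1 (Eventually.of_forall fun y => by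
    simpa using abs_normalComp_le (y := y) a)

theorem abs_lam_le (x : ℝ) : |lam x| ≤ 1 := by
  rw [lam, abs_div, abs_of_pos (sqrt_one_add_sq_pos x), div_le_one (sqrt_one_add_sq_pos x)]
  exact Real.le_sqrt_of_sq_le (by rw [sq_abs]; linarith)

theorem isBigO_lam {l : Filter (E (m + 1))} :
    (fun y : E (m + 1) => lam (y 0)) =O[l] fun _ => (1 : ℝ) :=
  Asymptotics.IsBigO.of_bound 1 (Eventually.of_forall fun y => by simpa using abs_lam_le (y 0))

/-- The component `e(η, ·)ₐ` of `e = G - b` in the orthonormal frame. -/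
noncomputable def normalDev (G : MetricField (m + 1)) (y : E (m + 1)) (a : Fin (m + 1)) : ℝ :=
  ∑ b, frameTensor (frame y) (deviation G y) ![a, b] * normalComp y b

/-- `e(η, η)` for `e = G - b`. -/
noncomputable def normalNormalDev (G : MetricField (m + 1)) (y : E (m + 1)) : ℝ :=
  ∑ a, normalComp y a * normalDev G y a

/-- The projection to the tangent space of the level sets of `y₀`, in the orthonormal frame. -/
noncomputable def tangentProj (y : E (m + 1)) (a b : Fin (m + 1)) : ℝ :=
  (1 : Matrix (Fin (m + 1)) (Fin (m + 1)) ℝ) a b - normalComp y a * normalComp y b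

/-- The linearization at `b` of the mean curvature, applied to `e = G - b`. -/
noncomputable def meanLinear (s : ℝ) (G : MetricField (m + 1)) (y : E (m + 1)) : ℝ :=
  lam (y 0) * (-(∑ a, frameTensor (frame y) (deviation G y) ![a, a])
      + (1 + m / 2) * normalNormalDev G y)
    - 1 / 2 * ∑ a, ∑ b, tangentProj y a b * ∑ c, normalComp y c * koszulFrame s G a c b y

theorem sum_one_mul (f : Fin (m + 1) → ℝ) (a : Fin (m + 1)) :
    ∑ b, (1 : Matrix (Fin (m + 1)) (Fin (m + 1)) ℝ) a b * f b = f a := by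
  simp [Matrix.one_apply]

variable (hρ : Tendsto ρ (atInfinity m s) (𝓝 0))
  (he : tensorNorm (hypMetric (m + 1)) (deviation G) =O[atInfinity m s] ρ)

include hρ he

theorem isBigO_gramNormal_sub_add (a : Fin (m + 1)) :
    (fun y => gramNormal G y a - normalComp y a + normalDev G y a)
      =O[atInfinity m s] fun y => ρ y * ρ y := by
  have h : ∀ y, ∑ b, ((gram G y)⁻¹ a b - (1 : Matrix (Fin (m + 1)) (Fin (m + 1)) ℝ) a b
      + frameTensor (frame y) (deviation G y) ![a, b]) * normalComp y b
      = gramNormal G y a - normalComp y a + normalDev G y a := fun y => by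
    simp only [add_mul, sub_mul, Finset.sum_add_distrib, Finset.sum_sub_distrib, sum_one_mul]
    rfl
  refine Asymptotics.IsBigO.congr_left ?_ h
  exact Asymptotics.IsBigO.fun_sum fun b _ =>
    isBigO_mul_one (isBigO_gram_inv_sub_one_add hρ he a b) (isBigO_normalComp b)

omit hρ in
theorem isBigO_normalDev (a : Fin (m + 1)) :
    (fun y => normalDev G y a) =O[atInfinity m s] ρ :=
  Asymptotics.IsBigO.fun_sum fun b _ => isBigO_mul_one (isBigO_frameTensor he _) (isBigO_normalComp b)

omit hρ in
theorem isBigO_normalNormalDev : (fun y => normalNormalDev G y) =O[atInfinity m s] ρ :=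
  Asymptotics.IsBigO.fun_sum fun a _ => isBigO_one_mul (isBigO_normalComp a) (isBigO_normalDev he a)

theorem isBigO_gramNormal_sub (a : Fin (m + 1)) :
    (fun y => gramNormal G y a - normalComp y a) =O[atInfinity m s] ρ := by
  have hρ1 := hρ.isBigO_one ℝ
  refine ((isBigO_gramNormal_sub_add hρ he a).trans (isBigO_one_mul hρ1
    (Asymptotics.isBigO_refl ρ _)) |>.sub (isBigO_normalDev he a)).congr_left fun y => by ring

theorem isBigO_gramNormal (a : Fin (m + 1)) :
    (fun y => gramNormal G y a) =O[atInfinity m s] fun _ => (1 : ℝ) :=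
  (((isBigO_gramNormal_sub hρ he a).trans (hρ.isBigO_one ℝ)).add
    (isBigO_normalComp a)).congr_left fun y => by ring

theorem isBigO_gramNormalSq_sub_add :
    (fun y => gramNormalSq G y - 1 + normalNormalDev G y)
      =O[atInfinity m s] fun y => ρ y * ρ y := by
  have h : ∀ y, ∑ a, normalComp y a * (gramNormal G y a - normalComp y a + normalDev G y a)
      = gramNormalSq G y - 1 + normalNormalDev G y := fun y => by
    simp only [mul_add, mul_sub, Finset.sum_add_distrib, Finset.sum_sub_distrib]
    rw [sum_normalComp_sq]
    rfl
  refine Asymptotics.IsBigO.congr_left ?_ h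
  exact Asymptotics.IsBigO.fun_sum fun a _ =>
    isBigO_one_mul (isBigO_normalComp a) (isBigO_gramNormal_sub_add hρ he a)

theorem isBigO_gramNormalSq_sub_one :
    (fun y => gramNormalSq G y - 1) =O[atInfinity m s] ρ :=
  ((isBigO_gramNormalSq_sub_add hρ he).trans (isBigO_one_mul (hρ.isBigO_one ℝ)
    (Asymptotics.isBigO_refl ρ _)) |>.sub (isBigO_normalNormalDev he)).congr_left fun y => by ring

theorem tendsto_gramNormalSq : Tendsto (gramNormalSq G) (atInfinity m s) (𝓝 1) := by
  have h := ((isBigO_gramNormalSq_sub_one hρ he).trans_tendsto hρ).add_const 1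
  simpa using h

theorem isBigO_sum_gramNormal_sq :
    (fun y => (∑ a, gramNormal G y a * gramNormal G y a) - 1 + 2 * normalNormalDev G y)
      =O[atInfinity m s] fun y => ρ y * ρ y := by
  have h : ∀ y, ∑ a, ((gramNormal G y a - normalComp y a + normalDev G y a)
        * (gramNormal G y a + normalComp y a)
        - normalDev G y a * (gramNormal G y a - normalComp y a))
      = (∑ a, gramNormal G y a * gramNormal G y a) - 1 + 2 * normalNormalDev G y := fun y => by
    rw [← sum_normalComp_sq (y := y), normalNormalDev, Finset.mul_sum, ← Finset.sum_sub_distrib,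
      ← Finset.sum_add_distrib]
    exact Finset.sum_congr rfl fun a _ => by ring
  refine Asymptotics.IsBigO.congr_left ?_ h
  exact Asymptotics.IsBigO.fun_sum fun a _ => (isBigO_mul_one (isBigO_gramNormal_sub_add hρ he a)
    ((isBigO_gramNormal hρ he a).add (isBigO_normalComp a))).sub
    ((isBigO_normalDev he a).mul (isBigO_gramNormal_sub hρ he a))

theorem isBigO_gramNormalSq_inv :
    (fun y => (gramNormalSq G y)⁻¹) =O[atInfinity m s] fun _ => (1 : ℝ) :=
  ((tendsto_gramNormalSq hρ he).inv₀ one_ne_zero).isBigO_one ℝ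

/-- The trace of the inverse of the induced metric, to first order. -/
theorem isBigO_trace_gramTangential :
    (fun y => (∑ a, gramTangential G y a a) - (m - (∑ a, frameTensor (frame y) (deviation G y) ![a, a])
      + normalNormalDev G y)) =O[atInfinity m s] fun y => ρ y * ρ y := by
  have hε := isBigO_normalNormalDev he
  have h1 : (fun y => ∑ a, ((gram G y)⁻¹ a a - (1 : Matrix (Fin (m + 1)) (Fin (m + 1)) ℝ) a a
      + frameTensor (frame y) (deviation G y) ![a, a])) =O[atInfinity m s] fun y => ρ y * ρ y :=
    Asymptotics.IsBigO.fun_sum fun a _ => isBigO_gram_inv_sub_one_add hρ he a a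
  have h2 := isBigO_mul_one (((isBigO_sum_gramNormal_sq hρ he).sub
    (isBigO_mul_one (isBigO_gramNormalSq_sub_add hρ he)
      ((Asymptotics.isBigO_refl (fun _ => (1 : ℝ)) _).sub (hε.trans (hρ.isBigO_one ℝ))))).sub
    (hε.mul hε)) (isBigO_gramNormalSq_inv hρ he)
  refine (h1.sub h2).congr' ?_ EventuallyEq.rfl
  filter_upwards [(tendsto_gramNormalSq hρ he).eventually_ne one_ne_zero] with y hy
  have h3 : ∑ a, ((gram G y)⁻¹ a a - (1 : Matrix (Fin (m + 1)) (Fin (m + 1)) ℝ) a a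
      + frameTensor (frame y) (deviation G y) ![a, a])
      = (∑ a, (gram G y)⁻¹ a a) - ((m : ℝ) + 1)
        + ∑ a, frameTensor (frame y) (deviation G y) ![a, a] := by
    simp [Finset.sum_add_distrib, Finset.sum_sub_distrib]
  rw [h3]
  simp only [gramTangential, Finset.sum_sub_distrib, ← Finset.sum_div]
  field_simp
  ring

theorem isBigO_gramTangential_sub (a b : Fin (m + 1)) :
    (fun y => gramTangential G y a b - tangentProj y a b) =O[atInfinity m s] ρ := by
  have hv := isBigO_gramNormal_sub hρ he
  have h1 : (fun y => (gramNormal G y a - normalComp y a) * gramNormal G y b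
      + normalComp y a * (gramNormal G y b - normalComp y b)) =O[atInfinity m s] ρ :=
    (isBigO_mul_one (hv a) (isBigO_gramNormal hρ he b)).add
      (isBigO_one_mul (isBigO_normalComp a) (hv b))
  have h2 : (fun y => (gramNormalSq G y - 1) * (normalComp y a * normalComp y b))
      =O[atInfinity m s] ρ := isBigO_mul_one (isBigO_gramNormalSq_sub_one hρ he)
    (isBigO_one_mul (isBigO_normalComp a) (isBigO_normalComp b))
  refine ((isBigO_gram_inv_sub_one hρ he a b).sub
    (isBigO_mul_one (h1.sub h2) (isBigO_gramNormalSq_inv hρ he))).congr' ?_ EventuallyEq.rfl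
  filter_upwards [(tendsto_gramNormalSq hρ he).eventually_ne one_ne_zero] with y hy
  rw [gramTangential, tangentProj]
  field_simp
  ring

/-- `x^{-1/2} = 1 - (x - 1) / 2 + O((x - 1)²)` at `x = gramNormalSq`. -/
theorem isBigO_sqrt_gramNormalSq_inv :
    (fun y => (Real.sqrt (gramNormalSq G y))⁻¹ - 1 - 1 / 2 * normalNormalDev G y)
      =O[atInfinity m s] fun y => ρ y * ρ y := by
  have hf := tendsto_gramNormalSq hρ he
  have hr : Tendsto (fun y => Real.sqrt (gramNormalSq G y)) (atInfinity m s) (𝓝 1) := by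
    simpa using hf.sqrt
  have h1 := isBigO_gramNormalSq_sub_one hρ he
  have h2 : (fun y => (2 + Real.sqrt (gramNormalSq G y)) *
      (2 * Real.sqrt (gramNormalSq G y) * (1 + Real.sqrt (gramNormalSq G y)) ^ 2)⁻¹)
      =O[atInfinity m s] fun _ => (1 : ℝ) :=
    ((hr.const_add 2).mul (((hr.const_mul 2).mul ((hr.const_add 1).pow 2)).inv₀
      (by norm_num))).isBigO_one ℝ
  refine ((isBigO_one_mul h2 (h1.mul h1)).sub
    ((isBigO_gramNormalSq_sub_add hρ he).const_mul_left (1 / 2))).congr' ?_ EventuallyEq.rfl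
  filter_upwards [hf.eventually (lt_mem_nhds one_pos)] with y hy
  have h3 : 0 < Real.sqrt (gramNormalSq G y) := Real.sqrt_pos.2 hy
  have h4 : gramNormalSq G y = Real.sqrt (gramNormalSq G y) ^ 2 := (Real.sq_sqrt hy.le).symm
  set r := Real.sqrt (gramNormalSq G y)
  rw [h4]
  field_simp
  ring

variable (hE : tensorNorm (hypMetric (m + 1)) (devDeriv s G) =O[atInfinity m s] ρ)

include hE

omit hρ he in
theorem isBigO_koszulFrame (a c b : Fin (m + 1)) :
    (fun y => koszulFrame s G a c b y) =O[atInfinity m s] ρ :=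
  ((isBigO_frameTensor hE _).add (isBigO_frameTensor hE _)).sub (isBigO_frameTensor hE _)

omit hρ he in
theorem isBigO_tangentProj_koszulFrame :
    (fun y => ∑ a, ∑ b, tangentProj y a b * ∑ c, normalComp y c * koszulFrame s G a c b y)
      =O[atInfinity m s] ρ := by
  refine Asymptotics.IsBigO.fun_sum fun a _ => Asymptotics.IsBigO.fun_sum fun b _ =>
    isBigO_one_mul ?_ (Asymptotics.IsBigO.fun_sum fun c _ =>
      isBigO_one_mul (isBigO_normalComp c) (isBigO_koszulFrame hE a c b))
  exact (Asymptotics.isBigO_const_const _ one_ne_zero _).sub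
    (isBigO_one_mul (isBigO_normalComp a) (isBigO_normalComp b))

theorem isBigO_gramTangential_koszulFrame :
    (fun y => (∑ a, ∑ b, gramTangential G y a b * ∑ c, gramNormal G y c * koszulFrame s G a c b y)
      - ∑ a, ∑ b, tangentProj y a b * ∑ c, normalComp y c * koszulFrame s G a c b y)
      =O[atInfinity m s] fun y => ρ y * ρ y := by
  have h : ∀ y, ∑ a, ∑ b, ((gramTangential G y a b - tangentProj y a b) *
        (∑ c, gramNormal G y c * koszulFrame s G a c b y)
      + tangentProj y a b * ∑ c, (gramNormal G y c - normalComp y c) * koszulFrame s G a c b y)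
      = (∑ a, ∑ b, gramTangential G y a b * ∑ c, gramNormal G y c * koszulFrame s G a c b y)
      - ∑ a, ∑ b, tangentProj y a b * ∑ c, normalComp y c * koszulFrame s G a c b y := fun y => by
    simp only [← Finset.sum_sub_distrib]
    refine Finset.sum_congr rfl fun a _ => Finset.sum_congr rfl fun b _ => ?_
    simp only [sub_mul, Finset.sum_sub_distrib]
    ring
  refine Asymptotics.IsBigO.congr_left ?_ h
  refine Asymptotics.IsBigO.fun_sum fun a _ => Asymptotics.IsBigO.fun_sum fun b _ => ?_
  refine ((isBigO_gramTangential_sub hρ he a b).mul (Asymptotics.IsBigO.fun_sum fun c _ =>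
    isBigO_one_mul (isBigO_gramNormal hρ he c) (isBigO_koszulFrame hE a c b))).add
    (isBigO_one_mul ?_ (Asymptotics.IsBigO.fun_sum fun c _ =>
      (isBigO_gramNormal_sub hρ he c).mul (isBigO_koszulFrame hE a c b)))
  exact (Asymptotics.isBigO_const_const _ one_ne_zero _).sub
    (isBigO_one_mul (isBigO_normalComp a) (isBigO_normalComp b))

/-- The mean curvature of `G` is that of `b` plus its linearization plus a quadratic remainder. -/
theorem isBigO_meanCurvature (hG : ∀ i j, ContDiffOn ℝ ∞ (fun z => G z i j) (modelEnd s r₀))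
    (hs : ∀ z ∈ modelEnd s r₀, ∀ i j, G z i j = G z j i) :
    (fun y => meanCurvature (halfSpace s) G y - m * lam (y 0) - meanLinear s G y)
      =O[atInfinity m s] fun y => ρ y * ρ y := by
  obtain ⟨R, hR⟩ := exists_isUnit_det hρ he
  have hρ1 := hρ.isBigO_one ℝ
  have hρ2 : (fun y => ρ y * ρ y) =O[atInfinity m s] ρ :=
    isBigO_one_mul hρ1 (Asymptotics.isBigO_refl ρ _)
  have hε := isBigO_normalNormalDev he
  have hg := isBigO_sqrt_gramNormalSq_inv hρ he
  have hT := isBigO_trace_gramTangential hρ he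
  have hZ := isBigO_gramTangential_koszulFrame hρ he hE
  have hZ0 := isBigO_tangentProj_koszulFrame hE
  have ht : (fun y => ∑ a, frameTensor (frame y) (deviation G y) ![a, a]) =O[atInfinity m s] ρ :=
    Asymptotics.IsBigO.fun_sum fun a _ => isBigO_frameTensor he _
  have hl := isBigO_lam (l := atInfinity m s)
  -- the linear part of the bracket in `meanCurvature_eq`, beyond the constant `m λ`
  have hB : (fun y => lam (y 0) * (-(∑ a, frameTensor (frame y) (deviation G y) ![a, a])
      + normalNormalDev G y) - 1 / 2 * ∑ a, ∑ b, tangentProj y a b *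
        ∑ c, normalComp y c * koszulFrame s G a c b y) =O[atInfinity m s] ρ :=
    (isBigO_one_mul hl (ht.neg_left.add hε)).sub (hZ0.const_mul_left _)
  have hD := (isBigO_one_mul hl hT).sub (hZ.const_mul_left (1 / 2))
  have hm : (fun y : E (m + 1) => (m : ℝ) * lam (y 0)) =O[atInfinity m s] fun _ => (1 : ℝ) :=
    hl.const_mul_left _
  have hA := (((hD.trans hρ2).trans hρ1).add (hB.trans hρ1)).add hm
  have h1e : (fun y => 1 + 1 / 2 * normalNormalDev G y) =O[atInfinity m s] fun _ => (1 : ℝ) :=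
    (Asymptotics.isBigO_refl _ _).add ((hε.trans hρ1).const_mul_left _)
  refine (((isBigO_mul_one hg hA).add (isBigO_one_mul h1e hD)).add
    ((hε.const_mul_left (1 / 2)).mul hB)).congr' ?_ EventuallyEq.rfl
  filter_upwards [eventually_mem_modelEnd s (max r₀ R),
    (tendsto_gramNormalSq hρ he).eventually_ne one_ne_zero] with y hy hy0
  have hr : (modelEnd s (max r₀ R) : Set (E (m + 1))) ⊆ modelEnd s r₀ :=
    modelEnd_mono (le_max_left _ _)
  rw [meanCurvature_eq (fun i j => (hG i j).mono hr) (fun z hz => hs z (hr hz))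
    (fun z hz => hR z (modelEnd_mono (le_max_right _ _) hz)) hy hy0, meanLinear]
  ring

end MeanCurvatureExpansion

/-! ### Divergence of 1-forms along the boundary -/

section BoundaryDivergence

variable {m : ℕ} {s r₀ : ℝ} {V : E (m + 1) → ℝ} {e : TensorField (m + 1) 2}

/-- The linear part of `sigmaPoint s`. -/
noncomputable def sigmaLinear (m : ℕ) : E m →L[ℝ] E (m + 1) :=
  LinearMap.toContinuousLinearMap
    { toFun := sigmaPoint 0
      map_add' := fun z w => by
        ext i; refine Fin.cases ?_ (fun j => ?_) i <;> simp [sigmaPoint]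
      map_smul' := fun c z => by
        ext i; refine Fin.cases ?_ (fun j => ?_) i <;> simp [sigmaPoint] }

theorem sigmaPoint_eq (s : ℝ) (z : E m) : sigmaPoint s z = sigmaPoint s 0 + sigmaLinear m z := by
  ext i; refine Fin.cases ?_ (fun j => ?_) i <;> simp [sigmaPoint, sigmaLinear]

theorem sigmaLinear_single (α : Fin m) :
    sigmaLinear m (EuclideanSpace.single α 1) = EuclideanSpace.single α.succ 1 := by
  ext i
  refine Fin.cases ?_ (fun j => ?_) i
  · simp [sigmaPoint, sigmaLinear]
  · simp [sigmaPoint, sigmaLinear]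

theorem sigmaPoint_zero (s : ℝ) (z : E m) : sigmaPoint s z 0 = s := rfl

theorem sigmaPoint_succ (s : ℝ) (z : E m) (α : Fin m) : sigmaPoint s z α.succ = z α := rfl

theorem contDiff_sigmaPoint : ContDiff ℝ ∞ (sigmaPoint s : E m → E (m + 1)) := by
  rw [show (sigmaPoint s : E m → E (m + 1)) = fun z => sigmaPoint s 0 + sigmaLinear m z from
    funext (sigmaPoint_eq s)]
  exact contDiff_const.add (sigmaLinear m).contDiff

theorem sigmaPoint_mem_modelEnd {z : E m} (hz : r₀ < ‖sigmaPoint s z‖) :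
    sigmaPoint s z ∈ modelEnd s r₀ := ⟨le_of_eq rfl, hz⟩

theorem contDiffOn_comp_sigmaPoint {f : E (m + 1) → ℝ} (hf : ContDiffOn ℝ ∞ f (modelEnd s r₀)) :
    ContDiffOn ℝ ∞ (fun z => f (sigmaPoint s z)) {z : E m | r₀ < ‖sigmaPoint s z‖} :=
  hf.comp contDiff_sigmaPoint.contDiffOn fun _ hz => sigmaPoint_mem_modelEnd hz

theorem hasFDerivWithinAt_comp_sigmaPoint {f : E (m + 1) → ℝ} {z : E m}
    (hf : DifferentiableWithinAt ℝ f (halfSpace s) (sigmaPoint s z)) :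
    HasFDerivWithinAt (fun z => f (sigmaPoint s z))
      ((fderivWithin ℝ f (halfSpace s) (sigmaPoint s z)).comp (sigmaLinear m)) univ z := by
  have h1 : HasFDerivWithinAt (sigmaPoint s : E m → E (m + 1)) (sigmaLinear m) univ z := by
    rw [show (sigmaPoint s : E m → E (m + 1)) = fun z => sigmaPoint s 0 + sigmaLinear m z from
      funext (sigmaPoint_eq s)]
    exact ((sigmaLinear m).hasFDerivWithinAt).const_add _
  exact hf.hasFDerivWithinAt.comp z h1 fun w _ => le_of_eq (sigmaPoint_zero s w)

theorem pd_comp_sigmaPoint {f : E (m + 1) → ℝ} {z : E m}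
    (hf : DifferentiableWithinAt ℝ f (halfSpace s) (sigmaPoint s z)) (α : Fin m) :
    pd univ (fun z => f (sigmaPoint s z)) α z = pd (halfSpace s) f α.succ (sigmaPoint s z) := by
  rw [pd_of_hasFDerivWithinAt uniqueDiffWithinAt_univ (hasFDerivWithinAt_comp_sigmaPoint hf),
    ContinuousLinearMap.comp_apply, sigmaLinear_single, pd]

/-- The 1-form `|dy₀|_b V e(η, ·)`; along `Σ_s` the factor `|dy₀|_b` is the constant `√(1 + s²)`. -/
noncomputable def conormalForm (V : E (m + 1) → ℝ) (e : TensorField (m + 1) 2) (j : Fin (m + 1))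
    (y : E (m + 1)) : ℝ :=
  V y * ∑ i, hypInv y i 0 * e y ![j, i]

theorem contDiffOn_conormalForm (hV : ContDiffOn ℝ ∞ V (modelEnd s r₀))
    (he : ∀ I, ContDiffOn ℝ ∞ (fun z => e z I) (modelEnd s r₀)) (j : Fin (m + 1)) :
    ContDiffOn ℝ ∞ (conormalForm V e j) (modelEnd s r₀) :=
  hV.mul (ContDiffOn.sum fun i _ => (contDiffOn_hypInv i 0).mul (he _))

/-- The vector density `√det γ · γ^{αβ} K_β` on `Σ_s` dual to the restriction of a 1-form `K`, where
`γ` is the metric induced by `b`. Its constant factor `√(1 + s²)` is left out; `conormalForm` has it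
instead. -/
noncomputable def sigmaDensity (s : ℝ) (K : Fin (m + 1) → E (m + 1) → ℝ) (α : Fin m) (z : E m) : ℝ :=
  (height (sigmaPoint s z))⁻¹ *
    ∑ β : Fin m, ((if α = β then 1 else 0) + z α * z β / (1 + s ^ 2)) * K β.succ (sigmaPoint s z)

theorem contDiffOn_sigmaDensity {K : Fin (m + 1) → E (m + 1) → ℝ}
    (hK : ∀ j, ContDiffOn ℝ ∞ (K j) (modelEnd s r₀)) (α : Fin m) :
    ContDiffOn ℝ ∞ (sigmaDensity s K α) {z | r₀ < ‖sigmaPoint s z‖} := by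
  refine ContDiffOn.mul ?_ (ContDiffOn.sum fun β _ => ContDiffOn.mul ?_
    (contDiffOn_comp_sigmaPoint (hK _)))
  · exact ((contDiff_height.comp contDiff_sigmaPoint).inv fun z => (height_pos _).ne').contDiffOn
  · exact (contDiff_const.add (ContDiff.div_const (by fun_prop) _)).contDiffOn

/-- The position vector `z` contracted with the inverse of the metric that `b` induces on `Σ_s`. -/
theorem sum_coord_mul_sum (z : E m) (k : Fin m → ℝ) :
    ∑ α : Fin m, z α * ∑ β : Fin m, ((if α = β then 1 else 0) + z α * z β / (1 + s ^ 2)) * k β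
      = height (sigmaPoint s z) ^ 2 / (1 + s ^ 2) * ∑ β : Fin m, z β * k β := by
  have hh : height (sigmaPoint s z) ^ 2 = 1 + s ^ 2 + ‖z‖ ^ 2 := by
    rw [height_sq, norm_sigmaPoint_sq]; ring
  have e1 : ∀ α : Fin m, z α * ∑ β : Fin m,
      ((if α = β then 1 else 0) + z α * z β / (1 + s ^ 2)) * k β
      = z α * k α + z α * z α * ((∑ β : Fin m, z β * k β) / (1 + s ^ 2)) := by
    intro α
    simp only [add_mul, Finset.sum_add_distrib, ite_mul, one_mul, zero_mul, Finset.sum_ite_eq,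
      Finset.mem_univ, if_true, mul_add, Finset.sum_div, Finset.mul_sum]
    congr 1
    exact Finset.sum_congr rfl fun β _ => by ring
  simp only [e1, Finset.sum_add_distrib]
  rw [← Finset.sum_mul, sum_sq_eq, hh]
  field_simp

/-- The divergence of `sigmaDensity`; the last term comes from the Christoffel symbols of the induced
metric. -/
theorem divWithin_sigmaDensity {K : Fin (m + 1) → E (m + 1) → ℝ}
    (hK : ∀ j, ContDiffOn ℝ ∞ (K j) (modelEnd s r₀)) {z : E m} (hz : r₀ < ‖sigmaPoint s z‖) :
    height (sigmaPoint s z) * divWithin univ (sigmaDensity s K) z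
      = (∑ α : Fin m, ∑ β : Fin m, ((if α = β then 1 else 0) + z α * z β / (1 + s ^ 2)) *
          pd (halfSpace s) (K β.succ) α.succ (sigmaPoint s z))
        + m / (1 + s ^ 2) * ∑ β : Fin m, z β * K β.succ (sigmaPoint s z) := by
  have hU := uniqueDiffWithinAt_univ (𝕜 := ℝ) (x := z)
  have hy := sigmaPoint_mem_modelEnd hz
  have hw : (1 + s ^ 2) ≠ 0 := by positivity
  have h0 := (height_pos (sigmaPoint s z)).ne'
  have dK := fun j => differentiableWithinAt_halfSpace (hK j) hy
  have dK' : ∀ j, DifferentiableWithinAt ℝ (fun z => K j (sigmaPoint s z)) univ z := fun j =>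
    (hasFDerivWithinAt_comp_sigmaPoint (dK j)).differentiableWithinAt
  have dh : DifferentiableWithinAt ℝ (fun z => (height (sigmaPoint s z))⁻¹) univ z :=
    (hasFDerivWithinAt_comp_sigmaPoint
      (f := fun y => (height y)⁻¹) differentiableWithinAt_height_inv).differentiableWithinAt
  have hc := fun k : Fin m => differentiableWithinAt_coord (S := univ) (y := z) k
  have dγ : ∀ α β : Fin m, DifferentiableWithinAt ℝ
      (fun z : E m => (if α = β then 1 else 0) + z α * z β / (1 + s ^ 2)) univ z := fun α β =>
    (differentiableWithinAt_const _).fun_add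
      (by simpa only [div_eq_mul_inv] using ((hc α).fun_mul (hc β)).mul_const (1 + s ^ 2)⁻¹)
  have pγ : ∀ α β : Fin m,
      pd univ (fun z : E m => (if α = β then 1 else 0) + z α * z β / (1 + s ^ 2)) α z
      = (z β + z α * if α = β then 1 else 0) / (1 + s ^ 2) := fun α β => by
    have e1 : (fun z : E m => (if α = β then (1 : ℝ) else 0) + z α * z β / (1 + s ^ 2))
        = fun z => (if α = β then 1 else 0) + (1 + s ^ 2)⁻¹ * (z α * z β) := by
      funext z; rw [div_eq_inv_mul]
    rw [e1, pd_add hU (differentiableWithinAt_const _) (((hc α).fun_mul (hc β)).const_mul _),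
      pd_const, pd_const_mul hU _ ((hc α).fun_mul (hc β)), pd_mul hU (hc α) (hc β), pd_coord hU,
      pd_coord hU, if_pos rfl]
    ring
  have h1 : ∀ α, pd univ (sigmaDensity s K α) α z
      = - z α * (height (sigmaPoint s z))⁻¹ ^ 3 * (∑ β : Fin m,
          ((if α = β then 1 else 0) + z α * z β / (1 + s ^ 2)) * K β.succ (sigmaPoint s z))
        + (height (sigmaPoint s z))⁻¹ * ∑ β : Fin m,
          ((z β + z α * if α = β then 1 else 0) / (1 + s ^ 2) * K β.succ (sigmaPoint s z)
          + ((if α = β then 1 else 0) + z α * z β / (1 + s ^ 2)) *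
            pd (halfSpace s) (K β.succ) α.succ (sigmaPoint s z)) := by
    intro α
    have d2 : ∀ β : Fin m, DifferentiableWithinAt ℝ (fun z : E m =>
      ((if α = β then 1 else 0) + z α * z β / (1 + s ^ 2)) * K β.succ (sigmaPoint s z)) univ z :=
      fun β => (dγ α β).fun_mul (dK' _)
    rw [show sigmaDensity s K α = fun z => (height (sigmaPoint s z))⁻¹ *
      ∑ β : Fin m, ((if α = β then 1 else 0) + z α * z β / (1 + s ^ 2)) *
        K β.succ (sigmaPoint s z) from rfl,
      pd_mul hU dh (DifferentiableWithinAt.fun_sum fun β _ => d2 β), pd_sum hU _ fun β _ => d2 β,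
      pd_comp_sigmaPoint (f := fun y => (height y)⁻¹) differentiableWithinAt_height_inv,
      pd_height_inv (uniqueDiffOn_halfSpace s _ hy.1), sigmaPoint_succ]
    congr 2
    refine Finset.sum_congr rfl fun β _ => ?_
    rw [pd_mul hU (dγ α β) (dK' _), pγ, pd_comp_sigmaPoint (dK _)]
  have h2 := sum_coord_mul_sum (s := s) z fun β => K β.succ (sigmaPoint s z)
  have h3 : ∑ α : Fin m, ∑ β : Fin m,
      (z β + z α * if α = β then 1 else 0) / (1 + s ^ 2) * K β.succ (sigmaPoint s z)
      = (m + 1) / (1 + s ^ 2) * ∑ β : Fin m, z β * K β.succ (sigmaPoint s z) := by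
    have e1 : ∀ α : Fin m, ∑ β : Fin m,
        (z β + z α * if α = β then 1 else 0) / (1 + s ^ 2) * K β.succ (sigmaPoint s z)
        = (∑ β : Fin m, z β * K β.succ (sigmaPoint s z)) / (1 + s ^ 2)
          + z α * K α.succ (sigmaPoint s z) / (1 + s ^ 2) := by
      intro α
      simp only [add_div, add_mul, Finset.sum_add_distrib, mul_ite, mul_one, mul_zero, ite_mul,
        ite_div, zero_div, zero_mul, Finset.sum_ite_eq, Finset.mem_univ, if_true, Finset.sum_div]
      congr 1
      · exact Finset.sum_congr rfl fun β _ => by ring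
      · ring
    simp only [e1, Finset.sum_add_distrib, Finset.sum_const, Finset.card_univ, Fintype.card_fin,
      nsmul_eq_mul, ← Finset.sum_div]
    ring
  have h4 : ∑ α : Fin m, (- z α * (height (sigmaPoint s z))⁻¹ ^ 3 * (∑ β : Fin m,
      ((if α = β then 1 else 0) + z α * z β / (1 + s ^ 2)) * K β.succ (sigmaPoint s z)))
      = - (height (sigmaPoint s z))⁻¹ ^ 3 * ∑ α : Fin m, z α * ∑ β : Fin m,
      ((if α = β then 1 else 0) + z α * z β / (1 + s ^ 2)) * K β.succ (sigmaPoint s z) := by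
    rw [Finset.mul_sum]
    exact Finset.sum_congr rfl fun α _ => by ring
  rw [divWithin]
  simp only [h1, Finset.sum_add_distrib]
  rw [h4, h2, ← Finset.mul_sum]
  simp only [Finset.sum_add_distrib]
  rw [h3]
  field_simp
  ring

end BoundaryDivergence

/-! ### Divergence of the conormal form along the boundary -/

section BoundaryIdentity

variable {m : ℕ} {s r₀ : ℝ} {V : E (m + 1) → ℝ} {G : MetricField (m + 1)} {y : E (m + 1)}

theorem deviation_hypMetric : deviation (hypMetric (m + 1)) y = 0 := by
  funext I; simp [deviation]

theorem gram_hypMetric : gram (hypMetric (m + 1)) y = 1 := by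
  rw [gram, deviation_hypMetric]
  ext a b
  simp [frameTensor]

theorem gramNormal_hypMetric (a : Fin (m + 1)) :
    gramNormal (hypMetric (m + 1)) y a = normalComp y a := by
  rw [gramNormal, gram_hypMetric, inv_one, sum_one_mul]

theorem gramNormalSq_hypMetric : gramNormalSq (hypMetric (m + 1)) y = 1 := by
  simp only [gramNormalSq, gramNormal_hypMetric, sum_normalComp_sq]

theorem gramTangential_hypMetric (a b : Fin (m + 1)) :
    gramTangential (hypMetric (m + 1)) y a b = tangentProj y a b := by
  rw [gramTangential, gram_hypMetric, gramNormal_hypMetric, gramNormal_hypMetric,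
    gramNormalSq_hypMetric, inv_one, div_one, tangentProj]

/-- Contraction with the inverse of the metric that `b` induces on `Σ_s`, in frame components. -/
theorem sum_sigmaInv_mul (z : E m) (F : Fin (m + 1) → Fin (m + 1) → ℝ) :
    ∑ α : Fin m, ∑ β : Fin m, ((if α = β then 1 else 0) + z α * z β / (1 + s ^ 2)) *
        F α.succ β.succ
      = ∑ a, ∑ b, tangentProj (sigmaPoint s z) a b * frameComp (frame (sigmaPoint s z))
        (fun i => frameComp (frame (sigmaPoint s z)) (fun j => F i j) b) a := by
  set y := sigmaPoint s z with hy
  have hd : IsUnit (hypMetric (m + 1) y).det := by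
    refine IsUnit.of_mul_eq_one (hypInv y).det ?_
    rw [← Matrix.det_mul, hypMetric_mul_hypInv, Matrix.det_one]
  have hw : (1 + s ^ 2) ≠ 0 := by positivity
  have hw' : (1 + y 0 ^ 2) ≠ 0 := by positivity
  have h0 : (hypMetric (m + 1) y)⁻¹ 0 0 ≠ 0 := by
    rw [hypMetric_inv, hypInv_zero_zero]; exact hw'
  have h1 := sum_inv_inducedMetric hd h0 F
  rw [sum_tangentialInv_mul (hypMetric_symm y)] at h1
  simp only [gramTangential_hypMetric] at h1
  rw [← h1, inv_inducedMetric hd h0]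
  refine Finset.sum_congr rfl fun α _ => Finset.sum_congr rfl fun β _ => ?_
  congr 1
  have h00 : y 0 = s := rfl
  have hα : ∀ α : Fin m, y α.succ = z α := fun _ => rfl
  rw [Matrix.of_apply, tangentialInv, hypMetric_inv, hypInv_zero_zero, hypInv_symm y 0]
  simp only [hypInv, rankOneUpdate, Matrix.of_apply, h00, hα, Fin.succ_ne_zero, if_false,
    Fin.succ_inj]
  field_simp
  ring

theorem pd_conormalForm (hV : ContDiffOn ℝ ∞ V (modelEnd s r₀))
    (hG : ∀ i j, ContDiffOn ℝ ∞ (fun z => G z i j) (modelEnd s r₀)) (hy : y ∈ modelEnd s r₀)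
    (α : Fin m) (j : Fin (m + 1)) :
    pd (halfSpace s) (conormalForm V (deviation G) j) α.succ y
      = pd (halfSpace s) V α.succ y * (∑ i, hypInv y i 0 * deviation G y ![j, i])
        + V y * (y 0 * deviation G y ![j, α.succ]
          + (∑ i, hypInv y i 0 * devDeriv s G y ![α.succ, j, i])
          - hypMetric (m + 1) y α.succ j *
            ∑ i, hypInv y i 0 * ∑ p, y p * deviation G y ![p, i]) := by
  have hS := uniqueDiffOn_halfSpace s y hy.1
  have he := contDiffOn_deviation hG
  have hc := fun k : Fin (m + 1) => differentiableWithinAt_coord (S := halfSpace s) (y := y) k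
  have dV := differentiableWithinAt_halfSpace hV hy
  have de := fun I => differentiableWithinAt_halfSpace (he I) hy
  have dβ := fun i => differentiableWithinAt_halfSpace
    (contDiffOn_hypInv (m := m) i 0 (S := modelEnd s r₀)) hy
  have pβ : ∀ i, pd (halfSpace s) (fun z : E (m + 1) => hypInv z i 0) α.succ y
      = if α.succ = i then y 0 else 0 := by
    intro i
    have : (fun z : E (m + 1) => hypInv z i 0) = fun z => (if i = 0 then 1 else 0) + z i * z 0 := by
      funext z; simp [hypInv, rankOneUpdate]
    rw [this, pd_add hS (differentiableWithinAt_const _) ((hc i).fun_mul (hc 0)), pd_const,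
      pd_mul hS (hc i) (hc 0), pd_coord hS, pd_coord hS, if_neg (Fin.succ_ne_zero α)]
    simp
  have ds : DifferentiableWithinAt ℝ (fun z => ∑ i, hypInv z i 0 * deviation G z ![j, i])
      (halfSpace s) y := DifferentiableWithinAt.fun_sum fun i _ => (dβ i).fun_mul (de _)
  rw [show conormalForm V (deviation G) j = fun z => V z * ∑ i, hypInv z i 0 *
    deviation G z ![j, i] from rfl, pd_mul hS dV ds, pd_sum hS _ fun i _ => (dβ i).fun_mul (de _)]
  congr 2
  simp only [pd_mul hS (dβ _) (de _), pβ, devDeriv, covDeriv_two hy.1]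
  have h1 : ∑ i, hypInv y i 0 * (hypMetric (m + 1) y α.succ i * ∑ p, y p * deviation G y ![j, p])
      = 0 := by
    have h2 : ∑ i, hypInv y 0 i * hypMetric (m + 1) y i α.succ = 0 := by
      rw [sum_hypInv_mul_hypMetric, if_neg (Fin.succ_ne_zero α).symm]
    have h3 : ∀ i, hypInv y i 0 * (hypMetric (m + 1) y α.succ i * ∑ p, y p * deviation G y ![j, p])
        = hypInv y 0 i * hypMetric (m + 1) y i α.succ * ∑ p, y p * deviation G y ![j, p] := fun i => by
      rw [hypInv_symm y i 0, hypMetric_symm y α.succ i]; ring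
    simp only [h3]
    rw [← Finset.sum_mul, h2, zero_mul]
  have h4 : ∑ i, hypInv y i 0 * (hypMetric (m + 1) y α.succ j * ∑ p, y p * deviation G y ![p, i])
      = hypMetric (m + 1) y α.succ j * ∑ i, hypInv y i 0 * ∑ p, y p * deviation G y ![p, i] := by
    rw [Finset.mul_sum]; exact Finset.sum_congr rfl fun i _ => by ring
  simp only [mul_add, Finset.sum_add_distrib, h1, h4, ite_mul, zero_mul, Finset.sum_ite_eq,
    Finset.mem_univ, if_true]
  ring

/-- The components of `dV` in the orthonormal frame. -/
noncomputable def gradFrame (s : ℝ) (V : E (m + 1) → ℝ) (y : E (m + 1)) (a : Fin (m + 1)) : ℝ :=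
  frameComp (frame y) (fun i => pd (halfSpace s) V i y) a

/-- The boundary condition `∂V/∂η = λ_s V` in frame components. -/
theorem sum_normalComp_gradFrame (hV : IsStaticPotential s V) (hy : y 0 = s) :
    ∑ a, normalComp y a * gradFrame s V y a = lam s * V y := by
  have h := hV.boundary_eq y hy
  have hw := sqrt_one_add_sq_pos s
  have h1 : ∑ i, outwardNormal (hypMetric (m + 1)) y i * pd (halfSpace s) V i y
      = (∑ i, hypInv y i 0 * pd (halfSpace s) V i y) / Real.sqrt (1 + s ^ 2) := by
    rw [Finset.sum_div]
    refine Finset.sum_congr rfl fun i _ => ?_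
    rw [outwardNormal, hypMetric_inv, hypInv_zero_zero, hy]; ring
  rw [h1, sum_hypInv_zero_mul, hy, mul_div_cancel_left₀ _ hw.ne'] at h
  exact h

theorem frameComp_sum_deviation (b : Fin (m + 1)) :
    frameComp (frame y) (fun j => ∑ i, hypInv y i 0 * deviation G y ![j, i]) b
      = Real.sqrt (1 + y 0 ^ 2) * normalDev G y b := by
  simp only [sum_hypInv_zero_mul, frameComp_mul_left, frameComp_sum, normalDev, frameTensor_two]
  congr 1
  exact Finset.sum_congr rfl fun a _ => by rw [mul_comm]

theorem sum_tangentProj_self : ∑ a, tangentProj y a a = m := by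
  simp only [tangentProj, Finset.sum_sub_distrib, sum_normalComp_sq, Matrix.one_apply_eq]
  simp

theorem sum_sum_tangentProj_mul (f : Fin (m + 1) → Fin (m + 1) → ℝ) :
    ∑ a, ∑ b, tangentProj y a b * f a b
      = (∑ a, f a a) - ∑ a, ∑ b, normalComp y a * normalComp y b * f a b := by
  simp only [tangentProj, sub_mul, Finset.sum_sub_distrib, sum_one_mul]

/-- The divergence along `Σ_s` of the tangential part of `V e(η, ·)`. -/
theorem divWithin_sigmaDensity_conormalForm (hV : ContDiffOn ℝ ∞ V (modelEnd s r₀))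
    (hG : ∀ i j, ContDiffOn ℝ ∞ (fun z => G z i j) (modelEnd s r₀))
    (hs : ∀ z ∈ modelEnd s r₀, ∀ i j, G z i j = G z j i) {z : E m}
    (hz : r₀ < ‖sigmaPoint s z‖) (hy : y = sigmaPoint s z) :
    height y * divWithin univ (sigmaDensity s (conormalForm V (deviation G))) z
      = Real.sqrt (1 + s ^ 2) * ((∑ a, ∑ b, tangentProj y a b * (gradFrame s V y a * normalDev G y b))
        + V y * (lam s * (∑ a, ∑ b, tangentProj y a b * frameTensor (frame y) (deviation G y) ![a, b])
          + (∑ a, ∑ b, tangentProj y a b * ∑ c, normalComp y c *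
            frameTensor (frame y) (devDeriv s G y) ![a, b, c])
          - m * lam s * normalNormalDev G y)) := by
  have hmem : y ∈ modelEnd s r₀ := hy ▸ sigmaPoint_mem_modelEnd hz
  have h00 : y 0 = s := hy ▸ rfl
  have hsuc : ∀ β : Fin m, z β = y β.succ := fun β => hy ▸ rfl
  have hsym := deviation_symm hs y hmem
  have hw := sqrt_one_add_sq_pos s
  have hw2 : Real.sqrt (1 + s ^ 2) ^ 2 = 1 + s ^ 2 := Real.sq_sqrt (by positivity)
  set Q := ∑ i, hypInv y i 0 * ∑ p, y p * deviation G y ![p, i] with hQ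
  set Z := ∑ i, hypInv y i 0 * deviation G y ![0, i] with hZ
  rw [hy, divWithin_sigmaDensity (contDiffOn_conormalForm hV (contDiffOn_deviation hG)) hz]
  have h1 : ∀ α β : Fin m, pd (halfSpace s) (conormalForm V (deviation G) β.succ) α.succ
      (sigmaPoint s z) = (fun i j => pd (halfSpace s) V i y * (∑ p, hypInv y p 0 * deviation G y ![j, p])
        + V y * (s * deviation G y ![i, j] + (∑ p, hypInv y p 0 * devDeriv s G y ![i, j, p])
          - Q * hypMetric (m + 1) y i j)) (Fin.succ α) (Fin.succ β) := by
    intro α β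
    rw [← hy, pd_conormalForm hV hG hmem, h00, hsym β.succ, ← hQ]
    ring
  simp only [h1]
  rw [sum_sigmaInv_mul z (fun i j => pd (halfSpace s) V i y * (∑ p, hypInv y p 0 *
    deviation G y ![j, p]) + V y * (s * deviation G y ![i, j] + (∑ p, hypInv y p 0 *
      devDeriv s G y ![i, j, p]) - Q * hypMetric (m + 1) y i j)), ← hy]
  simp only [frameComp_add, frameComp_sub, frameComp_mul_left, frameComp_mul_right,
    frameComp_sum_deviation]
  have h3 : ∀ a b, frameComp (frame y) (fun i => frameComp (frame y)
      (fun j => hypMetric (m + 1) y i j) b) a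
      = (1 : Matrix (Fin (m + 1)) (Fin (m + 1)) ℝ) a b := fun a b => by
    rw [← mul_mul_apply_eq_frameComp _ (frame_symm y), frame_mul_hypMetric_mul_frame]
  have h4 : ∀ a b, frameComp (frame y) (fun i => frameComp (frame y)
      (fun j => deviation G y ![i, j]) b) a = frameTensor (frame y) (deviation G y) ![a, b] :=
    fun a b => (frameTensor_two _ _ _ _).symm
  have h5 : ∀ a b, frameComp (frame y) (fun i => frameComp (frame y)
      (fun j => ∑ p, hypInv y p 0 * devDeriv s G y ![i, j, p]) b) a
      = Real.sqrt (1 + s ^ 2) * ∑ c, normalComp y c *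
        frameTensor (frame y) (devDeriv s G y) ![a, b, c] := fun a b => by
    simp only [sum_hypInv_zero_mul, frameComp_mul_left, frameComp_sum, frameTensor_three, h00]
  simp only [h3, h4, h5]
  -- the term `-Q b` contributes `-m Q`, which cancels against the last term of
  -- `divWithin_sigmaDensity`
  have h6 : ∑ a, ∑ b, tangentProj y a b * (1 : Matrix (Fin (m + 1)) (Fin (m + 1)) ℝ) a b = m := by
    rw [← sum_tangentProj_self (y := y)]
    simp [Matrix.one_apply]
  have h7 : ∑ β : Fin m, z β * conormalForm V (deviation G) β.succ y = V y * (Q - s * Z) := by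
    have e1 : ∑ j, y j * ∑ i, hypInv y i 0 * deviation G y ![j, i] = Q := by
      rw [hQ]
      simp only [Finset.mul_sum]
      rw [Finset.sum_comm]
      exact Finset.sum_congr rfl fun i _ => Finset.sum_congr rfl fun j _ => by ring
    rw [Fin.sum_univ_succ, h00] at e1
    rw [← e1, ← hZ, add_sub_cancel_left, Finset.mul_sum]
    refine Finset.sum_congr rfl fun β _ => ?_
    rw [hsuc, conormalForm]; ring
  have h8 : s * Q + Z = (1 + s ^ 2) * normalNormalDev G y := by
    have e1 : ∀ q, hypInv y q 0 = (if q = 0 then 1 else 0) + y q * s := fun q => by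
      simp [hypInv, rankOneUpdate, h00]
    have e2 : ∑ p, hypInv y p 0 * ∑ i, hypInv y i 0 * deviation G y ![p, i] = s * Q + Z := by
      have : ∀ p, hypInv y p 0 * ∑ i, hypInv y i 0 * deviation G y ![p, i]
          = (if p = 0 then 1 else 0) * (∑ i, hypInv y i 0 * deviation G y ![p, i])
            + s * ∑ i, hypInv y i 0 * (y p * deviation G y ![p, i]) := by
        intro p
        have e3 : ∑ i, hypInv y i 0 * (y p * deviation G y ![p, i])
            = y p * ∑ i, hypInv y i 0 * deviation G y ![p, i] := by
          rw [Finset.mul_sum]; exact Finset.sum_congr rfl fun i _ => by ring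
        rw [e3]
        nth_rewrite 1 [e1]
        ring
      simp only [this, Finset.sum_add_distrib, ite_mul, one_mul, zero_mul, Finset.sum_ite_eq',
        Finset.mem_univ, if_true]
      rw [← hZ, add_comm, ← Finset.mul_sum, hQ, Finset.sum_comm]
      simp only [Finset.mul_sum]
    rw [← e2, sum_hypInv_zero_mul, h00]
    simp only [frameComp_sum_deviation, h00]
    have e4 : ∑ a, normalComp y a * (Real.sqrt (1 + s ^ 2) * normalDev G y a)
        = Real.sqrt (1 + s ^ 2) * normalNormalDev G y := by
      rw [normalNormalDev, Finset.mul_sum]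
      exact Finset.sum_congr rfl fun a _ => by ring
    rw [e4, ← mul_assoc, ← sq, hw2]
  have h9 : ∀ (c : ℝ) (f : Fin (m + 1) → Fin (m + 1) → ℝ), ∑ a, ∑ b, tangentProj y a b * (c * f a b)
      = c * ∑ a, ∑ b, tangentProj y a b * f a b := by
    intro c f; simp only [Finset.mul_sum, mul_left_comm]
  have h10 : ∀ a b, frameComp (frame y) (fun i => pd (halfSpace s) V i y) a *
      (Real.sqrt (1 + y 0 ^ 2) * normalDev G y b)
      = Real.sqrt (1 + s ^ 2) * (gradFrame s V y a * normalDev G y b) := fun a b => by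
    rw [gradFrame, h00]; ring
  simp only [h10, mul_add, mul_sub, Finset.sum_add_distrib, Finset.sum_sub_distrib, h9]
  have h11 : m / (1 + s ^ 2) * (V y * (Q - s * Z)) = m * V y * (Q - s * normalNormalDev G y) := by
    have h12 : Z = (1 + s ^ 2) * normalNormalDev G y - s * Q := by linarith
    have : (1 + s ^ 2) ≠ 0 := by positivity
    rw [h12]
    field_simp
    ring
  have hl : Real.sqrt (1 + s ^ 2) * lam s = s := mul_div_cancel₀ _ hw.ne'
  have h13 : ∑ a, ∑ b, tangentProj y a b * (Q * (1 : Matrix (Fin (m + 1)) (Fin (m + 1)) ℝ) a b)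
      = Q * m :=
    (h9 Q fun a b => (1 : Matrix (Fin (m + 1)) (Fin (m + 1)) ℝ) a b).trans (congrArg (Q * ·) h6)
  rw [h7, h11, h13]
  set A := ∑ a, ∑ b, tangentProj y a b * frameTensor (frame y) (deviation G y) ![a, b]
  linear_combination (m * V y * normalNormalDev G y - V y * A) * hl

end BoundaryIdentity

/-! ### The boundary integrand -/

section BoundaryCharge

variable {m : ℕ} {s r₀ σ : ℝ} {V : E (m + 1) → ℝ} {G : MetricField (m + 1)} {y : E (m + 1)}

theorem frameComp_divTwo (a : Fin (m + 1)) :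
    frameComp (frame y) (fun i => divTwo (halfSpace s) (hypMetric (m + 1)) (deviation G) i y) a
      = ∑ b, frameTensor (frame y) (devDeriv s G y) ![b, b, a] := by
  have h := fun b => frameComp_three_perm (frame y) (σ := ![1, 2, 0]) (by decide)
    (devDeriv s G y) a b b
  simp [comp_vecCons, comp_vecEmpty] at h
  simp only [divTwo_hypMetric, sum_mul_eq_sum_frameComp (frame y) (hypInv_eq_sum y), frameComp_sum]
  exact Finset.sum_congr rfl fun b _ => h b

theorem frameComp_pd_traceTwo (hG : ∀ i j, ContDiffOn ℝ ∞ (fun z => G z i j) (modelEnd s r₀))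
    (hy : y ∈ modelEnd s r₀) (a : Fin (m + 1)) :
    frameComp (frame y)
        (fun i => pd (halfSpace s) (traceTwo (hypMetric (m + 1)) (deviation G)) i y) a
      = ∑ b, frameTensor (frame y) (devDeriv s G y) ![a, b, b] := by
  simp only [pd_traceTwo (contDiffOn_deviation hG) hy,
    sum_mul_eq_sum_frameComp (frame y) (hypInv_eq_sum y), frameComp_sum, frameTensor_three]
  rfl

theorem frameComp_gradContraction (a : Fin (m + 1)) :
    frameComp (frame y) (fun i => gradContraction (halfSpace s) V (deviation G) i y) a
      = ∑ b, gradFrame s V y b * frameTensor (frame y) (deviation G y) ![b, a] := by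
  simp only [gradContraction, sum_mul_eq_sum_frameComp (frame y) (hypInv_eq_sum y), frameComp_sum,
    frameComp_mul_left, frameComp_mul_right, frameTensor_two]
  refine Finset.sum_congr rfl fun b _ => ?_
  rw [frameComp_comm]
  rfl

/-- The normal component of the charge along `Σ_s`. -/
theorem vectorDensity_charge_zero (hV : IsStaticPotential s V)
    (hG : ∀ i j, ContDiffOn ℝ ∞ (fun z => G z i j) (modelEnd s r₀))
    (hy : y ∈ modelEnd s r₀) (h0 : y 0 = s) :
    height y * vectorDensity (charge (halfSpace s) (hypMetric (m + 1)) V (deviation G)) 0 y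
      = Real.sqrt (1 + s ^ 2) * (V y *
          ((∑ a, normalComp y a * ∑ b, frameTensor (frame y) (devDeriv s G y) ![b, b, a])
          - ∑ a, normalComp y a * ∑ b, frameTensor (frame y) (devDeriv s G y) ![a, b, b])
        - (∑ b, gradFrame s V y b * normalDev G y b)
        + (∑ a, frameTensor (frame y) (deviation G y) ![a, a]) * (lam s * V y)) := by
  rw [vectorDensity, ← mul_assoc, mul_inv_cancel₀ (height_pos y).ne', one_mul]
  simp only [hypInv_symm y 0]
  rw [sum_hypInv_zero_mul, h0]
  congr 1
  simp only [charge_eq, frameComp_add, frameComp_sub, frameComp_mul_left, frameComp_divTwo,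
    frameComp_pd_traceTwo hG hy, frameComp_gradContraction, traceTwo_eq_sum_frameTensor]
  rw [← sum_normalComp_gradFrame hV h0]
  simp only [mul_add, mul_sub, Finset.sum_add_distrib, Finset.sum_sub_distrib]
  congr 1
  · congr 1
    · simp only [Finset.mul_sum, mul_left_comm]
    · simp only [normalDev, Finset.mul_sum]
      rw [Finset.sum_comm]
      exact Finset.sum_congr rfl fun a _ => Finset.sum_congr rfl fun b _ => by ring
  · rw [Finset.mul_sum]
    exact Finset.sum_congr rfl fun a _ => by rw [gradFrame]; ring

/-- On `Σ_s` the conormal component of the charge and the tangential divergence of `V e(η, ·)`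
combine to `-2V` times the linearized mean curvature: the boundary condition on `V` removes all
terms with derivatives of `V`. -/
theorem vectorDensity_charge_add_divWithin (hV : IsStaticPotential s V)
    (hG : ∀ i j, ContDiffOn ℝ ∞ (fun z => G z i j) (modelEnd s r₀))
    (hs : ∀ z ∈ modelEnd s r₀, ∀ i j, G z i j = G z j i) {z : E m}
    (hz : r₀ < ‖sigmaPoint s z‖) (hy : y = sigmaPoint s z) :
    height y * (vectorDensity (charge (halfSpace s) (hypMetric (m + 1)) V (deviation G)) 0 y
        + divWithin univ (sigmaDensity s (conormalForm V (deviation G))) z)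
      = -2 * Real.sqrt (1 + s ^ 2) * V y * meanLinear s G y := by
  have hmem : y ∈ modelEnd s r₀ := hy ▸ sigmaPoint_mem_modelEnd hz
  have h0 : y 0 = s := hy ▸ rfl
  rw [mul_add, vectorDensity_charge_zero hV hG hmem h0,
    divWithin_sigmaDensity_conormalForm (contDiffOn_modelEnd_of_isStaticPotential hV) hG hs hz hy,
    meanLinear, h0]
  set A := ∑ a, normalComp y a * ∑ b, frameTensor (frame y) (devDeriv s G y) ![b, b, a] with hA
  set B := ∑ a, normalComp y a * ∑ b, frameTensor (frame y) (devDeriv s G y) ![a, b, b] with hB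
  set g := ∑ b, gradFrame s V y b * normalDev G y b with hg
  set tr := ∑ a, frameTensor (frame y) (deviation G y) ![a, a] with htr
  set C := ∑ a, ∑ b, tangentProj y a b * ∑ c, normalComp y c *
    frameTensor (frame y) (devDeriv s G y) ![a, b, c] with hC
  set D := ∑ a, ∑ b, tangentProj y a b * ∑ c, normalComp y c *
    frameTensor (frame y) (devDeriv s G y) ![c, a, b] with hD
  have h1 : ∑ a, ∑ b, tangentProj y a b * (gradFrame s V y a * normalDev G y b)
      = g - lam s * V y * normalNormalDev G y := by
    rw [sum_sum_tangentProj_mul, ← sum_normalComp_gradFrame hV h0, normalNormalDev,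
      Finset.sum_mul_sum]
    congr 1
    exact Finset.sum_congr rfl fun a _ => Finset.sum_congr rfl fun b _ => by ring
  have h2 : ∑ a, ∑ b, tangentProj y a b * frameTensor (frame y) (deviation G y) ![a, b]
      = tr - normalNormalDev G y := by
    rw [sum_sum_tangentProj_mul, normalNormalDev]
    congr 1
    refine Finset.sum_congr rfl fun a _ => ?_
    rw [normalDev, Finset.mul_sum]
    exact Finset.sum_congr rfl fun b _ => by ring
  have h3 : ∑ a, ∑ b, tangentProj y a b * ∑ c, normalComp y c * koszulFrame s G a c b y
      = 2 * C - D := by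
    have e1 : C = ∑ a, ∑ b, tangentProj y a b * ∑ c, normalComp y c *
        frameTensor (frame y) (devDeriv s G y) ![b, a, c] := by
      rw [hC, Finset.sum_comm]
      refine Finset.sum_congr rfl fun a _ => Finset.sum_congr rfl fun b _ => ?_
      congr 1
      simp only [tangentProj, Matrix.one_apply, eq_comm (a := a)]
      ring
    rw [two_mul]
    nth_rewrite 2 [e1]
    rw [hC, hD, ← Finset.sum_add_distrib, ← Finset.sum_sub_distrib]
    refine Finset.sum_congr rfl fun a _ => ?_
    rw [← Finset.sum_add_distrib, ← Finset.sum_sub_distrib]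
    refine Finset.sum_congr rfl fun b _ => ?_
    rw [← mul_add, ← mul_sub, ← Finset.sum_add_distrib, ← Finset.sum_sub_distrib]
    congr 1
    exact Finset.sum_congr rfl fun c _ => by rw [koszulFrame]; ring
  -- the purely normal components drop out of the difference
  have h4 : C - D = A - B := by
    have e1 : ∑ a, ∑ b, normalComp y a * normalComp y b * ∑ c, normalComp y c *
          frameTensor (frame y) (devDeriv s G y) ![a, b, c]
        = ∑ a, ∑ b, normalComp y a * normalComp y b * ∑ c, normalComp y c *
          frameTensor (frame y) (devDeriv s G y) ![c, a, b] := by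
      simp only [Finset.mul_sum]
      conv_rhs =>
        enter [2, a]
        rw [Finset.sum_comm]
      conv_rhs => rw [Finset.sum_comm]
      exact Finset.sum_congr rfl fun a _ => Finset.sum_congr rfl fun b _ =>
        Finset.sum_congr rfl fun c _ => by ring
    have e2 : A = ∑ a, ∑ c, normalComp y c * frameTensor (frame y) (devDeriv s G y) ![a, a, c] := by
      rw [hA, Finset.sum_comm]; simp only [Finset.mul_sum]
    have e3 : B = ∑ a, ∑ c, normalComp y c * frameTensor (frame y) (devDeriv s G y) ![c, a, a] := by
      rw [hB, Finset.sum_comm]; simp only [Finset.mul_sum]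
    rw [hC, hD, sum_sum_tangentProj_mul, sum_sum_tangentProj_mul, e1, e2, e3]
    ring
  rw [h1, h2, h3]
  linear_combination (Real.sqrt (1 + s ^ 2) * V y) * (-h4)

theorem one_lt_norm_of_lt_norm_sigmaPoint {R : ℝ} {z : E m} (hR : 1 + |s| ≤ R) (hz : R < ‖sigmaPoint s z‖) :
    1 < ‖z‖ := by
  have h := norm_sigmaPoint_sq s z
  by_contra! h1
  have h2 : ‖z‖ ^ 2 ≤ 1 := by nlinarith [norm_nonneg z]
  have h3 : (1 + |s|) ^ 2 < ‖sigmaPoint s z‖ ^ 2 :=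
    pow_lt_pow_left₀ (hR.trans_lt hz) (by positivity) two_ne_zero
  nlinarith [abs_nonneg s, sq_abs s]

/-- The boundary integrand of `exists_tendsto_fluxDifference` is integrable near infinity. -/
theorem exists_integrableOn_boundary_charge (hV : IsStaticPotential s V)
    (hG : ∀ i j, ContDiffOn ℝ ∞ (fun z => G z i j) (modelEnd s r₀))
    (hs : ∀ z ∈ modelEnd s r₀, ∀ i j, G z i j = G z j i)
    (hσ : ((m : ℝ) + 1) / 2 < σ)
    (he : tensorNorm (hypMetric (m + 1)) (deviation G) =O[atInfinity m s] fun y => ‖y‖ ^ (-σ))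
    (hE : tensorNorm (hypMetric (m + 1)) (devDeriv s G) =O[atInfinity m s] fun y => ‖y‖ ^ (-σ))
    (hint : IntegrableOn (fun z : E m => ‖sigmaPoint s z‖ *
      (meanCurvature (halfSpace s) G (sigmaPoint s z) - m * lam s) *
      Real.sqrt (inducedMetric G (sigmaPoint s z)).det) {z | r₀ < ‖sigmaPoint s z‖}) :
    ∃ R₀, ∀ R, R₀ ≤ R → IntegrableOn (fun z : E m =>
      vectorDensity (charge (halfSpace s) (hypMetric (m + 1)) V (deviation G)) 0 (sigmaPoint s z)
        + divWithin univ (sigmaDensity s (conormalForm V (deviation G))) z)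
      {z | R < ‖sigmaPoint s z‖} := by
  have hσ0 : 0 < σ := lt_trans (by positivity) hσ
  have hρ := tendsto_norm_rpow_neg (m := m) (s := s) hσ0
  obtain ⟨C₁, hC₁, hV₁⟩ := (isBigO_of_isStaticPotential hV).exists_pos
  obtain ⟨C₂, hC₂, hR₂⟩ := (isBigO_meanCurvature hρ he hE hG hs).exists_pos
  obtain ⟨R₁, hR₁⟩ := eventually_atInfinity.1 (hV₁.bound.and (hR₂.bound.and
    (((tendsto_det_gram hρ he).mul (tendsto_gramNormalSq hρ he)).eventually
      (lt_mem_nhds (show (1 / 4 : ℝ) < 1 * 1 by norm_num)))))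
  refine ⟨max (max r₀ R₁) (1 + |s|), fun R hR => ?_⟩
  have hr0 : r₀ ≤ R := ((le_max_left _ _).trans (le_max_left _ _)).trans hR
  have hr1 : R₁ ≤ R := ((le_max_right _ _).trans (le_max_left _ _)).trans hR
  have hR1 : 1 + |s| ≤ R := (le_max_right _ _).trans hR
  have hU : IsOpen {z : E m | R < ‖(sigmaPoint s z : E (m + 1))‖} :=
    isOpen_lt continuous_const contDiff_sigmaPoint.continuous.norm
  set w := Real.sqrt (1 + s ^ 2) with hw
  have hw0 : 0 < w := sqrt_one_add_sq_pos s
  have hpow : IntegrableOn (fun z : E m => ‖z‖ ^ (-(2 * σ))) {z | R < ‖(sigmaPoint s z : E (m + 1))‖} :=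
    (integrableOn_norm_rpow_neg (d := m) (τ := 2 * σ) (by linarith) le_rfl).mono_set
      fun z hz => one_lt_norm_of_lt_norm_sigmaPoint hR1 hz
  have hcont : ContinuousOn (fun z : E m =>
      vectorDensity (charge (halfSpace s) (hypMetric (m + 1)) V (deviation G)) 0 (sigmaPoint s z)
        + divWithin univ (sigmaDensity s (conormalForm V (deviation G))) z)
      {z | r₀ < ‖sigmaPoint s z‖} := by
    have hU0 : IsOpen {z : E m | r₀ < ‖(sigmaPoint s z : E (m + 1))‖} :=
      isOpen_lt continuous_const contDiff_sigmaPoint.continuous.norm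
    refine ContinuousOn.add (contDiffOn_comp_sigmaPoint (contDiffOn_vectorDensity
      (contDiffOn_charge hV (contDiffOn_deviation hG)) 0)).continuousOn ?_
    refine continuousOn_finsetSum _ fun α _ => ?_
    have h1 := contDiffOn_sigmaDensity (contDiffOn_conormalForm
      (contDiffOn_modelEnd_of_isStaticPotential hV) (contDiffOn_deviation hG)) α
    have h2 := h1.continuousOn_fderiv_of_isOpen hU0 (by simp)
    have h3 := h2.clm_apply (continuousOn_const (c := EuclideanSpace.single α (1 : ℝ)))
    exact h3.congr fun z hz => by rw [pd, fderivWithin_univ]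
  refine (((hint.mono_set fun z hz => hr0.trans_lt hz).norm.const_mul (4 * C₁)).add
    (hpow.const_mul (2 * w * C₁ * C₂))).mono'
    ((hcont.mono fun z hz => hr0.trans_lt hz).aestronglyMeasurable hU.measurableSet) ?_
  refine (ae_restrict_mem hU.measurableSet).mono fun z hz => ?_
  set y : E (m + 1) := sigmaPoint s z with hyz
  have hy : y ∈ modelEnd s R := sigmaPoint_mem_modelEnd hz
  have h00 : y 0 = s := rfl
  obtain ⟨hv, hsc, hdet⟩ := hR₁ y (modelEnd_mono hr1 hy)
  have hdiv := vectorDensity_charge_add_divWithin hV hG hs (hr0.trans_lt hz) hyz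
  have h0 := height_pos y
  have hz1 : 1 < ‖z‖ := one_lt_norm_of_lt_norm_sigmaPoint hR1 hz
  have hy1 : 1 ≤ ‖y‖ := by linarith [hy.2, abs_nonneg s]
  have hy0 : 0 < ‖y‖ := by linarith
  have hyh : ‖y‖ ≤ height y := Real.le_sqrt_of_sq_le (by linarith)
  have hzy : ‖z‖ ≤ ‖y‖ := by
    rw [hyz, norm_sigmaPoint]; exact Real.le_sqrt_of_sq_le (by nlinarith [sq_nonneg s])
  have hd : IsUnit (G y).det := by
    rw [det_gram] at hdet
    refine IsUnit.mk0 _ fun h => ?_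
    rw [h] at hdet; norm_num at hdet
  -- the measures induced by `G` and `b` on `Σ_s` are comparable
  have hdh : w ≤ 2 * (height y * Real.sqrt (inducedMetric G y).det) := by
    have h1 : height y ^ 2 * (inducedMetric G y).det = w ^ 2 * ((gram G y).det * gramNormalSq G y) := by
      rw [det_inducedMetric hd, det_gram, inv_zero_zero, h00, hw, Real.sq_sqrt (by positivity)]
      ring
    have h2 : height y * Real.sqrt (inducedMetric G y).det
        = w * Real.sqrt ((gram G y).det * gramNormalSq G y) := by
      rw [← Real.sqrt_sq h0.le, ← Real.sqrt_mul (by positivity), h1,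
        Real.sqrt_mul (by positivity), Real.sqrt_sq hw0.le]
    have h3 : (1 / 2 : ℝ) ≤ Real.sqrt ((gram G y).det * gramNormalSq G y) :=
      Real.le_sqrt_of_sq_le (by norm_num; linarith)
    rw [h2]
    nlinarith
  simp only [Real.norm_eq_abs, Pi.add_apply] at hv hsc ⊢
  rw [abs_of_pos hy0] at hv
  have hρρ : ‖y‖ ^ (-σ) * ‖y‖ ^ (-σ) = ‖y‖ ^ (-(2 * σ)) := by
    rw [← Real.rpow_add hy0]; congr 1; ring
  rw [hρρ, abs_of_pos (show 0 < ‖y‖ ^ (-(2 * σ)) by positivity), h00] at hsc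
  have hmono : ‖y‖ ^ (-(2 * σ)) ≤ ‖z‖ ^ (-(2 * σ)) :=
    Real.rpow_le_rpow_of_nonpos (by linarith) hzy (by linarith)
  set X := meanCurvature (halfSpace s) G y - m * lam s
  set D := vectorDensity (charge (halfSpace s) (hypMetric (m + 1)) V (deviation G)) 0 y
    + divWithin univ (sigmaDensity s (conormalForm V (deviation G))) z
  have hz0 : 0 < ‖z‖ ^ (-(2 * σ)) := Real.rpow_pos_of_pos (by linarith) _
  have hL : |meanLinear s G y| ≤ |X| + C₂ * ‖z‖ ^ (-(2 * σ)) := by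
    have h1 := abs_sub_abs_le_abs_sub (meanLinear s G y) X
    rw [abs_sub_comm (meanLinear s G y)] at h1
    have h2 := mul_le_mul_of_nonneg_left hmono hC₂.le
    linarith
  have h1 : height y * |D| ≤ 2 * w * ((C₁ * ‖y‖) * (|X| + C₂ * ‖z‖ ^ (-(2 * σ)))) := by
    rw [show height y * |D| = |height y * D| by rw [abs_mul, abs_of_pos h0], hdiv, abs_mul, abs_mul,
      abs_mul, abs_of_pos hw0, abs_neg, abs_two, mul_assoc (2 * w)]
    exact mul_le_mul_of_nonneg_left (mul_le_mul hv hL (abs_nonneg _) (by positivity)) (by positivity)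
  have h2 : 2 * w * ((C₁ * ‖y‖) * (|X| + C₂ * ‖z‖ ^ (-(2 * σ))))
      ≤ height y * (4 * C₁ * |‖y‖ * X * Real.sqrt (inducedMetric G y).det|
        + 2 * w * C₁ * C₂ * ‖z‖ ^ (-(2 * σ))) := by
    rw [abs_mul, abs_mul, abs_of_pos hy0, abs_of_nonneg (Real.sqrt_nonneg _)]
    have e1 : 2 * C₁ * ‖y‖ * |X| * w
        ≤ 2 * C₁ * ‖y‖ * |X| * (2 * (height y * Real.sqrt (inducedMetric G y).det)) :=
      mul_le_mul_of_nonneg_left hdh (by positivity)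
    have e2 : 2 * w * C₁ * C₂ * ‖z‖ ^ (-(2 * σ)) * ‖y‖
        ≤ 2 * w * C₁ * C₂ * ‖z‖ ^ (-(2 * σ)) * height y :=
      mul_le_mul_of_nonneg_left hyh (by positivity)
    linarith
  exact le_of_mul_le_mul_left (h1.trans h2) h0

end BoundaryCharge

/-! ### The mass functional as a difference of fluxes -/

section Mass

variable {m : ℕ} {s r₀ : ℝ} {V : E (m + 1) → ℝ}

/-- `|y|_b = |y| / √(1 + |y|²)` for the position vector `y`. -/
theorem hypSq_self {n : ℕ} (y : E n) : hypSq y y = (‖y‖ / height y) ^ 2 := by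
  have h : ∀ i, ∑ j, hypMetric n y i j * y i * y j = y i * y i * (height y ^ 2)⁻¹ := fun i => by
    have h1 := sum_hypMetric_mul (y := y) i
    calc _ = y i * ∑ j, hypMetric n y i j * y j := by
          rw [Finset.mul_sum]; exact Finset.sum_congr rfl fun j _ => by ring
      _ = _ := by rw [h1]; ring
  rw [hypSq, Finset.sum_congr rfl fun i _ => h i, ← Finset.sum_mul, sum_sq_eq]
  ring

/-- `⟨𝕌, μ⟩` is the radial component of the vector density: `b⁻¹ y = (1 + |y|²) y`, so that the factor
`√(1 + |y|²)` in `μ` cancels against `√det b`. -/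
theorem fluxDensity_eq_radialPart (e : TensorField (m + 1) 2) (y : E (m + 1)) :
    fluxDensity s V e y
      = radialPart (vectorDensity (charge (halfSpace s) (hypMetric (m + 1)) V e)) y := by
  have h0 := height_pos y
  rw [fluxDensity, radialPart, hypSq_self, Real.sqrt_sq (by positivity)]
  set U := charge (halfSpace s) (hypMetric (m + 1)) V e
  have h1 : ∀ i, vectorDensity U i y * (y i / ‖y‖)
      = ∑ j, (height y)⁻¹ * ‖y‖⁻¹ * (U j y * (hypInv y j i * y i)) := fun i => by
    rw [vectorDensity, Finset.mul_sum, Finset.sum_mul]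
    refine Finset.sum_congr rfl fun j _ => ?_
    rw [hypInv_symm y i j]
    ring
  simp only [h1]
  rw [Finset.sum_comm]
  refine Finset.sum_congr rfl fun j _ => ?_
  rw [← Finset.mul_sum, ← Finset.mul_sum, sum_hypInv_mul]
  rw [div_div_eq_mul_div, div_eq_mul_inv]
  field_simp

/-- `|(0, z)|_b` at the point `(s, z)`. -/
theorem hypSq_sigmaPoint (s : ℝ) (z : E m) :
    hypSq (sigmaPoint s z) (sigmaPoint 0 z)
      = (‖z‖ * Real.sqrt (1 + s ^ 2) / height (sigmaPoint s z)) ^ 2 := by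
  have hh : height (sigmaPoint s z) ^ 2 = 1 + s ^ 2 + ‖z‖ ^ 2 := by
    rw [height_sq, norm_sigmaPoint_sq]; ring
  have hn : 1 + ‖sigmaPoint s z‖ ^ 2 = 1 + s ^ 2 + ‖z‖ ^ 2 := by rw [norm_sigmaPoint_sq]; ring
  have h : ∀ i : Fin m, ∑ j : Fin m, hypMetric (m + 1) (sigmaPoint s z) i.succ j.succ * z i * z j
      = z i * z i - z i * z i * (‖z‖ ^ 2 / (1 + s ^ 2 + ‖z‖ ^ 2)) := fun i => by
    simp only [hypMetric, Matrix.of_apply, Fin.succ_inj, sigmaPoint_succ, hn, sub_mul, ite_mul,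
      one_mul, zero_mul, Finset.sum_sub_distrib, Finset.sum_ite_eq, Finset.mem_univ, if_true]
    rw [← sum_sq_eq z, Finset.sum_div, Finset.mul_sum]
    congr 1
    exact Finset.sum_congr rfl fun j _ => by ring
  rw [div_pow, hh, mul_pow, Real.sq_sqrt (by positivity)]
  simp only [hypSq, Fin.sum_univ_succ, sigmaPoint_zero, sigmaPoint_succ, mul_zero, zero_mul,
    Finset.sum_const_zero, zero_add, h, Finset.sum_sub_distrib, ← Finset.sum_mul, sum_sq_eq]
  field_simp
  ring

theorem cornerDensity_eq_radialPart {e : TensorField (m + 1) 2} {z : E m}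
    (hs : ∀ i j, e (sigmaPoint s z) ![i, j] = e (sigmaPoint s z) ![j, i]) :
    cornerDensity s V e z = radialPart (sigmaDensity s (conormalForm V e)) z := by
  have h0 := height_pos (sigmaPoint s z)
  have hw := sqrt_one_add_sq_pos s
  have hw2 : Real.sqrt (1 + s ^ 2) ^ 2 = 1 + s ^ 2 := Real.sq_sqrt (by positivity)
  rw [cornerDensity, radialPart, hypSq_sigmaPoint, Real.sqrt_sq (by positivity)]
  simp only [outwardNormal, hypMetric_inv, hypInv_zero_zero, sigmaPoint_zero]
  set w := Real.sqrt (1 + s ^ 2)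
  set h := height (sigmaPoint s z)
  have h1 : ∀ α : Fin m, sigmaDensity s (conormalForm V e) α z * (z α / ‖z‖)
      = h⁻¹ * ‖z‖⁻¹ * (z α * ∑ β : Fin m, ((if α = β then 1 else 0) + z α * z β / (1 + s ^ 2)) *
          conormalForm V e β.succ (sigmaPoint s z)) := fun α => by
    rw [sigmaDensity]; ring
  simp only [h1]
  rw [← Finset.mul_sum, sum_coord_mul_sum z fun β => conormalForm V e β.succ (sigmaPoint s z),
    Finset.sum_comm, Fin.sum_univ_succ]
  simp only [sigmaPoint_zero, sigmaPoint_succ, zero_div, mul_zero, Finset.sum_const_zero, zero_add,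
    Finset.mul_sum, conormalForm]
  refine Finset.sum_congr rfl fun β _ => Finset.sum_congr rfl fun i _ => ?_
  rw [hs i, ← hw2]
  change _ = h⁻¹ * ‖z‖⁻¹ * (h ^ 2 / _ * _)
  rw [div_div_eq_mul_div]
  field_simp

theorem massIntegral_eq_fluxDifference {m : ℕ} {V : E (m + 1 + 1) → ℝ}
    {e : TensorField (m + 1 + 1) 2} {r : ℝ} (hr : |s| ≤ r)
    (hs : ∀ y : E (m + 1 + 1), y 0 = s → ‖y‖ = r → ∀ i j, e y ![i, j] = e y ![j, i]) :
    massIntegral s V e r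
      = fluxDifference s (vectorDensity (charge (halfSpace s) (hypMetric (m + 1 + 1)) V e))
          (sigmaDensity s (conormalForm V e)) r := by
  simp only [massIntegral, fluxDifference, fluxDensity_eq_radialPart, Nat.add_sub_cancel]
  congr 2
  refine integral_congr_ae (Eventually.of_forall fun ξ => ?_)
  refine cornerDensity_eq_radialPart (hs _ rfl ?_)
  rw [norm_sigmaPoint, norm_smul, norm_eq_of_mem_sphere, mul_one, Real.norm_eq_abs, sq_abs,
    sqrt_sq_add_cornerRadius_sq hr]

end Mass

end AHMass

theorem theorem2p1 {m : ℕ} (hm : 1 ≤ m) (s : ℝ) {M : Type*} [TopologicalSpace M]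
    [ChartedSpace (EuclideanHalfSpace (m + 1)) M] [IsManifold (𝓡∂ (m + 1)) ∞ M]
    (g : Bundle.ContMDiffRiemannianMetric (𝓡∂ (m + 1)) ∞ (E (m + 1))
      (fun x : M => TangentSpace (𝓡∂ (m + 1)) x))
    (r₀ : ℝ) (F : E (m + 1) → M) (hF : IsAsymptoticallyHyperbolic g s r₀ F)
    (V : E (m + 1) → ℝ) (hV : IsStaticPotential s V) :
    (∀ᶠ r in atTop,
      IntegrableOn (fun ξ : Metric.sphere (0 : E (m + 1)) 1 =>
        fluxDensity s V (deviation (pullbackMetric g s r₀ F)) (r • (ξ : E (m + 1))))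
        (hemisphere m s r) (volume : Measure (E (m + 1))).toSphere ∧
      Integrable (fun ξ : Metric.sphere (0 : E m) 1 =>
        cornerDensity s V (deviation (pullbackMetric g s r₀ F)) (cornerRadius s r • (ξ : E m)))
        (volume : Measure (E m)).toSphere) ∧
    ∃ L : ℝ, Tendsto (massIntegral s V (deviation (pullbackMetric g s r₀ F))) atTop (𝓝 L) := by
  obtain ⟨m, rfl⟩ : ∃ k, m = k + 1 := ⟨m - 1, by omega⟩
  obtain ⟨σ, hσ, hdecay⟩ := hF.decay
  set G := pullbackMetric g s r₀ F
  set e := deviation G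
  have hG : ∀ i j, ContDiffOn ℝ ∞ (fun z => G z i j) (modelEnd s r₀) :=
    contDiffOn_pullbackMetric g hF.chart.smooth
  have hs : ∀ z, ∀ i j, G z i j = G z j i := pullbackMetric_symm g s r₀ F
  have hes : ∀ z i j, e z ![i, j] = e z ![j, i] := fun z i j => by
    have h1 := hs z i j
    have h2 := hypMetric_symm (y := z) i j
    simp only [e, deviation, Matrix.cons_val_zero, Matrix.cons_val_one, h1, h2]
  have hn : ∀ {k : ℕ} (T : TensorField (m + 1 + 1) k) (y), 0 ≤ tensorNorm (hypMetric _) T y :=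
    fun T y => Real.sqrt_nonneg _
  -- each of the three nonnegative norms is bounded by their sum
  have hbound : ∀ f : E (m + 1 + 1) → ℝ, (∀ y, 0 ≤ f y) → (∀ y, f y ≤ tensorNorm (hypMetric _) e y
      + tensorNorm (hypMetric _) (devDeriv s G) y + tensorNorm (hypMetric _) (devDerivTwo s G) y) →
      f =O[atInfinity (m + 1) s] fun y => ‖y‖ ^ (-σ) := fun f h0 hf =>
    (Asymptotics.isBigO_of_le _ fun y => by
      rw [Real.norm_of_nonneg (h0 y)]
      exact (hf y).trans (le_abs_self _)).trans hdecay
  have he := hbound _ (hn e) fun y => by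
    linarith [hn (devDeriv s G) y, hn (devDerivTwo s G) y]
  have hE := hbound _ (hn (devDeriv s G)) fun y => by linarith [hn e y, hn (devDerivTwo s G) y]
  have hN := hbound _ (hn (devDerivTwo s G)) fun y => by linarith [hn e y, hn (devDeriv s G) y]
  obtain ⟨R₁, hR₁⟩ := exists_integrableOn_divWithin_charge hV hG (fun z _ => hs z) hσ he hE hN
    hF.scalar_integrable
  obtain ⟨R₂, hR₂⟩ := exists_integrableOn_boundary_charge hV hG (fun z _ => hs z) hσ he hE
    hF.mean_integrable
  set J := vectorDensity (charge (halfSpace s) (hypMetric (m + 1 + 1)) V e)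
  set Y := sigmaDensity s (conormalForm V e)
  obtain ⟨R, hR⟩ : ∃ R, R = max (max r₀ |s|) (max R₁ R₂) := ⟨_, rfl⟩
  have hr0 : r₀ ≤ R := ((le_max_left _ _).trans (le_max_left _ _)).trans hR.ge
  have hrs : |s| ≤ R := ((le_max_right _ _).trans (le_max_left _ _)).trans hR.ge
  have hr1 : R₁ ≤ R := ((le_max_left _ _).trans (le_max_right _ _)).trans hR.ge
  have hr2 : R₂ ≤ R := ((le_max_right _ _).trans (le_max_right _ _)).trans hR.ge
  have hR0 : 0 ≤ R := hF.chart.pos.le.trans hr0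
  have hJ : ∀ i, ContDiffOn ℝ ∞ (J i) (modelEnd s R) := fun i =>
    (contDiffOn_vectorDensity (contDiffOn_charge hV (contDiffOn_deviation hG)) i).mono
      (modelEnd_mono hr0)
  have hYm : ∀ {ρ : ℝ}, |s| ≤ ρ → {z : E (m + 1) | cornerRadius s ρ < ‖z‖}
      ⊆ {z | ρ < ‖sigmaPoint s z‖} := fun {ρ} hρ z hz => by
    rw [mem_ofPred_eq, norm_sigmaPoint, ← sqrt_sq_add_cornerRadius_sq hρ]
    have := cornerRadius_nonneg s ρ
    exact Real.sqrt_lt_sqrt (by positivity) (by gcongr; exact hz)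
  have hY : ∀ i, ContDiffOn ℝ ∞ (Y i) {z | cornerRadius s R < ‖z‖} := fun i =>
    (contDiffOn_sigmaDensity (contDiffOn_conormalForm
      (contDiffOn_modelEnd_of_isStaticPotential hV) (contDiffOn_deviation hG)) i).mono
      ((hYm hrs).trans fun z hz => hr0.trans_lt hz)
  constructor
  · filter_upwards [eventually_gt_atTop R] with r hr
    constructor
    · simp only [fluxDensity_eq_radialPart]
      exact integrableOn_hemisphere hR0 hr (continuousOn_radialPart hR0 hJ)
    · simp only [cornerDensity_eq_radialPart (hes _)]
      have hρ : cornerRadius s R < cornerRadius s r := cornerRadius_lt hrs hr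
      have hρ0 : 0 < cornerRadius s r := (cornerRadius_nonneg s R).trans_lt hρ
      have hnorm : ∀ ξ : Metric.sphere (0 : E (m + 1)) 1,
          ‖cornerRadius s r • (ξ : E (m + 1))‖ = cornerRadius s r := fun ξ => by
        rw [norm_smul, norm_eq_of_mem_sphere, mul_one, Real.norm_of_nonneg hρ0.le]
      refine Continuous.integrable_of_hasCompactSupport ?_ (HasCompactSupport.of_compactSpace _)
      refine continuous_finsetSum _ fun i _ => Continuous.mul ?_ ?_
      · exact (hY i).continuousOn.comp_continuous (by fun_prop) fun ξ => by
          rw [mem_ofPred_eq, hnorm]; exact hρ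
      · simp only [hnorm]
        fun_prop
  · obtain ⟨L, hL⟩ := exists_tendsto_fluxDifference hrs hJ hY (hR₁ R hr1) (hR₂ R hr2)
    refine ⟨L, hL.congr' ?_⟩
    filter_upwards [eventually_ge_atTop R] with r hr
    exact (massIntegral_eq_fluxDifference (hrs.trans hr) fun y _ _ => hes y).symm
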